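/- **Setting.** Let $(\Omega,\Sigma,P)$ be a probability space. For $d\in\mathbb N$ consider families $(u_\varepsilon)_{\varepsilon\in(0,1]}$ of real-valued random fields $u_\varepsilon(x,\omega)$, $x\in\mathbb R^d$, $\omega\in\Omega$, such that $u_\varepsilon(x,\cdot)$ is measurable (with respect to the completion of $\Sigma$) for all $x$ and $\varepsilon$ and such that, for almost all $\omega$ and all $\varepsilon$, the path $x\mapsto u_\varepsilon(x,\omega)$ is $C^\infty$. For $1\le p\le\infty$ let $\mathcal E_{M,L^p}(\Omega,\mathbb R^d)$ (resp. $\mathcal N_{L^p}(\Omega,\mathbb R^d)$) be the set of those families for which all $\partial^\alpha u_\varepsilon(x,\cdot)$ belong to $L^p(\Omega)$ and, for all compact $K\subset\mathbb R^d$ and all $\alpha\in\mathbb N_0^d$, the numbers $\sup_{x\in K}\|\partial^\alpha u_\varepsilon(x)\|_{L^p(\Omega)}$ are finite for every $\varepsilon$ and are $O(\varepsilon^{-a})$ as $\varepsilon\to0$ for some $a\ge0$ (resp. $O(\varepsilon^{b})$ for every $b\ge0$). Put $\mathcal G_{L^p}(\Omega,\mathbb R^d)=\mathcal E_{M,L^p}(\Omega,\mathbb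 R^d)/\mathcal N_{L^p}(\Omega,\mathbb R^d)$. Partial derivatives, the product $\mathcal G_{L^\infty}\times\mathcal G_{L^p}\to\mathcal G_{L^p}$, and the restriction $u\mapsto u(\cdot,0)$ from $\mathcal G_{L^p}(\Omega,\mathbb R^2)$ to $\mathcal G_{L^p}(\Omega,\mathbb R)$ are defined on representatives. An element $v\in\mathcal G_{L^\infty}(\Omega,\mathbb R^2)$ is *uniformly bounded on strips* if it has a representative such that for every compact interval $I$ there is $c>0$ with $\sup_{x\in\mathbb R,\,t\in I}|v_\varepsilon(x,t,\omega)|\le c$ for almost all $\omega$ and all $\varepsilon\in(0,1]$. It is *of uniform local logarithmic type* if it has a representative such that for every compact $K\subset\mathbb R^2$ there is $c>0$ with $\sup_{(x,t)\in K}|v_\varepsilon(x,t,\omega)|\le c|\log\varepsilon|$ for almost all $\omega$ and all $\varepsilon\in(0,1]$. **Theorem 5.3.** Let $1\le p\le\infty$ and $n\in\mathbb N$. Let $\lambda=\mathrm{diag}(\lambda_1,\dots,\lambda_n)$ and $f=(f_{ij})_{i,j=1}^n$ have entries in $\mathcal G_{L^\infty}(\Omega,\mathbb R^2)$, let $g=(g_1,\dots,g_n)$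 have entries in $\mathcal G_{L^p}(\Omega,\mathbb R^2)$ and let $u_0=(u_{01},\dots,u_{0n})$ have entries in $\mathcal G_{L^p}(\Omega,\mathbb R)$. Assume that all $\lambda_i$ are uniformly bounded on strips and that all $\partial_x\lambda_i$ and all $f_{ij}$ are of uniform local logarithmic type. Then the Cauchy problem $$\big(\partial_t+\lambda(x,t)\,\partial_x\big)u=f(x,t)\,u+g(x,t),\quad (x,t)\in\mathbb R^2,\qquad u(x,0)=u_0(x),\quad x\in\mathbb R,$$ has a unique solution $u=(u_1,\dots,u_n)$ with entries in $\mathcal G_{L^p}(\Omega,\mathbb R^2)$, the equations being understood as equalities in $\mathcal G_{L^p}(\Omega,\mathbb R^2)$ and $\mathcal G_{L^p}(\Omega,\mathbb R)$, respectively. -/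

import Mathlib

open MeasureTheory
open scoped ENNReal NNReal

namespace ColombeauRF

/-! ## Nets of numbers -/

/-- The parameter set `(0, 1]` of the regularization parameter `ε`. -/
abbrev Eps : Type := Set.Ioc (0 : ℝ) 1

/-- `r_ε = O(ε ^ s)` as `ε → 0`, for a net of (extended) nonnegative numbers. -/
def IsBigOPow (r : Eps → ℝ≥0∞) (s : ℝ) : Prop :=
  ∃ C : ℝ≥0, ∃ η : ℝ, 0 < η ∧
    ∀ ε : Eps, (ε : ℝ) ≤ η → r ε ≤ (C : ℝ≥0∞) * ENNReal.ofReal ((ε : ℝ) ^ s)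

/-- Moderate nets: all members are finite, and `r_ε = O(ε ^ (-a))` for some `a ≥ 0`. -/
def ModerateNet (r : Eps → ℝ≥0∞) : Prop :=
  (∀ ε, r ε < ⊤) ∧ ∃ a : ℝ, 0 ≤ a ∧ IsBigOPow r (-a)

/-- Negligible nets: all members are finite, and `r_ε = O(ε ^ b)` for every `b ≥ 0`. -/
def NegligibleNet (r : Eps → ℝ≥0∞) : Prop :=
  (∀ ε, r ε < ⊤) ∧ ∀ b : ℝ, 0 ≤ b → IsBigOPow r b

/-! ## Partial derivatives -/

/-- The partial derivative `∂_i f` of a function on `ℝ^d`. -/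
noncomputable def partialD {d : ℕ} (i : Fin d) (f : (Fin d → ℝ) → ℝ) : (Fin d → ℝ) → ℝ :=
  fun x => fderiv ℝ f x (Pi.single i 1)

/-- Iterated partial derivatives along a word `i₁ i₂ … i_k` of coordinate directions.
For smooth functions partial derivatives commute, so the words of length `k` give exactly the
derivatives `∂^α`, `|α| = k`, where `α_j` counts the occurrences of `j` in the word. -/
noncomputable def iterPartial {d : ℕ} :
    List (Fin d) → ((Fin d → ℝ) → ℝ) → ((Fin d → ℝ) → ℝ)
  | [], f => f
  | i :: w, f => iterPartial w (partialD i f)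

/-! ## Families of random fields with smooth paths -/

section Families

variable {Ω : Type*} [MeasurableSpace Ω] {d : ℕ}

/-- Families `(u_ε)` of maps `ℝ^d × Ω → ℝ`, written `u ε x ω`. -/
abbrev Family (Ω : Type*) (d : ℕ) : Type _ := Eps → (Fin d → ℝ) → Ω → ℝ

/-- Pathwise iterated partial derivative of a family. -/
noncomputable def famD (w : List (Fin d)) (u : Family Ω d) : Family Ω d :=
  fun ε x ω => iterPartial w (fun y => u ε y ω) x

/-- For almost all `ω` and all `ε ∈ (0, 1]`, the path `x ↦ u_ε(x, ω)` is `C^∞`. -/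
def SmoothPaths (P : Measure Ω) (u : Family Ω d) : Prop :=
  ∀ᵐ ω ∂P, ∀ ε : Eps, ContDiff ℝ ((⊤ : ℕ∞) : WithTop ℕ∞) (fun x => u ε x ω)

/-- The net `ε ↦ sup_{x ∈ K} ‖u_ε(x)‖_{L^p(Ω)}`, with values in `[0, ∞]`. -/
noncomputable def supLp (P : Measure Ω) (p : ℝ≥0∞) (K : Set (Fin d → ℝ)) (u : Family Ω d) :
    Eps → ℝ≥0∞ :=
  fun ε => ⨆ x ∈ K, eLpNorm (u ε x) p P

/-- The family has almost surely smooth paths, all derivatives `∂^α u_ε(x)` belong to `L^p(Ω)`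
(which includes their measurability with respect to the completion of the σ-algebra), and for all
compact `K` and all `α` the net `sup_{x ∈ K} ‖∂^α u_ε(x)‖_{L^p(Ω)}` has the property `B`. -/
structure HasBounds (B : (Eps → ℝ≥0∞) → Prop) (P : Measure Ω) (p : ℝ≥0∞) (u : Family Ω d) :
    Prop where
  smooth : SmoothPaths P u
  memLp : ∀ (w : List (Fin d)) (ε : Eps) (x : Fin d → ℝ), MemLp (famD w u ε x) p P
  bound : ∀ K : Set (Fin d → ℝ), IsCompact K → ∀ w : List (Fin d), B (supLp P p K (famD w u))

/-! ### Facts used to see that the operations below are well defined -/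

/-- Closure properties shared by moderate and negligible nets. -/
structure NetClosed (B : (Eps → ℝ≥0∞) → Prop) : Prop where
  zero : B 0
  add : ∀ r s, B r → B s → B (r + s)
  mono : ∀ (C : ℝ≥0) (r s : Eps → ℝ≥0∞), (∀ ε, r ε ≤ C * s ε) → B s → B r

theorem IsBigOPow.zero (s : ℝ) : IsBigOPow 0 s :=
  ⟨0, 1, one_pos, fun ε _ => by simp⟩

theorem IsBigOPow.mono {r s : Eps → ℝ≥0∞} {C : ℝ≥0} {a : ℝ} (h : ∀ ε, r ε ≤ C * s ε)
    (hs : IsBigOPow s a) : IsBigOPow r a := by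
  obtain ⟨D, η, hη, H⟩ := hs
  refine ⟨C * D, η, hη, fun ε hε => (h ε).trans ?_⟩
  rw [ENNReal.coe_mul, mul_assoc]
  exact mul_le_mul_right (H ε hε) _

theorem IsBigOPow.weaken {r : Eps → ℝ≥0∞} {a b : ℝ} (hab : b ≤ a)
    (hr : IsBigOPow r a) : IsBigOPow r b := by
  obtain ⟨D, η, hη, H⟩ := hr
  refine ⟨D, η, hη, fun ε hε => (H ε hε).trans ?_⟩
  refine mul_le_mul_right (ENNReal.ofReal_le_ofReal ?_) _
  exact Real.rpow_le_rpow_of_exponent_ge ε.2.1 ε.2.2 hab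

theorem IsBigOPow.add {r s : Eps → ℝ≥0∞} {a : ℝ} (hr : IsBigOPow r a) (hs : IsBigOPow s a) :
    IsBigOPow (r + s) a := by
  obtain ⟨C, η, hη, H⟩ := hr
  obtain ⟨D, θ, hθ, G⟩ := hs
  refine ⟨C + D, min η θ, lt_min hη hθ, fun ε hε => ?_⟩
  rw [ENNReal.coe_add, add_mul]
  exact add_le_add (H ε (hε.trans (min_le_left _ _))) (G ε (hε.trans (min_le_right _ _)))

theorem IsBigOPow.mul {r s : Eps → ℝ≥0∞} {a b : ℝ} (hr : IsBigOPow r a) (hs : IsBigOPow s b) :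
    IsBigOPow (r * s) (a + b) := by
  obtain ⟨C, η, hη, H⟩ := hr
  obtain ⟨D, θ, hθ, G⟩ := hs
  refine ⟨C * D, min η θ, lt_min hη hθ, fun ε hε => ?_⟩
  rw [Real.rpow_add ε.2.1, ENNReal.ofReal_mul (Real.rpow_nonneg ε.2.1.le _), ENNReal.coe_mul,
    mul_mul_mul_comm]
  exact mul_le_mul' (H ε (hε.trans (min_le_left _ _))) (G ε (hε.trans (min_le_right _ _)))

theorem moderateNet_closed : NetClosed ModerateNet where
  zero := ⟨fun _ => by simp, 0, le_rfl, IsBigOPow.zero _⟩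
  add := by
    rintro r s ⟨hr, a, ha, hra⟩ ⟨hs, b, hb, hsb⟩
    refine ⟨fun ε => ENNReal.add_lt_top.2 ⟨hr ε, hs ε⟩, a + b, add_nonneg ha hb, ?_⟩
    exact (hra.weaken (by linarith)).add (hsb.weaken (by linarith))
  mono := by
    rintro C r s h ⟨hs, a, ha, hsa⟩
    exact ⟨fun ε => (h ε).trans_lt (ENNReal.mul_lt_top ENNReal.coe_lt_top (hs ε)), a, ha,
      hsa.mono h⟩

theorem negligibleNet_closed : NetClosed NegligibleNet where
  zero := ⟨fun _ => by simp, fun _ _ => IsBigOPow.zero _⟩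
  add := by
    rintro r s ⟨hr, hra⟩ ⟨hs, hsb⟩
    exact ⟨fun ε => ENNReal.add_lt_top.2 ⟨hr ε, hs ε⟩, fun b hb => (hra b hb).add (hsb b hb)⟩
  mono := by
    rintro C r s h ⟨hs, hsa⟩
    exact ⟨fun ε => (h ε).trans_lt (ENNReal.mul_lt_top ENNReal.coe_lt_top (hs ε)),
      fun b hb => (hsa b hb).mono h⟩

theorem ModerateNet.mul {r s : Eps → ℝ≥0∞} (hr : ModerateNet r) (hs : ModerateNet s) :
    ModerateNet (r * s) := by
  obtain ⟨hr, a, ha, hra⟩ := hr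
  obtain ⟨hs, b, hb, hsb⟩ := hs
  refine ⟨fun ε => ENNReal.mul_lt_top (hr ε) (hs ε), a + b, add_nonneg ha hb, ?_⟩
  rw [neg_add]
  exact hra.mul hsb

theorem ModerateNet.mul_negligible {r s : Eps → ℝ≥0∞} (hr : ModerateNet r)
    (hs : NegligibleNet s) : NegligibleNet (r * s) := by
  obtain ⟨hr, a, ha, hra⟩ := hr
  refine ⟨fun ε => ENNReal.mul_lt_top (hr ε) (hs.1 ε), fun b hb => ?_⟩
  have := hra.mul (hs.2 (a + b) (add_nonneg ha hb))
  rwa [neg_add_cancel_left] at this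

theorem NegligibleNet.mul_moderate {r s : Eps → ℝ≥0∞} (hr : NegligibleNet r)
    (hs : ModerateNet s) : NegligibleNet (r * s) := by
  rw [mul_comm]
  exact hs.mul_negligible hr

theorem contDiff_partialD {f : (Fin d → ℝ) → ℝ}
    (hf : ContDiff ℝ ((⊤ : ℕ∞) : WithTop ℕ∞) f) (i : Fin d) :
    ContDiff ℝ ((⊤ : ℕ∞) : WithTop ℕ∞) (partialD i f) :=
  (hf.fderiv_right (by simp)).clm_apply contDiff_const

theorem iterPartial_zero (w : List (Fin d)) :
    iterPartial w (fun _ : Fin d → ℝ => (0 : ℝ)) = fun _ => 0 := by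
  induction w with
  | nil => rfl
  | cons i w ih =>
    have : partialD i (fun _ : Fin d → ℝ => (0 : ℝ)) = fun _ => 0 := by
      funext x; simp [partialD]
    rw [iterPartial, this, ih]

theorem iterPartial_neg (w : List (Fin d)) (f : (Fin d → ℝ) → ℝ) :
    iterPartial w (fun x => -f x) = fun x => -iterPartial w f x := by
  induction w generalizing f with
  | nil => rfl
  | cons i w ih =>
    have : partialD i (fun x => -f x) = fun x => -partialD i f x := by
      funext x; simp [partialD]
    rw [iterPartial, this, ih]; rfl

theorem iterPartial_add (w : List (Fin d)) {f g : (Fin d → ℝ) → ℝ}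
    (hf : ContDiff ℝ ((⊤ : ℕ∞) : WithTop ℕ∞) f) (hg : ContDiff ℝ ((⊤ : ℕ∞) : WithTop ℕ∞) g) :
    iterPartial w (fun x => f x + g x) = fun x => iterPartial w f x + iterPartial w g x := by
  induction w generalizing f g with
  | nil => rfl
  | cons i w ih =>
    have : partialD i (fun x => f x + g x) = fun x => partialD i f x + partialD i g x := by
      funext x
      have h1 := hf.differentiable (by simp) x
      have h2 := hg.differentiable (by simp) x
      simp [partialD, fderiv_fun_add h1 h2]
    rw [iterPartial, this, ih (contDiff_partialD hf i) (contDiff_partialD hg i)]; rfl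

theorem partialD_mul {f g : (Fin d → ℝ) → ℝ}
    (hf : ContDiff ℝ ((⊤ : ℕ∞) : WithTop ℕ∞) f) (hg : ContDiff ℝ ((⊤ : ℕ∞) : WithTop ℕ∞) g)
    (i : Fin d) :
    partialD i (fun x => f x * g x) = fun x => partialD i f x * g x + f x * partialD i g x := by
  funext x
  have h1 := hf.differentiable (by simp) x
  have h2 := hg.differentiable (by simp) x
  simp [partialD, fderiv_fun_mul h1 h2]
  ring

/-- Two families with almost surely equal paths have the same bounds. -/
theorem HasBounds.congr {B : (Eps → ℝ≥0∞) → Prop} {P : Measure Ω} {p : ℝ≥0∞}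
    {u v : Family Ω d} (hu : HasBounds B P p u)
    (h : ∀ᵐ ω ∂P, ∀ ε x, u ε x ω = v ε x ω) : HasBounds B P p v := by
  have hD : ∀ w ε x, famD w u ε x =ᵐ[P] famD w v ε x := by
    intro w ε x
    filter_upwards [h] with ω hω
    have : (fun y => u ε y ω) = fun y => v ε y ω := funext fun y => hω ε y
    simp only [famD, this]
  refine ⟨?_, fun w ε x => (memLp_congr_ae (hD w ε x)).1 (hu.memLp w ε x), fun K hK w => ?_⟩
  · filter_upwards [hu.smooth, h] with ω h1 h2 ε
    have : (fun y => u ε y ω) = fun y => v ε y ω := funext fun y => h2 ε y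
    rw [← this]; exact h1 ε
  · have : supLp P p K (famD w v) = supLp P p K (famD w u) := by
      funext ε
      simp only [supLp]
      exact iSup_congr fun x => iSup_congr fun _ => eLpNorm_congr_ae (hD w ε x).symm
    rw [this]; exact hu.bound K hK w

theorem HasBounds.zero {B : (Eps → ℝ≥0∞) → Prop} (hB : NetClosed B) (P : Measure Ω)
    (p : ℝ≥0∞) : HasBounds B P p (0 : Family Ω d) := by
  have hD : ∀ w, famD w (0 : Family Ω d) = 0 := by
    intro w; funext ε x ω
    exact congrFun (iterPartial_zero w) x
  refine ⟨Filter.Eventually.of_forall fun ω ε => contDiff_const, fun w ε x => ?_,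
    fun K _ w => ?_⟩
  · rw [hD]; exact MemLp.zero
  · have : supLp P p K (famD w (0 : Family Ω d)) = 0 := by
      funext ε; simp [supLp, hD]
    rw [this]; exact hB.zero

theorem HasBounds.neg {B : (Eps → ℝ≥0∞) → Prop} {P : Measure Ω}
    {p : ℝ≥0∞} {u : Family Ω d} (hu : HasBounds B P p u) : HasBounds B P p (-u) := by
  have hD : ∀ w, famD w (-u) = -famD w u := by
    intro w; funext ε x ω
    exact congrFun (iterPartial_neg w _) x
  refine ⟨?_, fun w ε x => ?_, fun K hK w => ?_⟩
  · filter_upwards [hu.smooth] with ω h ε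
    exact (h ε).neg
  · rw [hD]; exact (hu.memLp w ε x).neg
  · have : supLp P p K (famD w (-u)) = supLp P p K (famD w u) := by
      funext ε; simp [supLp, hD]
    rw [this]; exact hu.bound K hK w

theorem HasBounds.add {B : (Eps → ℝ≥0∞) → Prop} (hB : NetClosed B) {P : Measure Ω}
    {p : ℝ≥0∞} {u v : Family Ω d} (hu : HasBounds B P p u) (hv : HasBounds B P p v) :
    HasBounds B P p (u + v) := by
  have hD : ∀ w ε x, famD w u ε x + famD w v ε x =ᵐ[P] famD w (u + v) ε x := by
    intro w ε x
    filter_upwards [hu.smooth, hv.smooth] with ω h1 h2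
    exact (congrFun (iterPartial_add w (h1 ε) (h2 ε)) x).symm
  refine ⟨?_, fun w ε x => ?_, fun K hK w => ?_⟩
  · filter_upwards [hu.smooth, hv.smooth] with ω h1 h2 ε
    exact (h1 ε).add (h2 ε)
  · exact (memLp_congr_ae (hD w ε x)).1 ((hu.memLp w ε x).add (hv.memLp w ε x))
  · refine hB.mono (ENNReal.LpAddConst p).toNNReal _ _ (fun ε => ?_)
      (hB.add _ _ (hu.bound K hK w) (hv.bound K hK w))
    rw [ENNReal.coe_toNNReal (ENNReal.LpAddConst_lt_top p).ne]
    refine iSup₂_le fun x hx => ?_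
    rw [← eLpNorm_congr_ae (hD w ε x)]
    refine (eLpNorm_add_le' (hu.memLp w ε x).1 (hv.memLp w ε x).1 p).trans ?_
    refine mul_le_mul_right (add_le_add ?_ ?_) _
    · exact le_iSup₂ (f := fun x (_ : x ∈ K) => eLpNorm (famD w u ε x) p P) x hx
    · exact le_iSup₂ (f := fun x (_ : x ∈ K) => eLpNorm (famD w v ε x) p P) x hx

theorem HasBounds.partialD {B : (Eps → ℝ≥0∞) → Prop} {P : Measure Ω}
    {p : ℝ≥0∞} {u : Family Ω d} (hu : HasBounds B P p u) (i : Fin d) :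
    HasBounds B P p (famD [i] u) := by
  refine ⟨?_, fun w => hu.memLp (i :: w), fun K hK w => hu.bound K hK (i :: w)⟩
  filter_upwards [hu.smooth] with ω h ε
  exact contDiff_partialD (h ε) i

theorem HasBounds.mul {B₁ B₂ B : (Eps → ℝ≥0∞) → Prop} (hB : NetClosed B)
    (hmul : ∀ r s, B₁ r → B₂ s → B (r * s)) {P : Measure Ω} {p : ℝ≥0∞}
    {u v : Family Ω d} (hu : HasBounds B₁ P ⊤ u) (hv : HasBounds B₂ P p v) :
    HasBounds B P p (u * v) := by
  have key : ∀ (w : List (Fin d)) (u v : Family Ω d), HasBounds B₁ P ⊤ u →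
      HasBounds B₂ P p v → (∀ ε x, MemLp (famD w (u * v) ε x) p P) ∧
        ∀ K, IsCompact K → B (supLp P p K (famD w (u * v))) := by
    intro w
    induction w with
    | nil =>
      intro u v hu hv
      refine ⟨fun ε x => (hv.memLp [] ε x).mul (hu.memLp [] ε x), fun K hK => ?_⟩
      refine hB.mono 1 _ _ (fun ε => ?_) (hmul _ _ (hu.bound K hK []) (hv.bound K hK []))
      rw [ENNReal.coe_one, one_mul]
      refine iSup₂_le fun x hx => ?_
      refine (eLpNorm_smul_le_eLpNorm_top_mul_eLpNorm p (hv.memLp [] ε x).1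
        (famD [] u ε x)).trans ?_
      refine mul_le_mul' ?_ ?_
      · exact le_iSup₂ (f := fun x (_ : x ∈ K) => eLpNorm (famD [] u ε x) ⊤ P) x hx
      · exact le_iSup₂ (f := fun x (_ : x ∈ K) => eLpNorm (famD [] v ε x) p P) x hx
    | cons i w ih =>
      intro u v hu hv
      obtain ⟨m1, b1⟩ := ih _ _ (hu.partialD i) hv
      obtain ⟨m2, b2⟩ := ih _ _ hu (hv.partialD i)
      have hD : ∀ ε x, famD w (famD [i] u * v) ε x + famD w (u * famD [i] v) ε x
          =ᵐ[P] famD (i :: w) (u * v) ε x := by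
        intro ε x
        filter_upwards [hu.smooth, hv.smooth] with ω h1 h2
        have e1 := partialD_mul (h1 ε) (h2 ε) i
        have e2 := congrFun (iterPartial_add w ((contDiff_partialD (h1 ε) i).mul (h2 ε))
          ((h1 ε).mul (contDiff_partialD (h2 ε) i))) x
        rw [← e1] at e2
        exact e2.symm
      refine ⟨fun ε x => (memLp_congr_ae (hD ε x)).1 ((m1 ε x).add (m2 ε x)), fun K hK => ?_⟩
      refine hB.mono (ENNReal.LpAddConst p).toNNReal _ _ (fun ε => ?_) (hB.add _ _ (b1 K hK) (b2 K hK))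
      rw [ENNReal.coe_toNNReal (ENNReal.LpAddConst_lt_top p).ne]
      refine iSup₂_le fun x hx => ?_
      rw [← eLpNorm_congr_ae (hD ε x)]
      refine (eLpNorm_add_le' (m1 ε x).1 (m2 ε x).1 p).trans ?_
      refine mul_le_mul_right (add_le_add ?_ ?_) _
      · exact le_iSup₂
          (f := fun x (_ : x ∈ K) => eLpNorm (famD w (famD [i] u * v) ε x) p P) x hx
      · exact le_iSup₂
          (f := fun x (_ : x ∈ K) => eLpNorm (famD w (u * famD [i] v) ε x) p P) x hx
  refine ⟨?_, fun w => (key w u v hu hv).1, fun K hK w => (key w u v hu hv).2 K hK⟩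
  filter_upwards [hu.smooth, hv.smooth] with ω h1 h2 ε
  exact (h1 ε).mul (h2 ε)

/-! ### Restriction of families to the line `t = 0` -/

/-- The linear embedding `ℝ → ℝ²`, `x ↦ (x, 0)`. -/
noncomputable def axisEmb : (Fin 1 → ℝ) →L[ℝ] (Fin 2 → ℝ) :=
  LinearMap.toContinuousLinearMap
    { toFun := fun y => ![y 0, 0]
      map_add' := fun y z => by ext i; fin_cases i <;> simp
      map_smul' := fun c y => by ext i; fin_cases i <;> simp }

/-- The family `(u_ε(·, 0))`. -/
def famAxis (u : Family Ω 2) : Family Ω 1 := fun ε y ω => u ε ![y 0, 0] ω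

theorem iterPartial_axis (w : List (Fin 1)) {f : (Fin 2 → ℝ) → ℝ}
    (hf : ContDiff ℝ ((⊤ : ℕ∞) : WithTop ℕ∞) f) :
    iterPartial w (fun y => f (axisEmb y)) =
      fun y => iterPartial (w.map fun _ => (0 : Fin 2)) f (axisEmb y) := by
  induction w generalizing f with
  | nil => rfl
  | cons i w ih =>
    have : partialD i (fun y => f (axisEmb y)) = fun y => partialD 0 f (axisEmb y) := by
      funext y
      have h1 := hf.differentiable (by simp) (axisEmb y)
      have h2 : HasFDerivAt (fun y => f (axisEmb y)) ((fderiv ℝ f (axisEmb y)).comp axisEmb) y :=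
        h1.hasFDerivAt.comp y axisEmb.hasFDerivAt
      have h3 : axisEmb (Pi.single i 1) = Pi.single 0 1 := by
        ext j; fin_cases i; fin_cases j <;> simp [axisEmb]
      simp [partialD, h2.fderiv, h3]
    rw [iterPartial, this, ih (contDiff_partialD hf 0)]; rfl

theorem HasBounds.axis {B : (Eps → ℝ≥0∞) → Prop} (hB : NetClosed B) {P : Measure Ω}
    {p : ℝ≥0∞} {u : Family Ω 2} (hu : HasBounds B P p u) : HasBounds B P p (famAxis u) := by
  have hD : ∀ w ε y, famD (w.map fun _ => (0 : Fin 2)) u ε (axisEmb y)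
      =ᵐ[P] famD w (famAxis u) ε y := by
    intro w ε y
    filter_upwards [hu.smooth] with ω h
    exact (congrFun (iterPartial_axis w (h ε)) y).symm
  refine ⟨?_, fun w ε y => (memLp_congr_ae (hD w ε y)).1 (hu.memLp _ ε _), fun K hK w => ?_⟩
  · filter_upwards [hu.smooth] with ω h ε
    exact (h ε).comp axisEmb.contDiff
  · refine hB.mono 1 _ _ (fun ε => ?_)
      (hu.bound (axisEmb '' K) (hK.image axisEmb.continuous) (w.map fun _ => 0))
    rw [ENNReal.coe_one, one_mul]
    refine iSup₂_le fun y hy => ?_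
    rw [← eLpNorm_congr_ae (hD w ε y)]
    exact le_iSup₂ (f := fun x (_ : x ∈ axisEmb '' K) =>
      eLpNorm (famD (w.map fun _ => (0 : Fin 2)) u ε x) p P) (axisEmb y) ⟨y, hy, rfl⟩

end Families

/-! ## The spaces of Colombeau random fields -/

section Spaces

variable {Ω : Type*} [MeasurableSpace Ω]

/-- Moderate families of random fields on `ℝ^d` with values in `L^p(Ω)`. -/
def moderateFamilies (P : Measure Ω) (p : ℝ≥0∞) (d : ℕ) : AddSubgroup (Family Ω d) where
  carrier := {u | HasBounds ModerateNet P p u}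
  zero_mem' := HasBounds.zero moderateNet_closed P p
  add_mem' := fun hu hv => HasBounds.add moderateNet_closed hu hv
  neg_mem' := fun hu => HasBounds.neg hu

/-- Negligible families of random fields on `ℝ^d` with values in `L^p(Ω)`. -/
def negligibleFamilies (P : Measure Ω) (p : ℝ≥0∞) (d : ℕ) : AddSubgroup (Family Ω d) where
  carrier := {u | HasBounds NegligibleNet P p u}
  zero_mem' := HasBounds.zero negligibleNet_closed P p
  add_mem' := fun hu hv => HasBounds.add negligibleNet_closed hu hv
  neg_mem' := fun hu => HasBounds.neg hu

/-- The space of Colombeau random fields on `ℝ^d` with values in `L^p(Ω)`, `1 ≤ p ≤ ∞`: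
moderate families modulo negligible families. -/
abbrev Colombeau (P : Measure Ω) (p : ℝ≥0∞) (d : ℕ) : Type _ :=
  moderateFamilies P p d ⧸ (negligibleFamilies P p d).addSubgroupOf (moderateFamilies P p d)

variable {P : Measure Ω} {p : ℝ≥0∞} {d : ℕ}

/-- `u` is a representative of the Colombeau random field `U`. -/
def IsRepr (u : Family Ω d) (U : Colombeau P p d) : Prop :=
  ∃ hu : u ∈ moderateFamilies P p d, (QuotientAddGroup.mk ⟨u, hu⟩ : Colombeau P p d) = U

/-- The partial derivative `∂_i`, computed on representatives. -/
noncomputable def pderiv (i : Fin d) : Colombeau P p d → Colombeau P p d :=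
  Quotient.map' (fun u => ⟨famD [i] u.1, HasBounds.partialD u.2 i⟩) (by
    rintro ⟨u, hu⟩ ⟨v, hv⟩ h
    rw [QuotientAddGroup.leftRel_apply] at h ⊢
    have h' : HasBounds NegligibleNet P p (-u + v) := h
    change HasBounds NegligibleNet P p (-famD [i] u + famD [i] v)
    refine (h'.partialD i).congr ?_
    filter_upwards [hu.smooth, hv.smooth] with ω h1 h2 ε x
    have e := congrFun (iterPartial_add [i] (h1 ε).neg (h2 ε)) x
    have e' := congrFun (iterPartial_neg [i] (fun y => u ε y ω)) x
    exact e.trans (congrArg (· + iterPartial [i] (fun y => v ε y ω) x) e'))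

/-- Multiplication of elements with values in `L^p(Ω)` by elements with values in `L^∞(Ω)`,
computed pointwise on representatives. -/
instance : SMul (Colombeau P ⊤ d) (Colombeau P p d) where
  smul := Quotient.map₂
    (fun a u => ⟨a.1 * u.1, HasBounds.mul moderateNet_closed (fun _ _ => ModerateNet.mul)
      a.2 u.2⟩) (by
    rintro ⟨a, ha⟩ ⟨b, hb⟩ hab ⟨u, hu⟩ ⟨v, hv⟩ huv
    have hab' : HasBounds NegligibleNet P ⊤ (-a + b) := QuotientAddGroup.leftRel_apply.1 hab
    have huv' : HasBounds NegligibleNet P p (-u + v) := QuotientAddGroup.leftRel_apply.1 huv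
    refine QuotientAddGroup.leftRel_apply.2 ?_
    change HasBounds NegligibleNet P p (-(a * u) + b * v)
    have e : -(a * u) + b * v = (-a + b) * u + b * (-u + v) := by ring
    rw [e]
    exact HasBounds.add negligibleNet_closed
      (HasBounds.mul negligibleNet_closed (fun _ _ => NegligibleNet.mul_moderate) hab' hu)
      (HasBounds.mul negligibleNet_closed (fun _ _ => ModerateNet.mul_negligible) hb huv'))

/-- The restriction `u(·, 0)` of a Colombeau random field on `ℝ²` to the line `t = 0`,
computed on representatives. -/
def restrictZero : Colombeau P p 2 → Colombeau P p 1 :=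
  Quotient.map' (fun u => ⟨famAxis u.1, HasBounds.axis moderateNet_closed u.2⟩) (by
    rintro ⟨u, hu⟩ ⟨v, hv⟩ h
    rw [QuotientAddGroup.leftRel_apply] at h ⊢
    have h' : HasBounds NegligibleNet P p (-u + v) := h
    exact HasBounds.axis negligibleNet_closed h')

/-! ## Properties of the coefficients

Points of `ℝ²` are written `![x, t]`: coordinate `0` is the space variable `x`, coordinate `1` is
the time variable `t`. -/

/-- Uniformly bounded on strips. -/
def UniformlyBoundedOnStrips (V : Colombeau P p 2) : Prop :=
  ∃ v : Family Ω 2, IsRepr v V ∧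
    ∀ a b : ℝ, ∃ c : ℝ, 0 < c ∧ ∀ᵐ ω ∂P, ∀ ε : Eps, ∀ x : ℝ, ∀ t ∈ Set.Icc a b,
      |v ε ![x, t] ω| ≤ c

/-- Of uniform local logarithmic type. -/
def UniformLocalLogType (V : Colombeau P p 2) : Prop :=
  ∃ v : Family Ω 2, IsRepr v V ∧
    ∀ K : Set (Fin 2 → ℝ), IsCompact K → ∃ c : ℝ, 0 < c ∧ ∀ᵐ ω ∂P, ∀ ε : Eps, ∀ z ∈ K,
      |v ε z ω| ≤ c * |Real.log (ε : ℝ)|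

/-! ## The Cauchy problem -/

/-- `U = (U_1, …, U_n)` solves `(∂_t + λ ∂_x) U = f U + g`, `U(·, 0) = U₀` in the space of
Colombeau random fields with values in `L^p(Ω)`, where `λ = diag(lam_1, …, lam_n)`. -/
def SolvesCauchy {n : ℕ} (lam : Fin n → Colombeau P ⊤ 2)
    (f : Matrix (Fin n) (Fin n) (Colombeau P ⊤ 2))
    (g : Fin n → Colombeau P p 2) (U₀ : Fin n → Colombeau P p 1)
    (U : Fin n → Colombeau P p 2) : Prop :=
  (∀ i, pderiv 1 (U i) + lam i • pderiv 0 (U i) = (∑ j, f i j • U j) + g i) ∧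
    ∀ i, restrictZero (U i) = U₀ i

end Spaces

end ColombeauRF

namespace ColombeauRF

open Set Filter Topology Function

/-! ## A maximum principle on trapezoids of determinacy -/

/-! For fixed ε and almost every ω the problem is a linear transport system with smooth
coefficients. What has to be found is a solution for each path, its measurability in ω, and bounds
in ε for all derivatives.

The bounds rest on a maximum principle on trapezoids of determinacy,
`abs_le_of_transport_inequality`: at a maximum of e^{-κt}|u_i| a step backwards along the
characteristic direction cannot increase the value. It gives |u| ≤ exp((nF + 1)T) · max(E, G), where
E, G and F bound the initial data, the source and the f_ij. The speeds are bounded on strips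
independently of ε and ω, so the trapezoid is a fixed compact set. Since F = O(|log ε|), the
exponential is at most a constant times a power ε^{-a} (`LogNet.moderate_exp`). Thus the solution is
dominated by a deterministic moderate factor times the data. The derivative ∂_x u solves a system of
the same shape, with f_ij - δ_ij ∂_xλ_i in place of f_ij and with a source involving only u and ∂_x
g; ∂_t u is read off the equation. Induction on the order gives `pathBound_of_transport`, which
holds for moderate and for negligible data alike. The moderate version shows that pathwise solutions
form a moderate family; the negligible version, applied to a difference, gives uniqueness.

These estimates control suprema along paths, whereas the spaces are defined through sup_x ‖·‖_{L^p}.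
A Sobolev embedding of paths together with Minkowski's inequality bounds ‖sup_x |·|‖_{L^p} at the
price of further derivatives (`HasBounds.locDom_line`, `HasBounds.locDom_plane`); the way back is
`HasBounds.of_pathBound`.

Pathwise solutions are constructed as limits of the Lax–Friedrichs scheme. Its values are algebraic
expressions in finitely many values of the coefficients and data, hence measurable, and so is the
limit. The derivatives of the approximations are bounded uniformly in the step h
(`exists_bound_lfSeq`), the equation holds up to O(√h) (`exists_residual_bound`), the same maximum
principle makes the approximations Cauchy, and an interpolation inequality extends this to all space
derivatives (`lfApprox_cauchy`). Time reversal supplies negative times (`exists_smooth_solution`).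
-/

theorem HasDerivWithinAt.nonpos_of_le_initial {f : ℝ → ℝ} {f' δ : ℝ} (hδ : 0 < δ)
    (hf : HasDerivWithinAt f f' (Ici 0) 0) (h : ∀ s, 0 < s → s ≤ δ → f s ≤ f 0) : f' ≤ 0 := by
  have h1 := (hasDerivWithinAt_iff_tendsto_slope' (s := Ioi (0 : ℝ)) (by simp)).1
    (hf.mono Ioi_subset_Ici_self)
  refine le_of_tendsto h1 ?_
  filter_upwards [Ioc_mem_nhdsGT hδ] with s hs
  rw [slope_def_field]
  exact div_nonpos_of_nonpos_of_nonneg (by linarith [h s hs.1 hs.2]) (by linarith [hs.1])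

/-- The trapezoid `0 ≤ t ≤ T`, `|x| ≤ R + C (T - t)`. -/
def trapezoid (R C T : ℝ) : Set (ℝ × ℝ) :=
  {z | 0 ≤ z.2 ∧ z.2 ≤ T ∧ |z.1| ≤ R + C * (T - z.2)}

theorem isCompact_trapezoid {R C T : ℝ} (hC : 0 ≤ C) : IsCompact (trapezoid R C T) := by
  refine (isCompact_Icc (a := (-(R + C * T), (0 : ℝ))) (b := (R + C * T, T))).of_isClosed_subset
    ?_ ?_
  · exact (isClosed_le continuous_const continuous_snd).inter
      ((isClosed_le continuous_snd continuous_const).inter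
        (isClosed_le (f := fun z : ℝ × ℝ => |z.1|) (g := fun z : ℝ × ℝ => R + C * (T - z.2))
          (by fun_prop) (by fun_prop)))
  · rintro ⟨x, t⟩ ⟨h1, h2, h3⟩
    simp only at h1 h2 h3
    have h4 := abs_le.1 h3
    have h5 : 0 ≤ C * t := mul_nonneg hC h1
    exact ⟨⟨by simp only; nlinarith, h1⟩, ⟨by simp only; nlinarith, h2⟩⟩

/-- Only a one-sided derivative in a single backward direction is required at each point. No
characteristic curves are needed, and the statement applies to functions that are merely piecewise
linear in time as well as to smooth solutions. -/
theorem abs_le_of_transport_inequality {ι : Type*} [Finite ι] {R C T A B E : ℝ}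
    (hC : 0 ≤ C) (hA : 0 ≤ A) (hB : 0 ≤ B) {w : ι → ℝ → ℝ → ℝ}
    (hw : ∀ i, Continuous (uncurry (w i)))
    (h0 : ∀ i x, |x| ≤ R + C * T → |w i x 0| ≤ E)
    (hd : ∀ i x t, 0 < t → t ≤ T → |x| ≤ R + C * (T - t) → ∃ l q, |l| ≤ C ∧
      HasDerivWithinAt (fun s => w i (x - l * s) (t - s)) (-q) (Ici 0) 0 ∧
      ∀ M, (∀ j, |w j x t| ≤ M) → |q| ≤ A * M + B)
    (i : ι) {x t : ℝ} (ht : 0 ≤ t) (htT : t ≤ T) (hx : |x| ≤ R + C * (T - t)) :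
    |w i x t| ≤ Real.exp ((A + 1) * T) * max E B := by
  set κ := A + 1 with hκ
  set Δ := trapezoid R C T with hΔ
  have hmem : (x, t) ∈ Δ := ⟨ht, htT, hx⟩
  set φ : ι → ℝ × ℝ → ℝ := fun i z => Real.exp (-(κ * z.2)) * |w i z.1 z.2| with hφ
  have hφc : ∀ i, Continuous (φ i) := fun i => by
    have := hw i
    have h2 : Continuous fun z : ℝ × ℝ => w i z.1 z.2 := this
    fun_prop
  choose z hzΔ hz using fun i => (isCompact_trapezoid hC).exists_isMaxOn ⟨_, hmem⟩
    (hφc i).continuousOn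
  have : Nonempty ι := ⟨i⟩
  obtain ⟨k, hk⟩ := Finite.exists_max fun i => φ i (z i)
  set m := φ k (z k) with hm
  have hmax : ∀ j y, y ∈ Δ → φ j y ≤ m := fun j y hy => (hz j hy).trans (hk j)
  have hle : ∀ j y, y ∈ Δ → |w j y.1 y.2| ≤ Real.exp (κ * y.2) * m := fun j y hy => by
    have := mul_le_mul_of_nonneg_left (hmax j y hy) (Real.exp_pos (κ * y.2)).le
    rw [hφ] at this
    simp only [← mul_assoc, ← Real.exp_add] at this
    simpa using this
  have hm0 : 0 ≤ m := by positivity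
  have hmE : m ≤ max E B := by
    obtain ⟨h1, h2, h3⟩ := hzΔ k
    rcases h1.eq_or_lt with h1 | h1
    · refine le_max_of_le_left ?_
      rw [hm, hφ]
      simp only [← h1]
      rw [mul_zero, neg_zero, Real.exp_zero, one_mul]
      exact h0 k _ (by rw [← h1] at h3; simpa using h3)
    · refine le_max_of_le_right ?_
      obtain ⟨l, q, hl, hder, hq⟩ := hd k (z k).1 (z k).2 h1 h2 h3
      have hq' := hq _ fun j => hle j (z k) (hzΔ k)
      set y := (z k).1
      set τ := (z k).2
      -- Freezing the sign at the maximum point replaces |w| by σ w, which has the one-sided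
      -- derivative and does not exceed |w|.
      obtain ⟨σ, hσ, hσ1⟩ : ∃ σ : ℝ, σ * w k y τ = |w k y τ| ∧ |σ| = 1 := by
        rcases le_total 0 (w k y τ) with h | h
        · exact ⟨1, by rw [abs_of_nonneg h, one_mul], by simp⟩
        · exact ⟨-1, by rw [abs_of_nonpos h, neg_one_mul], by simp⟩
      set ψ : ℝ → ℝ := fun s => Real.exp (-(κ * (τ - s))) * (σ * w k (y - l * s) (τ - s)) with hψ
      have hψ0 : ψ 0 = m := by simp [hψ, hσ, hm, hφ, y, τ]
      have hψd : HasDerivWithinAt ψ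
          (κ * Real.exp (-(κ * τ)) * (σ * w k y τ) + Real.exp (-(κ * τ)) * (σ * (-q)))
          (Ici 0) 0 := by
        have e1 : HasDerivAt (fun s => Real.exp (-(κ * (τ - s)))) (κ * Real.exp (-(κ * τ))) 0 := by
          have e2 : HasDerivAt (fun s : ℝ => -(κ * (τ - s))) κ 0 := by
            exact (((hasDerivAt_id (0 : ℝ)).const_sub τ).const_mul κ).fun_neg.congr_deriv (by ring)
          have := e2.exp
          simpa [mul_comm] using this
        exact (e1.hasDerivWithinAt.fun_mul (hder.const_mul σ)).congr_deriv (by simp)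
      -- Going back by s moves x by at most C s, which is just how much the trapezoid widens; the
      -- segment stays inside and `ψ` is at most its initial value m.
      have hle0 := HasDerivWithinAt.nonpos_of_le_initial h1 hψd (fun s hs hsτ => by
        rw [hψ0]
        refine le_trans ?_ (hmax k (y - l * s, τ - s) ⟨by simp only; linarith, by simp only; linarith, ?_⟩)
        · simp only [hψ, hφ]
          refine mul_le_mul_of_nonneg_left ?_ (Real.exp_pos _).le
          refine (le_abs_self _).trans ?_
          rw [abs_mul, hσ1, one_mul]
        · simp only
          calc |y - l * s| ≤ |y| + |l * s| := abs_sub _ _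
            _ ≤ (R + C * (T - τ)) + C * s := by
              refine add_le_add h3 ?_
              rw [abs_mul, abs_of_pos hs]
              exact mul_le_mul_of_nonneg_right hl hs.le
            _ = R + C * (T - (τ - s)) := by ring)
      have e3 : κ * Real.exp (-(κ * τ)) * (σ * w k y τ) = κ * m := by
        rw [hσ, hm, hφ]; ring
      rw [e3] at hle0
      have e4 : σ * q ≤ |q| := by
        refine (le_abs_self _).trans ?_
        rw [abs_mul, hσ1, one_mul]
      have e5 : Real.exp (-(κ * τ)) * (σ * q) ≤
          Real.exp (-(κ * τ)) * (A * (Real.exp (κ * τ) * m) + B) :=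
        mul_le_mul_of_nonneg_left (e4.trans hq') (Real.exp_pos _).le
      have e6 : Real.exp (-(κ * τ)) * Real.exp (κ * τ) = 1 := by
        rw [← Real.exp_add]; simp
      have e7 : Real.exp (-(κ * τ)) * (A * (Real.exp (κ * τ) * m) + B) =
          A * m + Real.exp (-(κ * τ)) * B := by
        linear_combination A * m * e6
      have e8 : Real.exp (-(κ * τ)) ≤ 1 := by
        rw [Real.exp_le_one_iff]
        have : 0 ≤ κ * τ := by positivity
        linarith
      have e9 : Real.exp (-(κ * τ)) * B ≤ B := mul_le_of_le_one_left hB e8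
      rw [hκ] at hle0
      linarith
  refine (hle i (x, t) hmem).trans ?_
  refine mul_le_mul ?_ hmE hm0 (Real.exp_pos _).le
  exact Real.exp_le_exp.2 (mul_le_mul_of_nonneg_left htT (by linarith))

end ColombeauRF

namespace ColombeauRF

open Set Filter Topology Function
open scoped ContDiff

/-! ## Functions of two real variables -/

section TwoVariables

variable {F : ℝ → ℝ → ℝ}

theorem contDiff_slice (hF : ContDiff ℝ ∞ (uncurry F)) (t : ℝ) :
    ContDiff ℝ ∞ (fun x => F x t) :=
  hF.comp (contDiff_id.prodMk contDiff_const)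

theorem deriv_slice_eq (hF : ContDiff ℝ ∞ (uncurry F)) (x t : ℝ) :
    deriv (fun y => F y t) x = fderiv ℝ (uncurry F) (x, t) (1, 0) := by
  have h1 := (hF.differentiable (by simp) (x, t)).hasFDerivAt
  have h2 : HasDerivAt (fun y : ℝ => (y, t)) ((1 : ℝ), (0 : ℝ)) x :=
    (hasDerivAt_id x).prodMk (hasDerivAt_const x t)
  exact (h1.comp_hasDerivAt x h2).deriv

theorem contDiff_deriv_slice (hF : ContDiff ℝ ∞ (uncurry F)) :
    ContDiff ℝ ∞ (uncurry fun x t => deriv (fun y => F y t) x) := by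
  have : (uncurry fun x t => deriv (fun y => F y t) x) =
      fun z => fderiv ℝ (uncurry F) z (1, 0) := by
    funext ⟨x, t⟩; exact deriv_slice_eq hF x t
  rw [this]
  exact (hF.fderiv_right (by simp)).clm_apply contDiff_const

theorem contDiff_iteratedDeriv_slice (hF : ContDiff ℝ ∞ (uncurry F)) (j : ℕ) :
    ContDiff ℝ ∞ (uncurry fun x t => iteratedDeriv j (fun y => F y t) x) := by
  induction j with
  | zero => simpa using hF
  | succ j ih =>
    simp_rw [iteratedDeriv_succ]
    exact contDiff_deriv_slice ih

theorem exists_bound_on_box {F : ℝ → ℝ → ℝ} (hF : Continuous (uncurry F)) (R T : ℝ) :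
    ∃ M, ∀ x t, |x| ≤ R → |t| ≤ T → |F x t| ≤ M := by
  obtain ⟨M, hM⟩ := ((isCompact_Icc (a := -R) (b := R)).prod
    (isCompact_Icc (a := -T) (b := T))).exists_bound_of_continuousOn hF.continuousOn
  exact ⟨M, fun x t hx ht => hM (x, t) ⟨abs_le.1 hx, abs_le.1 ht⟩⟩

end TwoVariables

theorem exists_uniform_bound {κ : Type*} [Finite κ] {α : Type*} {F : κ → α → ℝ} {s : Set α}
    (h : ∀ k, ∃ M, ∀ z ∈ s, |F k z| ≤ M) : ∃ M, 0 ≤ M ∧ ∀ k, ∀ z ∈ s, |F k z| ≤ M := by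
  cases nonempty_fintype κ
  choose M hM using h
  refine ⟨∑ k, |M k|, Finset.sum_nonneg fun _ _ => abs_nonneg _, fun k z hz => ?_⟩
  exact (hM k z hz).trans ((le_abs_self _).trans
    (Finset.single_le_sum (f := fun k => |M k|) (fun _ _ => abs_nonneg _) (Finset.mem_univ k)))

theorem abs_sub_le_of_abs_deriv_le {f : ℝ → ℝ} (hf : Differentiable ℝ f) {a b M : ℝ}
    (hab : a ≤ b) (h : ∀ y ∈ Icc a b, |deriv f y| ≤ M) : |f b - f a| ≤ M * (b - a) := by
  have := (convex_Icc a b).norm_image_sub_le_of_norm_deriv_le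
    (fun x _ => hf x) h (left_mem_Icc.2 hab) (right_mem_Icc.2 hab)
  simpa [Real.norm_eq_abs, abs_of_nonneg (sub_nonneg.2 hab)] using this

/-- In Leibniz' formula the term carrying the top derivative of φ is split off. The binomial
coefficients of the other terms add up to at most 2 ^ l. -/
theorem abs_iteratedDeriv_mul_sub_le {a φ : ℝ → ℝ} (ha : ContDiff ℝ ∞ a) (hφ : ContDiff ℝ ∞ φ)
    {l : ℕ} {x α β : ℝ} (hα0 : 0 ≤ α) (hβ0 : 0 ≤ β)
    (hα : ∀ m, 1 ≤ m → m ≤ l → |iteratedDeriv m a x| ≤ α)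
    (hβ : ∀ m < l, |iteratedDeriv m φ x| ≤ β) :
    |iteratedDeriv l (fun y => a y * φ y) x - a x * iteratedDeriv l φ x| ≤ 2 ^ l * (α * β) := by
  rw [iteratedDeriv_fun_mul (ha.of_le (by exact_mod_cast le_top)).contDiffAt
    (hφ.of_le (by exact_mod_cast le_top)).contDiffAt, Finset.sum_range_succ']
  simp only [Nat.choose_zero_right, Nat.cast_one, iteratedDeriv_zero, one_mul, Nat.sub_zero,
    add_sub_cancel_right]
  calc _ ≤ ∑ m ∈ Finset.range l, |((l.choose (m + 1) : ℝ)) * iteratedDeriv (m + 1) a x *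
        iteratedDeriv (l - (m + 1)) φ x| := Finset.abs_sum_le_sum_abs _ _
    _ ≤ ∑ m ∈ Finset.range l, (l.choose (m + 1) : ℝ) * (α * β) := by
      refine Finset.sum_le_sum fun m hm => ?_
      have hm' := Finset.mem_range.1 hm
      rw [abs_mul, abs_mul, Nat.abs_cast, mul_assoc]
      refine mul_le_mul_of_nonneg_left ?_ (Nat.cast_nonneg _)
      exact mul_le_mul (hα _ (by omega) (by omega)) (hβ _ (by omega)) (abs_nonneg _) hα0
    _ = (∑ m ∈ Finset.range l, (l.choose (m + 1) : ℝ)) * (α * β) := by rw [Finset.sum_mul]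
    _ ≤ 2 ^ l * (α * β) := by
      refine mul_le_mul_of_nonneg_right ?_ (mul_nonneg hα0 hβ0)
      have := Nat.sum_range_choose l
      rw [Finset.sum_range_succ'] at this
      have h2 : (∑ m ∈ Finset.range l, l.choose (m + 1)) ≤ 2 ^ l := by omega
      exact_mod_cast h2

/-! ## The Lax–Friedrichs scheme -/

/-- Coefficients and data of the Cauchy problem
`∂_t u_i + λ_i ∂_x u_i = ∑_j f_{ij} u_j + g_i`, `u_i(x, 0) = init_i(x)`. -/
structure TransportData (ι : Type*) where
  /-- the characteristic speeds -/
  lam : ι → ℝ → ℝ → ℝ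
  /-- the zeroth order coefficients -/
  f : ι → ι → ℝ → ℝ → ℝ
  /-- the source term -/
  g : ι → ℝ → ℝ → ℝ
  /-- the initial data -/
  init : ι → ℝ → ℝ

/-- All coefficients and data are smooth. -/
structure TransportData.Smooth {ι : Type*} (D : TransportData ι) : Prop where
  lam : ∀ i, ContDiff ℝ ∞ (uncurry (D.lam i))
  f : ∀ i j, ContDiff ℝ ∞ (uncurry (D.f i j))
  g : ∀ i, ContDiff ℝ ∞ (uncurry (D.g i))
  init : ∀ i, ContDiff ℝ ∞ (D.init i)

variable {ι : Type*} [Fintype ι]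

/-- The right-hand side `f v + g` at time `t`. -/
def TransportData.rhs (D : TransportData ι) (t : ℝ) (v : ι → ℝ → ℝ) (i : ι) (x : ℝ) : ℝ :=
  (∑ j, D.f i j x t * v j x) + D.g i x t

/-- One step of the Lax–Friedrichs scheme of length `h` at time `t`, with numerical speed `c`. -/
noncomputable def lfStep (D : TransportData ι) (c h t : ℝ) (v : ι → ℝ → ℝ) : ι → ℝ → ℝ :=
  fun i x => (v i (x - h * c) + v i (x + h * c)) / 2
    + (2 * c)⁻¹ * (D.lam i x t * (v i (x - h * c) - v i (x + h * c)))
    + h * D.rhs t v i x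

/-- The Lax–Friedrichs scheme with time step `h` and numerical speeds `c`. -/
noncomputable def lfSeq (D : TransportData ι) (c : ℝ → ℝ) (h : ℝ) : ℕ → ι → ℝ → ℝ
  | 0 => D.init
  | k + 1 => lfStep D (c (k * h)) h (k * h) (lfSeq D c h k)

theorem TransportData.Smooth.contDiff_rhs {D : TransportData ι} (hD : D.Smooth) (t : ℝ)
    {v : ι → ℝ → ℝ} (hv : ∀ i, ContDiff ℝ ∞ (v i)) (i : ι) : ContDiff ℝ ∞ (D.rhs t v i) := by
  refine ContDiff.add (ContDiff.sum fun j _ => ?_) (contDiff_slice (hD.g i) t)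
  exact (contDiff_slice (hD.f i j) t).mul (hv j)

theorem contDiff_lfStep {D : TransportData ι} (hD : D.Smooth) (c h t : ℝ) {v : ι → ℝ → ℝ}
    (hv : ∀ i, ContDiff ℝ ∞ (v i)) (i : ι) : ContDiff ℝ ∞ (lfStep D c h t v i) := by
  have h1 : ContDiff ℝ ∞ fun x => v i (x - h * c) := (hv i).comp (contDiff_id.sub contDiff_const)
  have h2 : ContDiff ℝ ∞ fun x => v i (x + h * c) := (hv i).comp (contDiff_id.add contDiff_const)
  exact (((h1.add h2).div_const 2).add
    (contDiff_const.mul ((contDiff_slice (hD.lam i) t).mul (h1.sub h2)))).add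
    (contDiff_const.mul (hD.contDiff_rhs t hv i))

theorem contDiff_lfSeq {D : TransportData ι} (hD : D.Smooth) (c : ℝ → ℝ) (h : ℝ) (k : ℕ) (i : ι) :
    ContDiff ℝ ∞ (lfSeq D c h k i) := by
  induction k generalizing i with
  | zero => exact hD.init i
  | succ k ih => exact contDiff_lfStep hD _ _ _ ih i

/-- Stability of one step, with growth only of order h. With θ = λ/c the transport part is the
average with weights (1 ± θ)/2, convex because |λ| ≤ c; the top-order terms are therefore bounded by
b with no extra factor. The remaining Leibniz terms contain differences of lower derivatives over a
distance 2hc. The mean value theorem bounds these by 2hcb, which cancels the factor 1/(2c) and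
leaves h. -/
theorem abs_iteratedDeriv_lfStep_le {D : TransportData ι} (hD : D.Smooth) {c h t x b Λ : ℝ}
    {v : ι → ℝ → ℝ} (hv : ∀ i, ContDiff ℝ ∞ (v i)) {J : ℕ} (hc : 0 < c) (hh : 0 ≤ h)
    (hb : 0 ≤ b) (hΛ : 0 ≤ Λ)
    (hvb : ∀ i, ∀ m ≤ J, ∀ y, |y - x| ≤ h * c → |iteratedDeriv m (v i) y| ≤ b)
    (hlam : ∀ i, ∀ m ≤ J, |iteratedDeriv m (fun y => D.lam i y t) x| ≤ Λ)
    (hf : ∀ i j, ∀ m ≤ J, |iteratedDeriv m (fun y => D.f i j y t) x| ≤ Λ)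
    (hg : ∀ i, ∀ m ≤ J, |iteratedDeriv m (fun y => D.g i y t) x| ≤ Λ)
    (hlc : ∀ i, |D.lam i x t| ≤ c) (i : ι) {l : ℕ} (hl : l ≤ J) :
    |iteratedDeriv l (lfStep D c h t v i) x| ≤
      b + h * (2 ^ J * (Λ * b) + Fintype.card ι * ((2 ^ J + 1) * (Λ * b)) + Λ) := by
  have hhc : 0 ≤ h * c := mul_nonneg hh hc.le
  have h1 : ContDiff ℝ ∞ fun x => v i (x - h * c) := (hv i).comp (contDiff_id.sub contDiff_const)
  have h2 : ContDiff ℝ ∞ fun x => v i (x + h * c) := (hv i).comp (contDiff_id.add contDiff_const)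
  have hle : (l : WithTop ℕ∞) ≤ ((⊤ : ℕ∞) : WithTop ℕ∞) := by exact_mod_cast le_top
  have hpow : (2 : ℝ) ^ l ≤ 2 ^ J := pow_le_pow_right₀ (by norm_num) hl
  have hlamS := contDiff_slice (hD.lam i) t
  set δ : ℝ → ℝ := fun y => v i (y - h * c) - v i (y + h * c) with hδ
  have hδS : ContDiff ℝ ∞ δ := h1.sub h2
  have hδm : ∀ m, iteratedDeriv m δ x =
      iteratedDeriv m (v i) (x - h * c) - iteratedDeriv m (v i) (x + h * c) := by
    intro m
    have hle : (m : WithTop ℕ∞) ≤ ((⊤ : ℕ∞) : WithTop ℕ∞) := by exact_mod_cast le_top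
    rw [hδ, iteratedDeriv_fun_sub (h1.of_le hle).contDiffAt (h2.of_le hle).contDiffAt,
      iteratedDeriv_comp_sub_const, iteratedDeriv_comp_add_const]
  have hδb : ∀ m < l, |iteratedDeriv m δ x| ≤ 2 * (h * c) * b := by
    intro m hm
    rw [hδm, abs_sub_comm]
    have hdiff : Differentiable ℝ (iteratedDeriv m (v i)) :=
      (hv i).differentiable_iteratedDeriv m (by exact_mod_cast WithTop.coe_lt_top m)
    refine (abs_sub_le_of_abs_deriv_le hdiff (M := b) (by linarith) fun y hy => ?_).trans
      (le_of_eq (by ring))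
    rw [← iteratedDeriv_succ]
    exact hvb i _ (by omega) y (abs_le.2 ⟨by linarith [hy.1], by linarith [hy.2]⟩)
  have hexp : iteratedDeriv l (lfStep D c h t v i) x =
      (iteratedDeriv l (v i) (x - h * c) + iteratedDeriv l (v i) (x + h * c)) / 2
        + (2 * c)⁻¹ * iteratedDeriv l (fun y => D.lam i y t * δ y) x
        + h * ((∑ j, iteratedDeriv l (fun y => D.f i j y t * v j y) x)
          + iteratedDeriv l (fun y => D.g i y t) x) := by
    have e1 : iteratedDeriv l (D.rhs t v i) x =
        (∑ j, iteratedDeriv l (fun y => D.f i j y t * v j y) x)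
          + iteratedDeriv l (fun y => D.g i y t) x := by
      have hs : ∀ j ∈ Finset.univ, ContDiffAt ℝ l (fun y => D.f i j y t * v j y) x := fun j _ =>
        (((contDiff_slice (hD.f i j) t).mul (hv j)).of_le hle).contDiffAt
      rw [← iteratedDeriv_fun_sum hs]
      exact iteratedDeriv_fun_add (ContDiffAt.sum hs)
        ((contDiff_slice (hD.g i) t).of_le hle).contDiffAt
    have e2 : iteratedDeriv l (fun y => (v i (y - h * c) + v i (y + h * c)) / 2) x =
        (iteratedDeriv l (v i) (x - h * c) + iteratedDeriv l (v i) (x + h * c)) / 2 := by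
      rw [iteratedDeriv_div_const,
        iteratedDeriv_fun_add (h1.of_le hle).contDiffAt (h2.of_le hle).contDiffAt,
        iteratedDeriv_comp_sub_const, iteratedDeriv_comp_add_const]
    have c1 : ContDiff ℝ l fun y => (v i (y - h * c) + v i (y + h * c)) / 2 :=
      ((h1.add h2).div_const 2).of_le hle
    have c2 : ContDiff ℝ l fun y => (2 * c)⁻¹ * (D.lam i y t * δ y) :=
      (contDiff_const.mul (hlamS.mul hδS)).of_le hle
    have c3 : ContDiff ℝ l fun y => h * D.rhs t v i y :=
      (contDiff_const.mul (hD.contDiff_rhs t hv i)).of_le hle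
    rw [← e1, ← e2, ← iteratedDeriv_const_mul_field, ← iteratedDeriv_const_mul_field h,
      ← iteratedDeriv_fun_add c1.contDiffAt c2.contDiffAt,
      ← iteratedDeriv_fun_add (c1.add c2).contDiffAt c3.contDiffAt]
    rfl
  set p := iteratedDeriv l (v i) (x - h * c) with hp
  set q := iteratedDeriv l (v i) (x + h * c) with hq
  have hpb : |p| ≤ b := hvb i l hl _ (by
    rw [sub_sub_cancel_left, abs_neg, abs_of_nonneg hhc])
  have hqb : |q| ≤ b := hvb i l hl _ (by
    rw [add_sub_cancel_left, abs_of_nonneg hhc])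
  have hvx : ∀ j, ∀ m ≤ J, |iteratedDeriv m (v j) x| ≤ b := fun j m hm =>
    hvb j m hm x (by simpa using hhc)
  have t1 : |(p + q) / 2 + (2 * c)⁻¹ * (D.lam i x t * iteratedDeriv l δ x)| ≤ b := by
    rw [hδm]
    set θ := D.lam i x t / c with hθ
    have hθ1 : |θ| ≤ 1 := by
      rw [hθ, abs_div, abs_of_pos hc]
      exact (div_le_one hc).2 (hlc i)
    have e : (p + q) / 2 + (2 * c)⁻¹ * (D.lam i x t * (p - q)) =
        (1 + θ) / 2 * p + (1 - θ) / 2 * q := by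
      rw [hθ]; field_simp; ring
    rw [e]
    obtain ⟨g1, g2⟩ := abs_le.1 hθ1
    have hp' := abs_le.1 hpb
    have hq' := abs_le.1 hqb
    rw [abs_le]
    constructor <;> nlinarith
  have t2 : |(2 * c)⁻¹ * (iteratedDeriv l (fun y => D.lam i y t * δ y) x -
      D.lam i x t * iteratedDeriv l δ x)| ≤ h * (2 ^ J * (Λ * b)) := by
    have := abs_iteratedDeriv_mul_sub_le hlamS hδS hΛ (by positivity : 0 ≤ 2 * (h * c) * b)
      (fun m _ hm => hlam i m (hm.trans hl)) hδb
    rw [abs_mul, abs_of_pos (by positivity : 0 < (2 * c)⁻¹)]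
    calc _ ≤ (2 * c)⁻¹ * (2 ^ l * (Λ * (2 * (h * c) * b))) :=
          mul_le_mul_of_nonneg_left this (by positivity)
      _ = 2 ^ l * (h * (Λ * b)) := by field_simp
      _ ≤ 2 ^ J * (h * (Λ * b)) := mul_le_mul_of_nonneg_right hpow (by positivity)
      _ = _ := by ring
  have t3 : ∀ j, |iteratedDeriv l (fun y => D.f i j y t * v j y) x| ≤ (2 ^ J + 1) * (Λ * b) := by
    intro j
    have := abs_iteratedDeriv_mul_sub_le (contDiff_slice (hD.f i j) t) (hv j) hΛ hb
      (fun m _ hm => hf i j m (hm.trans hl)) (fun m hm => hvx j m (hm.le.trans hl))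
    have e2 : |D.f i j x t * iteratedDeriv l (v j) x| ≤ Λ * b := by
      rw [abs_mul]
      refine mul_le_mul ?_ (hvx j l hl) (abs_nonneg _) hΛ
      simpa using hf i j 0 (Nat.zero_le _)
    have e3 : (2 : ℝ) ^ l * (Λ * b) ≤ 2 ^ J * (Λ * b) :=
      mul_le_mul_of_nonneg_right hpow (by positivity)
    have e4 := abs_sub_abs_le_abs_sub (iteratedDeriv l (fun y => D.f i j y t * v j y) x)
      (D.f i j x t * iteratedDeriv l (v j) x)
    linarith
  have t4 : |(∑ j, iteratedDeriv l (fun y => D.f i j y t * v j y) x)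
          + iteratedDeriv l (fun y => D.g i y t) x| ≤
      Fintype.card ι * ((2 ^ J + 1) * (Λ * b)) + Λ := by
    refine (abs_add_le _ _).trans (add_le_add ?_ (hg i l hl))
    refine (Finset.abs_sum_le_sum_abs _ _).trans ?_
    refine (Finset.sum_le_sum fun j _ => t3 j).trans (le_of_eq ?_)
    simp
  have e : iteratedDeriv l (lfStep D c h t v i) x =
      ((p + q) / 2 + (2 * c)⁻¹ * (D.lam i x t * iteratedDeriv l δ x))
      + (2 * c)⁻¹ * (iteratedDeriv l (fun y => D.lam i y t * δ y) x -
        D.lam i x t * iteratedDeriv l δ x)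
      + h * ((∑ j, iteratedDeriv l (fun y => D.f i j y t * v j y) x)
          + iteratedDeriv l (fun y => D.g i y t) x) := by
    rw [hexp]; ring
  rw [e]
  refine (abs_add_le _ _).trans ?_
  have t5 := (abs_add_le _ _).trans (add_le_add t1 t2)
  have t6 := mul_le_mul_of_nonneg_left t4 hh
  rw [abs_mul h, abs_of_nonneg hh]
  linarith

end ColombeauRF

/-! ### Uniform bounds for the scheme, and interpolation in time -/

namespace ColombeauRF

open Set Filter Topology Function
open scoped ContDiff

variable {ι : Type*} [Fintype ι]

/-- Smooth data with a monotone, space independent bound `c` for the characteristic speeds at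
nonnegative times. -/
structure TransportData.Admissible (D : TransportData ι) (c : ℝ → ℝ) : Prop where
  smooth : D.Smooth
  pos : ∀ t, 0 < c t
  mono : Monotone c
  speed : ∀ i x t, 0 ≤ t → |D.lam i x t| ≤ c t

theorem TransportData.Smooth.exists_coeff_bound {D : TransportData ι} (hD : D.Smooth)
    (J : ℕ) (R T : ℝ) : ∃ Λ, 0 ≤ Λ ∧ ∀ m ≤ J, ∀ x t, |x| ≤ R → |t| ≤ T →
      (∀ i, |iteratedDeriv m (fun y => D.lam i y t) x| ≤ Λ) ∧
      (∀ i j, |iteratedDeriv m (fun y => D.f i j y t) x| ≤ Λ) ∧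
      (∀ i, |iteratedDeriv m (fun y => D.g i y t) x| ≤ Λ) := by
  have key : ∀ {κ : Type _} [Finite κ] (F : κ → ℝ → ℝ → ℝ),
      (∀ k, ContDiff ℝ ∞ (uncurry (F k))) → ∃ Λ, 0 ≤ Λ ∧ ∀ m ≤ J, ∀ x t, |x| ≤ R → |t| ≤ T →
        ∀ k, |iteratedDeriv m (fun y => F k y t) x| ≤ Λ := by
    intro κ _ F hF
    obtain ⟨M, hM0, hM⟩ := exists_uniform_bound (κ := Fin (J + 1) × κ)
      (F := fun p z => iteratedDeriv p.1 (fun y => F p.2 y z.2) z.1)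
      (s := {z : ℝ × ℝ | |z.1| ≤ R ∧ |z.2| ≤ T}) (fun p => by
        obtain ⟨M, hM⟩ := exists_bound_on_box
          (contDiff_iteratedDeriv_slice (hF p.2) p.1).continuous R T
        exact ⟨M, fun z hz => hM z.1 z.2 hz.1 hz.2⟩)
    exact ⟨M, hM0, fun m hm x t hx ht k => hM (⟨m, by omega⟩, k) (x, t) ⟨hx, ht⟩⟩
  obtain ⟨Λ₁, h1, H1⟩ := key D.lam hD.lam
  obtain ⟨Λ₂, h2, H2⟩ := key (fun p : ι × ι => D.f p.1 p.2) (fun p => hD.f p.1 p.2)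
  obtain ⟨Λ₃, h3, H3⟩ := key D.g hD.g
  refine ⟨Λ₁ + Λ₂ + Λ₃, by positivity, fun m hm x t hx ht => ⟨fun i => ?_, fun i j => ?_,
    fun i => ?_⟩⟩
  · linarith [H1 m hm x t hx ht i]
  · linarith [H2 m hm x t hx ht (i, j)]
  · linarith [H3 m hm x t hx ht i]

theorem TransportData.Smooth.exists_init_bound {D : TransportData ι} (hD : D.Smooth)
    (J : ℕ) (R : ℝ) : ∃ M, 0 ≤ M ∧ ∀ i, ∀ m ≤ J, ∀ x, |x| ≤ R →
      |iteratedDeriv m (D.init i) x| ≤ M := by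
  obtain ⟨M, hM0, hM⟩ := exists_uniform_bound (κ := Fin (J + 1) × ι)
    (F := fun p x => iteratedDeriv p.1 (D.init p.2) x) (s := {x : ℝ | |x| ≤ R}) (fun p => by
      have hc : Continuous (iteratedDeriv p.1 (D.init p.2)) :=
        (hD.init p.2).continuous_iteratedDeriv _ (by exact_mod_cast le_top)
      obtain ⟨M, hM⟩ := (isCompact_Icc (a := -R) (b := R)).exists_bound_of_continuousOn
        hc.continuousOn
      exact ⟨M, fun x hx => hM x (abs_le.1 hx)⟩)
  exact ⟨M, hM0, fun i m hm x hx => hM (⟨m, by omega⟩, i) x hx⟩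

/-- The derivatives of the Lax–Friedrichs approximations are bounded on bounded sets, uniformly
in the step size. -/
theorem exists_bound_lfSeq {D : TransportData ι} {c : ℝ → ℝ} (hD : D.Admissible c)
    (J : ℕ) (R T : ℝ) : ∃ M, 0 ≤ M ∧ ∀ h, 0 ≤ h → ∀ k : ℕ, k * h ≤ T →
      ∀ i, ∀ m ≤ J, ∀ x, |x| ≤ R → |iteratedDeriv m (lfSeq D c h k i) x| ≤ M := by
  set C := c T with hC
  have hCpos := hD.pos T
  obtain ⟨Λ, hΛ, HΛ⟩ := hD.smooth.exists_coeff_bound J (R + C * T) T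
  obtain ⟨M₀, hM₀, HM₀⟩ := hD.smooth.exists_init_bound J (R + C * T)
  -- Growth rate of one step. The last Λ accounts for the source term, which is absorbed by Λ ≤ Λ b
  -- because the bound b is kept at least 1 through `max M₀ 1`.
  set A := 2 ^ J * Λ + Fintype.card ι * ((2 ^ J + 1) * Λ) + Λ with hA
  have hA0 : 0 ≤ A := by positivity
  -- Discrete Gronwall argument on the discrete trapezoid: each step uses values at distance at most
  -- h c(kh) ≤ h C, so the admissible interval shrinks by h C per step.
  have key : ∀ h, 0 ≤ h → ∀ k : ℕ, k * h ≤ T → ∀ i, ∀ m ≤ J, ∀ x, |x| ≤ R + C * (T - k * h) →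
      |iteratedDeriv m (lfSeq D c h k i) x| ≤ (1 + h * A) ^ k * max M₀ 1 := by
    intro h hh k
    induction k with
    | zero =>
      intro _ i m hm x hx
      simp only [pow_zero, one_mul]
      exact (HM₀ i m hm x (by simpa using hx)).trans (le_max_left _ _)
    | succ k ih =>
      intro hk i m hm x hx
      push_cast at hk hx
      have hkh : 0 ≤ k * h := by positivity
      have hk' : k * h ≤ T := by linarith
      have hck : c (k * h) ≤ C := hD.mono hk'
      have hx' : |x| ≤ R + C * T := hx.trans (by nlinarith)
      have ht' : |k * h| ≤ T := by rwa [abs_of_nonneg hkh]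
      set b := (1 + h * A) ^ k * max M₀ 1 with hb
      have hb1 : 1 ≤ b := by
        have h1 : 1 ≤ (1 + h * A) ^ k := one_le_pow₀ (by nlinarith)
        have h2 : 1 ≤ max M₀ 1 := le_max_right _ _
        nlinarith
      refine (abs_iteratedDeriv_lfStep_le hD.smooth (b := b) (Λ := Λ) (J := J)
        (fun i => contDiff_lfSeq hD.smooth c h k i) (hD.pos _) hh (by linarith) hΛ
        ?_ (fun i m hm => (HΛ m hm x _ hx' ht').1 i) (fun i j m hm => (HΛ m hm x _ hx' ht').2.1 i j)
        (fun i m hm => (HΛ m hm x _ hx' ht').2.2 i) (fun i => hD.speed i x _ hkh) i hm).trans ?_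
      · intro i m hm y hy
        refine ih hk' i m hm y ?_
        have : |y| ≤ |y - x| + |x| := by simpa using abs_add_le (y - x) x
        nlinarith
      · have e : (1 + h * A) ^ (k + 1) * max M₀ 1 = b + h * (A * b) := by
          rw [hb, pow_succ]; ring
        rw [e]
        have h3 : Λ ≤ Λ * b := le_mul_of_one_le_right hΛ hb1
        refine add_le_add_right (mul_le_mul_of_nonneg_left ?_ hh) b
        rw [hA]
        nlinarith
  refine ⟨Real.exp (A * T) * max M₀ 1, by positivity, fun h hh k hk i m hm x hx => ?_⟩
  refine (key h hh k hk i m hm x (hx.trans ?_)).trans ?_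
  · have : 0 ≤ C * (T - k * h) := mul_nonneg hCpos.le (by linarith)
    linarith
  · refine mul_le_mul_of_nonneg_right ?_ (by positivity)
    have h1 : 1 + h * A ≤ Real.exp (h * A) := by linarith [Real.add_one_le_exp (h * A)]
    calc (1 + h * A) ^ k ≤ Real.exp (h * A) ^ k :=
          pow_le_pow_left₀ (by positivity) h1 k
      _ = Real.exp (k * (h * A)) := by rw [← Real.exp_nat_mul]
      _ ≤ Real.exp (A * T) := Real.exp_le_exp.2 (by nlinarith)

/-! ## Piecewise linear interpolation -/

/-- The piecewise linear interpolation of a sequence, constant to the left of `0`. -/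
noncomputable def plInterp (a : ℕ → ℝ) (s : ℝ) : ℝ :=
  a 0 + ∑ k ∈ Finset.range ⌈s⌉₊, max 0 (min 1 (s - k)) * (a (k + 1) - a k)

/-- Increments with index k ≥ s have clamped weight zero, so any upper limit N ≥ s may be used. A
limit that is fixed near a given point makes the interpolation a finite sum there, which yields
continuity. -/
theorem plInterp_eq_sum (a : ℕ → ℝ) {s : ℝ} {N : ℕ} (hs : s ≤ N) :
    plInterp a s = a 0 + ∑ k ∈ Finset.range N, max 0 (min 1 (s - k)) * (a (k + 1) - a k) := by
  rw [plInterp]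
  congr 1
  refine Finset.sum_subset (Finset.range_mono (Nat.ceil_le.2 hs)) fun k _ hk => ?_
  have : s ≤ k := by
    rw [Finset.mem_range, not_lt] at hk
    exact Nat.ceil_le.1 hk
  rw [max_eq_left (by rw [min_le_iff]; right; linarith), zero_mul]

theorem plInterp_eq (a : ℕ → ℝ) {s : ℝ} {k : ℕ} (h1 : k ≤ s) (h2 : s ≤ k + 1) :
    plInterp a s = a k + (s - k) * (a (k + 1) - a k) := by
  rw [plInterp_eq_sum a (N := k + 1) (by exact_mod_cast h2), Finset.sum_range_succ,
    min_eq_right (by linarith), max_eq_right (by linarith)]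
  have : ∑ j ∈ Finset.range k, max 0 (min 1 (s - j)) * (a (j + 1) - a j) = a k - a 0 := by
    rw [← Finset.sum_range_sub]
    refine Finset.sum_congr rfl fun j hj => ?_
    have : (j : ℝ) + 1 ≤ k := by exact_mod_cast Finset.mem_range.1 hj
    rw [min_eq_left (by linarith), max_eq_right (by norm_num), one_mul]
  rw [this]; ring

theorem plInterp_of_nonpos (a : ℕ → ℝ) {s : ℝ} (h : s ≤ 0) : plInterp a s = a 0 := by
  rw [plInterp_eq_sum a (N := 0) (by simpa using h)]; simp

theorem continuous_plInterp {X : Type*} [TopologicalSpace X] {a : ℕ → X → ℝ} {s : X → ℝ}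
    (ha : ∀ k, Continuous (a k)) (hs : Continuous s) :
    Continuous fun x => plInterp (fun k => a k x) (s x) := by
  rw [continuous_iff_continuousAt]
  intro x
  obtain ⟨N, hN⟩ := exists_nat_gt (s x)
  have h1 : Continuous fun x => a 0 x +
      ∑ k ∈ Finset.range N, max 0 (min 1 (s x - k)) * (a (k + 1) x - a k x) := by
    have := ha 0
    refine this.add (continuous_finsetSum _ fun k _ => ?_)
    have h2 := ha k
    have h3 := ha (k + 1)
    fun_prop
  refine h1.continuousAt.congr ?_
  filter_upwards [hs.continuousAt.eventually_lt continuousAt_const hN] with y hy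
  exact (plInterp_eq_sum (fun k => a k y) hy.le).symm

theorem hasDerivAt_plInterp {a a' : ℕ → ℝ → ℝ} {x : ℝ} (h : ∀ k, HasDerivAt (a k) (a' k x) x)
    (s : ℝ) : HasDerivAt (fun y => plInterp (fun k => a k y) s) (plInterp (fun k => a' k x) s) x :=
  (h 0).add (HasDerivAt.fun_sum fun k _ => ((h (k + 1)).sub (h k)).const_mul _)

theorem abs_plInterp_le {a : ℕ → ℝ} {s M : ℝ} {N : ℕ} (hs : s ≤ N) (ha : ∀ k ≤ N, |a k| ≤ M) :
    |plInterp a s| ≤ M := by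
  rcases le_or_gt s 0 with h0 | h0
  · rw [plInterp_of_nonpos a h0]; exact ha 0 (Nat.zero_le _)
  have hN : 0 < N := by
    have : (0 : ℝ) < N := h0.trans_le hs
    exact_mod_cast this
  obtain ⟨k, hk⟩ : ∃ k : ℕ, ⌈s⌉₊ = k + 1 := ⟨⌈s⌉₊ - 1, by have := Nat.ceil_pos.2 h0; omega⟩
  have hkN : k + 1 ≤ N := hk ▸ Nat.ceil_le.2 hs
  have h1 : (k : ℝ) < s := Nat.lt_ceil.1 (by omega)
  have h2 : s ≤ k + 1 := by exact_mod_cast hk ▸ Nat.le_ceil s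
  rw [plInterp_eq a h1.le h2]
  have e1 := abs_le.1 (ha k (by omega))
  have e2 := abs_le.1 (ha (k + 1) hkN)
  rw [abs_le]
  constructor <;> nlinarith

end ColombeauRF

/-! ### Consistency of the Lax–Friedrichs scheme -/

namespace ColombeauRF

open Set Filter Topology Function
open scoped ContDiff

variable {ι : Type*} [Fintype ι]

/-- Interpolation inequality: the first derivative is controlled by the function and its second
derivative. -/
theorem abs_deriv_le_of_abs_le {φ : ℝ → ℝ} (hφ : ContDiff ℝ ∞ φ) {x d ε M : ℝ} (hd : 0 < d)
    (h0 : ∀ y ∈ Icc x (x + d), |φ y| ≤ ε) (h2 : ∀ y ∈ Icc x (x + d), |deriv (deriv φ) y| ≤ M) :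
    |deriv φ x| ≤ 2 * ε / d + M * d := by
  have hφd : Differentiable ℝ φ := hφ.differentiable (by simp)
  have hφ' : ContDiff ℝ ∞ (deriv φ) := by
    have := hφ.iterate_deriv 1
    simpa using this
  -- At some ξ the derivative equals the difference quotient over length d, hence is at most 2ε/d;
  -- moving from ξ back to x costs at most M d.
  obtain ⟨ξ, hξ, e⟩ := exists_deriv_eq_slope φ (lt_add_of_pos_right x hd)
    hφ.continuous.continuousOn hφd.differentiableOn
  have h3 : |deriv φ ξ - deriv φ x| ≤ M * (ξ - x) :=
    abs_sub_le_of_abs_deriv_le (hφ'.differentiable (by simp)) hξ.1.le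
      fun y hy => h2 y ⟨hy.1, hy.2.trans hξ.2.le⟩
  have hM : 0 ≤ M := (abs_nonneg _).trans (h2 x ⟨le_rfl, by linarith⟩)
  have h4 : |deriv φ ξ| ≤ 2 * ε / d := by
    rw [e, add_sub_cancel_left, abs_div, abs_of_pos hd]
    refine div_le_div_of_nonneg_right ?_ hd.le
    have a1 := abs_le.1 (h0 x ⟨le_rfl, by linarith⟩)
    have a2 := abs_le.1 (h0 (x + d) ⟨by linarith, le_rfl⟩)
    exact abs_le.2 ⟨by linarith, by linarith⟩
  have h5 : M * (ξ - x) ≤ M * d := mul_le_mul_of_nonneg_left (by linarith [hξ.2]) hM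
  have h6 := abs_sub_abs_le_abs_sub (deriv φ x) (deriv φ ξ)
  rw [abs_sub_comm] at h6
  linarith

theorem exists_lipschitz_on_box {F : ℝ → ℝ → ℝ} (hF : ContDiff ℝ ∞ (uncurry F)) (R T : ℝ) :
    ∃ L, 0 ≤ L ∧ ∀ x s t, |x| ≤ R → |s| ≤ T → |t| ≤ T → |F x t - F x s| ≤ L * |t - s| := by
  have hG : ContDiff ℝ ∞ (uncurry fun t x => F x t) := hF.comp (contDiff_snd.prodMk contDiff_fst)
  obtain ⟨M, hM⟩ := exists_bound_on_box (contDiff_deriv_slice hG).continuous T R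
  have key : ∀ x s t, |x| ≤ R → |s| ≤ T → |t| ≤ T → s ≤ t → |F x t - F x s| ≤ |M| * |t - s| := by
    intro x s t hx hs ht hst
    rw [abs_of_nonneg (sub_nonneg.2 hst)]
    refine abs_sub_le_of_abs_deriv_le (f := fun t => F x t)
      ((contDiff_slice hG x).differentiable (by simp)) hst fun y hy => ?_
    refine (hM y x ?_ hx).trans (le_abs_self _)
    rw [abs_le] at hs ht ⊢
    exact ⟨by linarith [hy.1], by linarith [hy.2]⟩
  refine ⟨|M|, abs_nonneg _, fun x s t hx hs ht => ?_⟩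
  rcases le_total s t with h | h
  · exact key x s t hx hs ht h
  · rw [abs_sub_comm, abs_sub_comm t]; exact key x t s hx ht hs h

/-- These estimates control the central difference and the average in the scheme. Subtracting the
linear function z φ'(x) leaves a function whose derivative is at most M y on the interval, and the
mean value theorem on either side of x gives the second-order errors. -/
theorem abs_symmetric_difference_le {φ : ℝ → ℝ} (hφ : ContDiff ℝ ∞ φ) {x y M : ℝ} (hy : 0 ≤ y)
    (h1 : ∀ z, |z - x| ≤ y → |deriv φ z| ≤ M) (h2 : ∀ z, |z - x| ≤ y → |deriv (deriv φ) z| ≤ M) :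
    |φ (x + y) - φ (x - y)| ≤ 2 * M * y ∧
    |φ (x + y) - φ (x - y) - 2 * y * deriv φ x| ≤ 2 * M * y ^ 2 ∧
    |(φ (x + y) + φ (x - y)) / 2 - φ x| ≤ M * y ^ 2 := by
  have hφd : Differentiable ℝ φ := hφ.differentiable (by simp)
  have hφ' : Differentiable ℝ (deriv φ) := by
    have := hφ.iterate_deriv 1
    exact (show ContDiff ℝ ∞ (deriv φ) by simpa using this).differentiable (by simp)
  have hM : 0 ≤ M := (abs_nonneg _).trans (h1 x (by simpa using hy))
  have hder : ∀ z, |z - x| ≤ y → |deriv φ z - deriv φ x| ≤ M * y := by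
    intro z hz
    have hz' := abs_le.1 hz
    rcases le_total x z with h | h
    · refine (abs_sub_le_of_abs_deriv_le hφ' h fun w hw => h2 w ?_).trans
        (mul_le_mul_of_nonneg_left (by linarith) hM)
      exact abs_le.2 ⟨by linarith [hw.1], by linarith [hw.2]⟩
    · rw [abs_sub_comm]
      refine (abs_sub_le_of_abs_deriv_le hφ' h fun w hw => h2 w ?_).trans
        (mul_le_mul_of_nonneg_left (by linarith) hM)
      exact abs_le.2 ⟨by linarith [hw.1], by linarith [hw.2]⟩
  set ψ : ℝ → ℝ := fun z => φ z - z * deriv φ x with hψ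
  have hψd : ∀ z, HasDerivAt ψ (deriv φ z - deriv φ x) z := fun z => by
    have := (hφd z).hasDerivAt.sub ((hasDerivAt_id z).mul_const (deriv φ x))
    rwa [one_mul] at this
  have hψ1 : ∀ a b, a ≤ b → (∀ z ∈ Icc a b, |z - x| ≤ y) → |ψ b - ψ a| ≤ M * y * (b - a) :=
    fun a b hab h => abs_sub_le_of_abs_deriv_le (fun z => (hψd z).differentiableAt) hab
      fun z hz => by rw [(hψd z).deriv]; exact hder z (h z hz)
  have p1 := hψ1 x (x + y) (by linarith) fun z hz =>
    abs_le.2 ⟨by linarith [hz.1], by linarith [hz.2]⟩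
  have p2 := hψ1 (x - y) x (by linarith) fun z hz =>
    abs_le.2 ⟨by linarith [hz.1], by linarith [hz.2]⟩
  simp only [hψ] at p1 p2
  rw [abs_le] at p1 p2
  refine ⟨?_, ?_, ?_⟩
  · refine (abs_sub_le_of_abs_deriv_le hφd (by linarith) fun z hz => h1 z ?_).trans
      (le_of_eq (by ring))
    exact abs_le.2 ⟨by linarith [hz.1], by linarith [hz.2]⟩
  · rw [abs_le]; constructor <;> nlinarith
  · rw [abs_le]; constructor <;> nlinarith

/-- The piecewise linear interpolation in time of the `j`-th space derivative of the
Lax–Friedrichs approximations. -/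
noncomputable def lfApprox (D : TransportData ι) (c : ℝ → ℝ) (h : ℝ) (j : ℕ) (i : ι) (x t : ℝ) :
    ℝ :=
  plInterp (fun k => iteratedDeriv j (lfSeq D c h k i) x) (t / h)

section Approx

variable {D : TransportData ι} {c : ℝ → ℝ}

theorem continuous_iteratedDeriv_lfSeq (hD : D.Smooth) (h : ℝ) (j k : ℕ) (i : ι) :
    Continuous (iteratedDeriv j (lfSeq D c h k i)) :=
  (contDiff_lfSeq hD c h k i).continuous_iteratedDeriv _ (by exact_mod_cast le_top)

theorem hasDerivAt_iteratedDeriv_lfSeq (hD : D.Smooth) (h : ℝ) (j k : ℕ) (i : ι) (x : ℝ) :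
    HasDerivAt (iteratedDeriv j (lfSeq D c h k i)) (iteratedDeriv (j + 1) (lfSeq D c h k i) x) x := by
  rw [iteratedDeriv_succ]
  exact ((contDiff_lfSeq hD c h k i).differentiable_iteratedDeriv j
    (by exact_mod_cast WithTop.coe_lt_top j) x).hasDerivAt

theorem continuous_lfApprox (hD : D.Smooth) (h : ℝ) (j : ℕ) (i : ι) :
    Continuous (uncurry (lfApprox D c h j i)) :=
  continuous_plInterp (X := ℝ × ℝ) (a := fun k z => iteratedDeriv j (lfSeq D c h k i) z.1)
    (s := fun z => z.2 / h)
    (fun k => (continuous_iteratedDeriv_lfSeq hD h j k i).comp continuous_fst) (by fun_prop)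

theorem hasDerivAt_lfApprox (hD : D.Smooth) (h : ℝ) (j : ℕ) (i : ι) (x t : ℝ) :
    HasDerivAt (fun y => lfApprox D c h j i y t) (lfApprox D c h (j + 1) i x t) x :=
  hasDerivAt_plInterp (fun k => hasDerivAt_iteratedDeriv_lfSeq hD h j k i x) _

theorem contDiff_lfApprox (hD : D.Smooth) (h : ℝ) (j : ℕ) (i : ι) (t : ℝ) :
    ContDiff ℝ ∞ (fun x => lfApprox D c h j i x t) := by
  have hs : ∀ k, ContDiff ℝ ∞ (iteratedDeriv j (lfSeq D c h k i)) := fun k => by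
    rw [iteratedDeriv_eq_iterate]
    exact (contDiff_lfSeq hD c h k i).iterate_deriv j
  exact (hs 0).add (ContDiff.sum fun k _ => contDiff_const.mul ((hs (k + 1)).sub (hs k)))

theorem lfApprox_zero_time (h : ℝ) (j : ℕ) (i : ι) {x t : ℝ} (hh : 0 ≤ h) (ht : t ≤ 0) :
    lfApprox D c h j i x t = iteratedDeriv j (D.init i) x :=
  plInterp_of_nonpos _ (div_nonpos_of_nonpos_of_nonneg ht hh)

theorem exists_bound_lfApprox (hD : D.Admissible c) (J : ℕ) (R T : ℝ) :
    ∃ M, 0 ≤ M ∧ ∀ h, 0 < h → h ≤ 1 → ∀ i, ∀ m ≤ J, ∀ x t, |x| ≤ R → t ≤ T →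
      |lfApprox D c h m i x t| ≤ M := by
  -- The interpolation may use the grid time just after t, which overshoots by less than h ≤ 1. The
  -- maximum with 0 covers negative T, where the interpolation is the initial value.
  obtain ⟨M, hM0, hM⟩ := exists_bound_lfSeq hD J R (max T 0 + 1)
  refine ⟨M, hM0, fun h hh h1 i m hm x t hx ht => ?_⟩
  refine abs_plInterp_le (N := ⌈t / h⌉₊) (Nat.le_ceil _) fun k hk => ?_
  refine hM h hh.le k ?_ i m hm x hx
  have h0 : 0 ≤ max T 0 := le_max_right _ _
  have h2 : (k : ℝ) < max T 0 / h + 1 := by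
    refine lt_of_le_of_lt (Nat.cast_le.2 (hk.trans (Nat.ceil_mono
      (div_le_div_of_nonneg_right (ht.trans (le_max_left T 0)) hh.le)))) ?_
    exact Nat.ceil_lt_add_one (by positivity)
  have h3 := mul_lt_mul_of_pos_right h2 hh
  rw [add_mul, div_mul_cancel₀ _ hh.ne'] at h3
  linarith

/-- Consistency: the interpolated Lax–Friedrichs approximations satisfy the equation up to an error
which is uniformly small on bounded sets. -/
theorem exists_residual_bound (hD : D.Admissible c) (R T : ℝ) :
    ∃ K, 0 ≤ K ∧ ∀ h, 0 < h → h ≤ 1 → ∀ (k : ℕ) (i : ι) (x t : ℝ), |x| ≤ R → t ≤ T →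
      k * h ≤ t → t ≤ (k + 1) * h →
      |(lfSeq D c h (k + 1) i x - lfSeq D c h k i x) / h + D.lam i x t * lfApprox D c h 1 i x t
        - D.rhs t (fun j y => lfApprox D c h 0 j y t) i x| ≤ K * √h := by
  set C := c T with hC
  have hCpos := hD.pos T
  -- The margin 1 in space leaves room for the interval of length √h used below, the margin C for
  -- the shift h c(kh); the margin 1 in time admits the level k + 1.
  obtain ⟨M, hM0, hM⟩ := exists_bound_lfSeq hD 2 (R + 1 + C) (T + 1)
  obtain ⟨Λ, hΛ0, hΛ⟩ := hD.smooth.exists_coeff_bound 0 (R + 1) (T + 1)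
  obtain ⟨L, hL0, hL⟩ : ∃ L, 0 ≤ L ∧ ∀ x s t, |x| ≤ R → |s| ≤ T → |t| ≤ T →
      (∀ i, |D.lam i x t - D.lam i x s| ≤ L * |t - s|) ∧
      (∀ i j, |D.f i j x t - D.f i j x s| ≤ L * |t - s|) ∧
      (∀ i, |D.g i x t - D.g i x s| ≤ L * |t - s|) := by
    choose L₁ h1 H1 using fun i => exists_lipschitz_on_box (hD.smooth.lam i) R T
    choose L₂ h2 H2 using fun i j => exists_lipschitz_on_box (hD.smooth.f i j) R T
    choose L₃ h3 H3 using fun i => exists_lipschitz_on_box (hD.smooth.g i) R T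
    have s2 : ∀ i, 0 ≤ ∑ j, L₂ i j := fun i => Finset.sum_nonneg fun j _ => h2 i j
    have S1 : 0 ≤ ∑ i, L₁ i := Finset.sum_nonneg fun i _ => h1 i
    have S2 : 0 ≤ ∑ i, ∑ j, L₂ i j := Finset.sum_nonneg fun i _ => s2 i
    have S3 : 0 ≤ ∑ i, L₃ i := Finset.sum_nonneg fun i _ => h3 i
    refine ⟨(∑ i, L₁ i) + (∑ i, ∑ j, L₂ i j) + ∑ i, L₃ i, by positivity,
      fun x s t hx hs ht => ⟨fun i => ?_, fun i j => ?_, fun i => ?_⟩⟩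
    · refine (H1 i x s t hx hs ht).trans (mul_le_mul_of_nonneg_right ?_ (abs_nonneg _))
      have := Finset.single_le_sum (f := L₁) (fun i _ => h1 i) (Finset.mem_univ i)
      linarith
    · refine (H2 i j x s t hx hs ht).trans (mul_le_mul_of_nonneg_right ?_ (abs_nonneg _))
      have := Finset.single_le_sum (f := L₂ i) (fun j _ => h2 i j) (Finset.mem_univ j)
      have := Finset.single_le_sum (f := fun i => ∑ j, L₂ i j) (fun i _ => s2 i)
        (Finset.mem_univ i)
      linarith
    · refine (H3 i x s t hx hs ht).trans (mul_le_mul_of_nonneg_right ?_ (abs_nonneg _))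
      have := Finset.single_le_sum (f := L₃) (fun i _ => h3 i) (Finset.mem_univ i)
      linarith
  set n : ℝ := (Fintype.card ι : ℝ) with hn
  have hU : ∀ h, 0 < h → ∀ k : ℕ, k * h ≤ T + 1 → ∀ i x, |x| ≤ R + 1 + C →
      |lfSeq D c h k i x| ≤ M ∧ |deriv (lfSeq D c h k i) x| ≤ M ∧
      |deriv (deriv (lfSeq D c h k i)) x| ≤ M := by
    intro h hh k hk i x hx
    have h0 := hM h hh.le k hk i 0 (by norm_num) x hx
    have h1 := hM h hh.le k hk i 1 (by norm_num) x hx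
    have h2 := hM h hh.le k hk i 2 (by norm_num) x hx
    rw [iteratedDeriv_zero] at h0
    rw [iteratedDeriv_one] at h1
    rw [iteratedDeriv_succ, iteratedDeriv_one] at h2
    exact ⟨h0, h1, h2⟩
  have hΛ' : ∀ x t, |x| ≤ R + 1 → |t| ≤ T + 1 → (∀ i, |D.lam i x t| ≤ Λ) ∧
      (∀ i j, |D.f i j x t| ≤ Λ) ∧ (∀ i, |D.g i x t| ≤ Λ) := fun x t hx ht => by
    simpa using hΛ 0 le_rfl x t hx ht
  have hsym := fun h (hh : 0 < h) (h1 : h ≤ 1) (k : ℕ) (hk : k * h ≤ T) i x (hx : |x| ≤ R + 1) =>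
    abs_symmetric_difference_le (contDiff_lfSeq hD.smooth c h k i) (x := x) (y := h * c (k * h))
      (M := M) (mul_nonneg hh.le (hD.pos _).le)
      (fun z hz => (hU h hh k (by linarith) i z (by
        have : |z| ≤ |z - x| + |x| := by simpa using abs_add_le (z - x) x
        have h3 : h * c (k * h) ≤ 1 * C := mul_le_mul h1 (hD.mono hk) (hD.pos _).le one_pos.le
        linarith)).2.1)
      (fun z hz => (hU h hh k (by linarith) i z (by
        have : |z| ≤ |z - x| + |x| := by simpa using abs_add_le (z - x) x
        have h3 : h * c (k * h) ≤ 1 * C := mul_le_mul h1 (hD.mono hk) (hD.pos _).le one_pos.le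
        linarith)).2.2)
  -- Lipschitz constant in time of the grid functions: the three summands come from the averaging,
  -- the central difference and the right-hand side.
  set K₁ := M * C ^ 2 + M * C + (n * (Λ * M) + Λ) with hK₁
  have hn0 : 0 ≤ n := Nat.cast_nonneg _
  have hK₁0 : 0 ≤ K₁ := by positivity
  have hinc : ∀ h, 0 < h → h ≤ 1 → ∀ (k : ℕ) (i : ι) (x : ℝ), |x| ≤ R + 1 → k * h ≤ T →
      |lfSeq D c h (k + 1) i x - lfSeq D c h k i x| ≤ K₁ * h := by
    intro h hh h1 k i x hx hk
    have hkh : 0 ≤ k * h := by positivity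
    obtain ⟨s1, -, s3⟩ := hsym h hh h1 k hk i x hx
    have hck := hD.pos (k * h)
    have hcC : c (k * h) ≤ C := hD.mono hk
    have hlam := hD.speed i x _ hkh
    obtain ⟨-, b2, b3⟩ := hΛ' x (k * h) hx (by rw [abs_of_nonneg hkh]; linarith)
    set U := lfSeq D c h k with hUdef
    set ck := c (k * h) with hckdef
    have e1 : lfSeq D c h (k + 1) i x - U i x =
        ((U i (x + h * ck) + U i (x - h * ck)) / 2 - U i x)
        - (2 * ck)⁻¹ * (D.lam i x (k * h) * (U i (x + h * ck) - U i (x - h * ck)))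
        + h * D.rhs (k * h) U i x := by
      rw [lfSeq, lfStep]; ring
    have b1 : |(2 * ck)⁻¹ * (D.lam i x (k * h) * (U i (x + h * ck) - U i (x - h * ck)))| ≤
        M * (h * C) := by
      rw [abs_mul, abs_mul, abs_of_pos (by positivity : 0 < (2 * ck)⁻¹)]
      calc _ ≤ (2 * ck)⁻¹ * (ck * (2 * M * (h * ck))) := by gcongr
        _ = M * (h * ck) := by field_simp
        _ ≤ _ := by gcongr
    have b4 : |D.rhs (k * h) U i x| ≤ n * (Λ * M) + Λ := by
      refine (abs_add_le _ _).trans (add_le_add ?_ (b3 i))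
      refine (Finset.abs_sum_le_sum_abs _ _).trans ?_
      refine (Finset.sum_le_sum (g := fun _ => Λ * M) fun j _ => ?_).trans (le_of_eq ?_)
      · rw [abs_mul]
        exact mul_le_mul (b2 i j) (hU h hh k (by linarith) j x (by linarith)).1 (abs_nonneg _) hΛ0
      · simp [hn]
    have b5 : M * (h * ck) ^ 2 ≤ M * C ^ 2 * h := by
      calc M * (h * ck) ^ 2 = M * (ck ^ 2 * (h * h)) := by ring
        _ ≤ M * (C ^ 2 * (1 * h)) := by gcongr
        _ = _ := by ring
    rw [e1]
    refine (abs_add_le _ _).trans ?_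
    have b6 := (abs_sub _ _).trans (add_le_add (s3.trans b5) b1)
    have b7 : |h * D.rhs (k * h) U i x| ≤ h * (n * (Λ * M) + Λ) := by
      rw [abs_mul, abs_of_pos hh]; gcongr
    rw [hK₁]
    linarith
  refine ⟨(2 * (M * C ^ 2) + L * M + n * (L * M) + n * (Λ * K₁) + L) + Λ * (2 * K₁ + 2 * M),
    by positivity, fun h hh h1 k i x t hx ht hk1 hk2 => ?_⟩
  have hkh : 0 ≤ k * h := by positivity
  have hk : k * h ≤ T := hk1.trans ht
  have hx1 : |x| ≤ R + 1 := by linarith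
  have htT : |t| ≤ T := by rwa [abs_of_nonneg (hkh.trans hk1)]
  have hkT : |k * h| ≤ T := by rwa [abs_of_nonneg hkh]
  have hsq : 0 < √h := Real.sqrt_pos.2 hh
  have hsq1 : √h ≤ 1 := by
    rw [← Real.sqrt_one]; exact Real.sqrt_le_sqrt h1
  have hsqh : √h * √h = h := Real.mul_self_sqrt hh.le
  have hhs : h ≤ √h := by nlinarith
  obtain ⟨-, s2, s3⟩ := hsym h hh h1 k hk i x hx1
  have hck := hD.pos (k * h)
  have hcC : c (k * h) ≤ C := hD.mono hk
  have hlam := hD.speed i x _ hkh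
  obtain ⟨a1, a2, a3⟩ := hΛ' x t hx1 (by linarith)
  obtain ⟨l1, l2, l3⟩ := hL x (k * h) t hx hkT htT
  have hth : |t - k * h| ≤ h := by
    rw [abs_of_nonneg (by linarith)]; linarith
  have hLh : L * |t - k * h| ≤ L * h := by gcongr
  set θ := t / h - k with hθ
  have hθh : θ * h = t - k * h := by rw [hθ, sub_mul, div_mul_cancel₀ _ hh.ne']
  have hθ0 : 0 ≤ θ := by
    rw [hθ, sub_nonneg, le_div_iff₀ hh]; exact hk1
  have hθ1 : θ ≤ 1 := by
    rw [hθ, sub_le_iff_le_add, div_le_iff₀ hh]; linarith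
  have hval : ∀ j m, lfApprox D c h m j x t = iteratedDeriv m (lfSeq D c h k j) x +
      θ * (iteratedDeriv m (lfSeq D c h (k + 1) j) x - iteratedDeriv m (lfSeq D c h k j) x) :=
    fun j m => plInterp_eq _ (by linarith) (by linarith)
  have hk1T : ((k + 1 : ℕ) : ℝ) * h ≤ T + 1 := by push_cast; linarith
  -- The origin of √h: successive levels differ by O(h) and their second derivatives are bounded, so
  -- the interpolation inequality over length √h bounds the difference of first derivatives by
  -- O(h)/√h + O(√h).
  have hdd : |deriv (lfSeq D c h (k + 1) i) x - deriv (lfSeq D c h k i) x| ≤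
      (2 * K₁ + 2 * M) * √h := by
    have cd := fun k => contDiff_lfSeq hD.smooth c h k i
    have cd1 : ∀ k, Differentiable ℝ (lfSeq D c h k i) := fun k => (cd k).differentiable (by simp)
    have cd2 : ∀ k, Differentiable ℝ (deriv (lfSeq D c h k i)) := fun k => by
      have := (cd k).iterate_deriv 1
      exact (show ContDiff ℝ ∞ (deriv (lfSeq D c h k i)) by simpa using this).differentiable
        (by simp)
    have ed : deriv (fun y => lfSeq D c h (k + 1) i y - lfSeq D c h k i y) =
        fun y => deriv (lfSeq D c h (k + 1) i) y - deriv (lfSeq D c h k i) y := by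
      funext y; exact deriv_fun_sub (cd1 _ y) (cd1 _ y)
    have := abs_deriv_le_of_abs_le ((cd (k + 1)).sub (cd k)) (x := x) (d := √h) (ε := K₁ * h)
      (M := 2 * M) hsq (fun y hy => hinc h hh h1 k i y ?_ hk) (fun y hy => ?_)
    · rw [ed] at this
      refine this.trans (le_of_eq ?_)
      have : K₁ * h / √h = K₁ * √h := by
        rw [div_eq_iff hsq.ne', mul_assoc, hsqh]
      rw [mul_div_assoc, this]; ring
    · have := abs_le.1 hx
      exact abs_le.2 ⟨by linarith [hy.1], by linarith [hy.2]⟩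
    · have hy' : |y| ≤ R + 1 + C := by
        have := abs_le.1 hx
        exact abs_le.2 ⟨by linarith [hy.1], by linarith [hy.2]⟩
      rw [ed, deriv_fun_sub (cd2 _ y) (cd2 _ y)]
      have u1 := (hU h hh (k + 1) hk1T i y hy').2.2
      have u2 := (hU h hh k (by linarith) i y hy').2.2
      exact (abs_sub _ _).trans (by linarith)
  have hinc' := fun j => hinc h hh h1 k j x hx1 hk
  have hUk := fun j => hU h hh k (by linarith) j x (by linarith)
  have hrhs : |D.rhs (k * h) (lfSeq D c h k) i x - D.rhs t (fun j y => lfApprox D c h 0 j y t) i x|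
      ≤ n * (L * h * M + Λ * (K₁ * h)) + L * h := by
    have e : D.rhs (k * h) (lfSeq D c h k) i x - D.rhs t (fun j y => lfApprox D c h 0 j y t) i x
        = (∑ j, (-(D.f i j x t - D.f i j x (k * h)) * lfSeq D c h k j x
            - D.f i j x t * (θ * (lfSeq D c h (k + 1) j x - lfSeq D c h k j x))))
          - (D.g i x t - D.g i x (k * h)) := by
      have e' : ∀ j, lfApprox D c h 0 j x t = lfSeq D c h k j x +
          θ * (lfSeq D c h (k + 1) j x - lfSeq D c h k j x) := fun j => by
        simpa using hval j 0
      simp only [TransportData.rhs, e', Finset.sum_sub_distrib, neg_mul, sub_mul, mul_add,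
        Finset.sum_add_distrib, Finset.sum_neg_distrib]
      ring
    rw [e]
    refine (abs_sub _ _).trans (add_le_add ?_ ((l3 i).trans hLh))
    refine (Finset.abs_sum_le_sum_abs _ _).trans ?_
    refine (Finset.sum_le_sum (g := fun _ => L * h * M + Λ * (K₁ * h)) fun j _ => ?_).trans
      (le_of_eq ?_)
    · refine (abs_sub _ _).trans (add_le_add ?_ ?_)
      · rw [abs_mul, abs_neg]
        exact mul_le_mul ((l2 i j).trans hLh) (hUk j).1 (abs_nonneg _) (by positivity)
      · rw [abs_mul, abs_mul, abs_of_nonneg hθ0]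
        refine mul_le_mul (a2 i j) ?_ (by positivity) hΛ0
        calc _ ≤ 1 * (K₁ * h) := by gcongr; exact hinc' j
          _ = _ := one_mul _
    · rw [Finset.sum_const, nsmul_eq_mul, Finset.card_univ]
  set U := lfSeq D c h k with hUdef
  set ck := c (k * h) with hckdef
  set e₁ := (U i (x + h * ck) + U i (x - h * ck)) / 2 - U i x with he₁
  set e₂ := U i (x + h * ck) - U i (x - h * ck) - 2 * (h * ck) * deriv (U i) x with he₂
  set ΔU' := deriv (lfSeq D c h (k + 1) i) x - deriv (U i) x with hΔ
  -- The residual splits into the averaging error, the central difference error, the variation of λ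
  -- in time, the variation of the space derivative between levels, and the variation of the
  -- right-hand side.
  have hmain : (lfSeq D c h (k + 1) i x - U i x) / h + D.lam i x t * lfApprox D c h 1 i x t
        - D.rhs t (fun j y => lfApprox D c h 0 j y t) i x =
      e₁ / h - D.lam i x (k * h) * e₂ / (2 * ck * h)
      + (D.lam i x t - D.lam i x (k * h)) * deriv (U i) x + D.lam i x t * (θ * ΔU')
      + (D.rhs (k * h) U i x - D.rhs t (fun j y => lfApprox D c h 0 j y t) i x) := by
    have e : lfSeq D c h (k + 1) i x = (U i (x - h * ck) + U i (x + h * ck)) / 2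
        + (2 * ck)⁻¹ * (D.lam i x (k * h) * (U i (x - h * ck) - U i (x + h * ck)))
        + h * D.rhs (k * h) U i x := rfl
    rw [hval i 1, iteratedDeriv_one, iteratedDeriv_one, e, he₁, he₂, hΔ]
    clear_value ck U
    generalize D.rhs (k * h) U i x = r₁
    generalize D.lam i x (k * h) = r₂
    field_simp
    ring
  have b1 : |e₁ / h| ≤ M * C ^ 2 * h := by
    rw [abs_div, abs_of_pos hh, div_le_iff₀ hh]
    calc |e₁| ≤ M * (h * ck) ^ 2 := s3
      _ ≤ M * (h * C) ^ 2 := by gcongr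
      _ = _ := by ring
  have b2 : |D.lam i x (k * h) * e₂ / (2 * ck * h)| ≤ M * C ^ 2 * h := by
    rw [abs_div, abs_of_pos (by positivity : 0 < 2 * ck * h), div_le_iff₀ (by positivity), abs_mul]
    calc _ ≤ ck * (2 * M * (h * ck) ^ 2) := by gcongr
      _ = M * ck ^ 2 * h * (2 * ck * h) := by ring
      _ ≤ _ := by gcongr
  have b3 : |(D.lam i x t - D.lam i x (k * h)) * deriv (U i) x| ≤ L * h * M := by
    rw [abs_mul]
    exact mul_le_mul ((l1 i).trans hLh) (hUk i).2.1 (abs_nonneg _) (by positivity)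
  have b4 : |D.lam i x t * (θ * ΔU')| ≤ Λ * ((2 * K₁ + 2 * M) * √h) := by
    rw [abs_mul, abs_mul, abs_of_nonneg hθ0]
    refine mul_le_mul (a1 i) ?_ (by positivity) hΛ0
    calc _ ≤ 1 * ((2 * K₁ + 2 * M) * √h) := by gcongr
      _ = _ := one_mul _
  rw [hmain]
  have := (abs_add_le _ _).trans (add_le_add ((abs_add_le _ _).trans (add_le_add
    ((abs_add_le _ _).trans (add_le_add ((abs_sub _ _).trans (add_le_add b1 b2)) b3)) b4)) hrhs)
  refine this.trans ?_
  have : (2 * (M * C ^ 2) + L * M + n * (L * M) + n * (Λ * K₁) + L) * h ≤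
      (2 * (M * C ^ 2) + L * M + n * (L * M) + n * (Λ * K₁) + L) * √h := by gcongr
  linarith

end Approx

end ColombeauRF

namespace ColombeauRF

open Set Filter Topology Function
open scoped ContDiff

variable {ι : Type*} [Fintype ι] {D : TransportData ι} {c : ℝ → ℝ}

/-! ## Convergence of the Lax–Friedrichs scheme -/

theorem lfApprox_eq {h : ℝ} (hh : 0 < h) {k : ℕ} {t : ℝ} (h1 : k * h ≤ t) (h2 : t ≤ (k + 1) * h)
    (j : ℕ) (i : ι) (x : ℝ) :
    lfApprox D c h j i x t = iteratedDeriv j (lfSeq D c h k i) x + (t / h - k) *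
      (iteratedDeriv j (lfSeq D c h (k + 1) i) x - iteratedDeriv j (lfSeq D c h k i) x) :=
  plInterp_eq _ (by rwa [le_div_iff₀ hh]) (by rwa [div_le_iff₀ hh])

/-- With k h < t ≤ (k + 1) h, times slightly before t lie in one mesh interval. The backward
derivative therefore exists even at grid times, which is all that the maximum principle asks for. -/
theorem hasDerivWithinAt_lfApprox_backward (hD : D.Smooth) {h : ℝ} (hh : 0 < h) {k : ℕ} {t : ℝ}
    (h1 : k * h < t) (h2 : t ≤ (k + 1) * h) (l : ℝ) (i : ι) (x : ℝ) :
    HasDerivWithinAt (fun s => lfApprox D c h 0 i (x - l * s) (t - s))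
      (-((lfSeq D c h (k + 1) i x - lfSeq D c h k i x) / h + l * lfApprox D c h 1 i x t))
      (Ici 0) 0 := by
  have hx : HasDerivAt (fun s : ℝ => x - l * s) (-l) 0 :=
    (((hasDerivAt_id (0 : ℝ)).const_mul l).const_sub x).congr_deriv (by simp)
  have hU : ∀ k, HasDerivAt (fun s : ℝ => lfSeq D c h k i (x - l * s))
      (deriv (lfSeq D c h k i) x * -l) 0 := fun k => by
    have e : HasDerivAt (lfSeq D c h k i) (deriv (lfSeq D c h k i) x) (x - l * 0) := by
      rw [mul_zero, sub_zero]
      exact ((contDiff_lfSeq hD c h k i).differentiable (by simp) x).hasDerivAt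
    exact e.comp 0 hx
  have hθ : HasDerivAt (fun s : ℝ => (t - s) / h - k) (-1 / h) 0 :=
    ((((hasDerivAt_id (0 : ℝ)).const_sub t).div_const h).sub_const _)
  have main := (hU k).fun_add (hθ.fun_mul ((hU (k + 1)).fun_sub (hU k)))
  refine (main.congr_deriv ?_).hasDerivWithinAt.congr_of_eventuallyEq_of_mem ?_ (by simp)
  · rw [lfApprox_eq hh h1.le h2, iteratedDeriv_one, iteratedDeriv_one]
    simp only [mul_zero, sub_zero]
    ring
  · filter_upwards [self_mem_nhdsWithin, nhdsWithin_le_nhds (Iio_mem_nhds (sub_pos.2 h1))]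
      with s hs0 hs1
    rw [lfApprox_eq hh (k := k) (by linarith [mem_Iio.1 hs1]) (by linarith [mem_Ici.1 hs0])]
    simp

theorem hasDerivWithinAt_lfApprox_forward {h : ℝ} (hh : 0 < h) {k : ℕ} {t : ℝ}
    (h1 : k * h ≤ t) (h2 : t < (k + 1) * h) (i : ι) (x : ℝ) :
    HasDerivWithinAt (fun s => lfApprox D c h 0 i x s)
      ((lfSeq D c h (k + 1) i x - lfSeq D c h k i x) / h) (Ici t) t := by
  have main : HasDerivAt (fun s => lfSeq D c h k i x + (s / h - k) *
      (lfSeq D c h (k + 1) i x - lfSeq D c h k i x))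
      ((lfSeq D c h (k + 1) i x - lfSeq D c h k i x) / h) t :=
    (((((hasDerivAt_id t).div_const h).sub_const (k : ℝ)).mul_const _).const_add _).congr_deriv
      (by ring)
  refine main.hasDerivWithinAt.congr_of_eventuallyEq_of_mem ?_ (by simp)
  filter_upwards [self_mem_nhdsWithin, nhdsWithin_le_nhds (Iio_mem_nhds h2)] with s hs0 hs1
  rw [lfApprox_eq hh (k := k) (h1.trans hs0) (le_of_lt hs1)]
  simp

/-- The difference of two approximations has zero initial values and satisfies the homogeneous
system up to the sum of the two residuals. The maximum principle applies with E = 0 and B = K(√h +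
√h'). -/
theorem exists_lfApprox_sub_le (hD : D.Admissible c) (R T : ℝ) :
    ∃ K, 0 ≤ K ∧ ∀ h h', 0 < h → h ≤ 1 → 0 < h' → h' ≤ 1 → ∀ i x t, |x| ≤ R → t ≤ T →
      |lfApprox D c h 0 i x t - lfApprox D c h' 0 i x t| ≤ K * (√h + √h') := by
  set C := c T with hC
  have hCpos := hD.pos T
  obtain ⟨K, hK0, hK⟩ := exists_residual_bound hD (R + C * T) T
  obtain ⟨Λ, hΛ0, hΛ⟩ := hD.smooth.exists_coeff_bound 0 (R + C * T) T
  set A := Fintype.card ι * Λ with hA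
  refine ⟨Real.exp ((A + 1) * T) * K, by positivity, fun h h' hh h1 hh' h1' i x t hx htT => ?_⟩
  rcases le_or_gt t 0 with ht | ht
  · rw [lfApprox_zero_time h 0 i hh.le ht, lfApprox_zero_time h' 0 i hh'.le ht, sub_self, abs_zero]
    positivity
  have key := abs_le_of_transport_inequality (R := R) (T := T) (C := C) (A := A)
    (B := K * (√h + √h')) (E := 0) hCpos.le (by positivity) (by positivity)
    (w := fun i x t => lfApprox D c h 0 i x t - lfApprox D c h' 0 i x t)
    (fun i => (continuous_lfApprox hD.smooth h 0 i).sub (continuous_lfApprox hD.smooth h' 0 i))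
    (fun i x _ => by
      rw [lfApprox_zero_time h 0 i hh.le le_rfl, lfApprox_zero_time h' 0 i hh'.le le_rfl, sub_self,
        abs_zero]) ?_ i ht.le htT (x := x) (by
      have : 0 ≤ C * (T - t) := mul_nonneg hCpos.le (by linarith)
      linarith)
  · rw [max_eq_right (by positivity)] at key
    linarith
  · intro i x t ht htT hx
    have step : ∀ h, 0 < h → ∃ k : ℕ, k * h < t ∧ t ≤ (k + 1) * h := fun h hh => by
      have h0 : 0 < t / h := by positivity
      obtain ⟨k, hk⟩ : ∃ k : ℕ, ⌈t / h⌉₊ = k + 1 :=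
        ⟨⌈t / h⌉₊ - 1, by have := Nat.ceil_pos.2 h0; omega⟩
      refine ⟨k, ?_, ?_⟩
      · rw [← lt_div_iff₀ hh]; exact Nat.lt_ceil.1 (by omega)
      · rw [← div_le_iff₀ hh]; exact_mod_cast hk ▸ Nat.le_ceil (t / h)
    have hx' : |x| ≤ R + C * T := hx.trans (by nlinarith)
    obtain ⟨k, a1, a2⟩ := step h hh
    obtain ⟨k', a1', a2'⟩ := step h' hh'
    have r := hK h hh h1 k i x t hx' htT a1.le a2
    have r' := hK h' hh' h1' k' i x t hx' htT a1'.le a2'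
    refine ⟨D.lam i x t, _, (hD.speed i x t ht.le).trans (hD.mono htT),
      ((hasDerivWithinAt_lfApprox_backward hD.smooth hh a1 a2 (D.lam i x t) i x).fun_sub
        (hasDerivWithinAt_lfApprox_backward hD.smooth hh' a1' a2' (D.lam i x t) i x)).congr_deriv
        (neg_sub_neg _ _ |>.trans (neg_sub _ _).symm), fun M hM => ?_⟩
    set S := (lfSeq D c h (k + 1) i x - lfSeq D c h k i x) / h +
      D.lam i x t * lfApprox D c h 1 i x t
    set S' := (lfSeq D c h' (k' + 1) i x - lfSeq D c h' k' i x) / h' +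
      D.lam i x t * lfApprox D c h' 1 i x t
    have b : |D.rhs t (fun j y => lfApprox D c h 0 j y t) i x -
        D.rhs t (fun j y => lfApprox D c h' 0 j y t) i x| ≤ A * M := by
      have e : D.rhs t (fun j y => lfApprox D c h 0 j y t) i x -
          D.rhs t (fun j y => lfApprox D c h' 0 j y t) i x =
          ∑ j, D.f i j x t * (lfApprox D c h 0 j x t - lfApprox D c h' 0 j x t) := by
        simp only [TransportData.rhs, mul_sub, Finset.sum_sub_distrib]
        ring
      rw [e]
      refine (Finset.abs_sum_le_sum_abs _ _).trans ?_
      refine (Finset.sum_le_sum (g := fun _ => Λ * M) fun j _ => ?_).trans (le_of_eq ?_)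
      · rw [abs_mul]
        refine mul_le_mul ?_ (hM j) (abs_nonneg _) hΛ0
        simpa using (hΛ 0 le_rfl x t hx' (by rwa [abs_of_pos ht])).2.1 i j
      · rw [Finset.sum_const, nsmul_eq_mul, Finset.card_univ, hA]; ring
    rw [abs_le] at *
    constructor <;> linarith

/-- Induction on the order of the derivative: differences of order j are small and those of order j
+ 2 are bounded, so by interpolation differences of order j + 1 are small. -/
theorem lfApprox_cauchy (hD : D.Admissible c) (j : ℕ) (R T : ℝ) {ε : ℝ} (hε : 0 < ε) :
    ∃ δ, 0 < δ ∧ ∀ h h', 0 < h → h ≤ δ → 0 < h' → h' ≤ δ → ∀ i x t, |x| ≤ R → t ≤ T →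
      |lfApprox D c h j i x t - lfApprox D c h' j i x t| ≤ ε := by
  induction j generalizing R ε with
  | zero =>
    obtain ⟨K, hK0, hK⟩ := exists_lfApprox_sub_le hD R T
    set η := ε / (2 * (K + 1)) with hη
    have hη0 : 0 < η := by positivity
    refine ⟨min 1 (η ^ 2), by positivity, fun h h' hh h1 hh' h1' i x t hx ht => ?_⟩
    refine (hK h h' hh (h1.trans (min_le_left _ _)) hh' (h1'.trans (min_le_left _ _))
      i x t hx ht).trans ?_
    have s1 : √h ≤ η := Real.sqrt_le_iff.2 ⟨hη0.le, h1.trans (min_le_right _ _)⟩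
    have s2 : √h' ≤ η := Real.sqrt_le_iff.2 ⟨hη0.le, h1'.trans (min_le_right _ _)⟩
    calc K * (√h + √h') ≤ (K + 1) * (η + η) := by gcongr; linarith
      _ = ε := by rw [hη]; field_simp; ring
  | succ j ih =>
    obtain ⟨M, hM0, hM⟩ := exists_bound_lfApprox hD (j + 2) (R + 1) T
    -- With this length, and ε d / 4 as tolerance for order j, each of the two terms of the
    -- interpolation inequality is at most ε / 2.
    set d := min 1 (ε / (4 * (M + 1))) with hd
    have hd0 : 0 < d := by positivity
    have hd1 : d ≤ 1 := min_le_left _ _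
    obtain ⟨δ, hδ0, hδ⟩ := ih (R + 1) (ε := ε * d / 4) (by positivity)
    refine ⟨min δ 1, by positivity, fun h h' hh h1 hh' h1' i x t hx ht => ?_⟩
    have der : ∀ m y, HasDerivAt (fun y => lfApprox D c h m i y t - lfApprox D c h' m i y t)
        (lfApprox D c h (m + 1) i y t - lfApprox D c h' (m + 1) i y t) y := fun m y =>
      (hasDerivAt_lfApprox hD.smooth h m i y t).sub (hasDerivAt_lfApprox hD.smooth h' m i y t)
    have e : ∀ m, deriv (fun y => lfApprox D c h m i y t - lfApprox D c h' m i y t) =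
        fun y => lfApprox D c h (m + 1) i y t - lfApprox D c h' (m + 1) i y t := fun m =>
      funext fun y => (der m y).deriv
    have hy : ∀ y ∈ Icc x (x + d), |y| ≤ R + 1 := fun y hy => by
      have := abs_le.1 hx
      exact abs_le.2 ⟨by linarith [hy.1], by linarith [hy.2]⟩
    have := abs_deriv_le_of_abs_le ((contDiff_lfApprox hD.smooth h j i t).sub
      (contDiff_lfApprox hD.smooth h' j i t)) (x := x) (ε := ε * d / 4) (M := 2 * M) hd0
      (fun y hyx => hδ h h' hh (h1.trans (min_le_left _ _)) hh' (h1'.trans (min_le_left _ _)) i y t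
        (hy y hyx) ht)
      (fun y hyx => by
        rw [e, e]
        have u1 := hM h hh (h1.trans (min_le_right _ _)) i (j + 1 + 1) (by omega) y t (hy y hyx) ht
        have u2 := hM h' hh' (h1'.trans (min_le_right _ _)) i (j + 1 + 1) (by omega) y t
          (hy y hyx) ht
        exact (abs_sub _ _).trans (by linarith))
    rw [e] at this
    refine this.trans ?_
    have e1 : 2 * (ε * d / 4) / d = ε / 2 := by field_simp; ring
    have e2 : 2 * M * d ≤ ε / 2 := by
      calc 2 * M * d ≤ 2 * (M + 1) * (ε / (4 * (M + 1))) := by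
            gcongr
            · linarith
            · exact min_le_right _ _
        _ = ε / 2 := by field_simp; ring
    linarith

/-- The step sizes `1 / (N + 1)`. -/
noncomputable def lfMesh (N : ℕ) : ℝ := 1 / ((N : ℝ) + 1)

theorem lfMesh_pos (N : ℕ) : 0 < lfMesh N := Nat.one_div_pos_of_nat

theorem lfMesh_le_one (N : ℕ) : lfMesh N ≤ 1 := by
  rw [lfMesh, div_le_one (by positivity)]
  linarith [(Nat.cast_nonneg N : (0 : ℝ) ≤ N)]

theorem tendsto_lfMesh : Tendsto lfMesh atTop (𝓝 0) := tendsto_one_div_add_atTop_nhds_zero_nat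

theorem exists_lfApprox_limit (hD : D.Admissible c) : ∃ w : ℕ → ι → ℝ → ℝ → ℝ,
    ∀ j R T ε, 0 < ε → ∀ᶠ N in atTop, ∀ i x t, |x| ≤ R → t ≤ T →
      |lfApprox D c (lfMesh N) j i x t - w j i x t| ≤ ε := by
  have hc : ∀ j R T ε, 0 < ε → ∃ N₀, ∀ N ≥ N₀, ∀ N' ≥ N₀, ∀ i x t, |x| ≤ R → t ≤ T →
      |lfApprox D c (lfMesh N) j i x t - lfApprox D c (lfMesh N') j i x t| ≤ ε := by
    intro j R T ε hε
    obtain ⟨δ, hδ, H⟩ := lfApprox_cauchy hD j R T hε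
    obtain ⟨N₀, hN₀⟩ := eventually_atTop.1 (tendsto_lfMesh.eventually (ge_mem_nhds hδ))
    exact ⟨N₀, fun N hN N' hN' => H _ _ (lfMesh_pos N) (hN₀ N hN) (lfMesh_pos N') (hN₀ N' hN')⟩
  have hlim : ∀ j i x t, ∃ y, Tendsto (fun N => lfApprox D c (lfMesh N) j i x t) atTop (𝓝 y) := by
    intro j i x t
    refine cauchySeq_tendsto_of_complete (Metric.cauchySeq_iff'.2 fun ε hε => ?_)
    obtain ⟨N₀, H⟩ := hc j |x| t (ε / 2) (by positivity)
    exact ⟨N₀, fun N hN => (H N hN N₀ le_rfl i x t le_rfl le_rfl).trans_lt (by linarith)⟩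
  choose w hw using hlim
  refine ⟨w, fun j R T ε hε => ?_⟩
  obtain ⟨N₀, H⟩ := hc j R T ε hε
  filter_upwards [eventually_ge_atTop N₀] with N hN i x t hx ht
  refine le_of_tendsto ((tendsto_const_nhds.sub (hw j i x t)).abs) ?_
  filter_upwards [eventually_ge_atTop N₀] with N' hN'
  exact H N hN N' hN' i x t hx ht

/-- The Cauchy problem for nonnegative times: the Lax–Friedrichs approximations converge to a
solution, given together with all its space derivatives, in integrated form. -/
theorem exists_forward_solution (hD : D.Admissible c) : ∃ w : ℕ → ι → ℝ → ℝ → ℝ,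
    (∀ j i, Continuous (uncurry (w j i))) ∧
    (∀ j i x t, HasDerivAt (fun y => w j i y t) (w (j + 1) i x t) x) ∧
    (∀ j i x t, t ≤ 0 → w j i x t = iteratedDeriv j (D.init i) x) ∧
    (∀ i x t, 0 ≤ t → w 0 i x t = D.init i x +
      ∫ s in 0..t, (D.rhs s (fun j y => w 0 j y s) i x - D.lam i x s * w 1 i x s)) ∧
    ∀ i x t, Tendsto (fun N => lfApprox D c (lfMesh N) 0 i x t) atTop (𝓝 (w 0 i x t)) := by
  obtain ⟨w, hw⟩ := exists_lfApprox_limit hD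
  have hlim : ∀ j i x t, Tendsto (fun N => lfApprox D c (lfMesh N) j i x t) atTop
      (𝓝 (w j i x t)) := by
    intro j i x t
    rw [Metric.tendsto_atTop']
    intro ε hε
    obtain ⟨N₀, H⟩ := eventually_atTop.1 (hw j |x| t (ε / 2) (by positivity))
    exact ⟨N₀, fun N hN => (H N hN.le i x t le_rfl le_rfl).trans_lt (by linarith)⟩
  have hloc : ∀ j i, TendstoLocallyUniformly
      (fun N => uncurry (lfApprox D c (lfMesh N) j i)) (uncurry (w j i)) atTop := by
    intro j i
    rw [Metric.tendstoLocallyUniformly_iff]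
    rintro ε hε ⟨x, t⟩
    refine ⟨Icc (x - 1) (x + 1) ×ˢ Iic (t + 1), prod_mem_nhds
      (Icc_mem_nhds (by linarith) (by linarith)) (Iic_mem_nhds (by linarith)), ?_⟩
    filter_upwards [hw j (|x| + 1) (t + 1) (ε / 2) (by positivity)] with N hN
    rintro ⟨y, s⟩ ⟨hy, hs⟩
    rw [dist_comm]
    refine (hN i y s ?_ hs).trans_lt (by linarith)
    have := abs_le.1 (le_refl |x|)
    exact abs_le.2 ⟨by linarith [hy.1], by linarith [hy.2]⟩
  have hcont : ∀ j i, Continuous (uncurry (w j i)) := fun j i =>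
    (hloc j i).continuous (Eventually.of_forall
      fun N => continuous_lfApprox hD.smooth (lfMesh N) j i).frequently
  refine ⟨w, hcont, fun j i x t => ?_, fun j i x t ht => ?_, fun i x t ht => ?_, hlim 0⟩
  · refine hasDerivAt_of_tendstoLocallyUniformlyOn (s := univ) isOpen_univ (l := atTop)
      (f := fun N y => lfApprox D c (lfMesh N) j i y t)
      (f' := fun N y => lfApprox D c (lfMesh N) (j + 1) i y t)
      (g' := fun y => w (j + 1) i y t) ?_
      (Eventually.of_forall fun N y _ => hasDerivAt_lfApprox hD.smooth (lfMesh N) j i y t)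
      (fun y _ => hlim j i y t) (mem_univ x)
    rw [tendstoLocallyUniformlyOn_univ]
    exact (hloc (j + 1) i).comp (fun y => (y, t)) (by fun_prop)
  · refine tendsto_nhds_unique (hlim j i x t) ?_
    refine tendsto_const_nhds.congr fun N => ?_
    rw [lfApprox_zero_time (lfMesh N) j i (lfMesh_pos N).le ht]
  · set G : ℝ → ℝ := fun s => D.rhs s (fun j y => w 0 j y s) i x - D.lam i x s * w 1 i x s with hG
    have cs : ∀ {F : ℝ → ℝ → ℝ}, Continuous (uncurry F) → Continuous fun s => F x s :=
      fun hF => hF.comp (Continuous.prodMk continuous_const continuous_id)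
    have hGc : Continuous G := by
      refine Continuous.sub (Continuous.add (continuous_finsetSum _ fun j _ => ?_) ?_) ?_
      · exact (cs (hD.smooth.f i j).continuous).mul (cs (hcont 0 j))
      · exact cs (hD.smooth.g i).continuous
      · exact (cs (hD.smooth.lam i).continuous).mul (cs (hcont 1 i))
    obtain ⟨K, hK0, hK⟩ := exists_residual_bound hD |x| t
    obtain ⟨Λ, hΛ0, hΛ⟩ := hD.smooth.exists_coeff_bound 0 |x| t
    set n : ℝ := (Fintype.card ι : ℝ) with hn
    have key : ∀ ε, 0 < ε → |w 0 i x t - (D.init i x + ∫ s in 0..t, G s)| ≤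
        (n * Λ + Λ + 1) * ε * t := by
      intro ε hε
      have hsq : Tendsto (fun N => K * √(lfMesh N)) atTop (𝓝 0) := by
        have := ((Real.continuous_sqrt.tendsto 0).comp tendsto_lfMesh).const_mul K
        simpa using this
      have hconv : Tendsto (fun N => |lfApprox D c (lfMesh N) 0 i x t -
          (D.init i x + ∫ s in 0..t, G s)|) atTop
          (𝓝 |w 0 i x t - (D.init i x + ∫ s in 0..t, G s)|) :=
        ((hlim 0 i x t).sub_const _).abs
      refine le_of_tendsto hconv ?_
      filter_upwards [hw 0 |x| t ε hε, hw 1 |x| t ε hε, hsq.eventually (ge_mem_nhds hε)]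
        with N h0 h1 h2
      have hh := lfMesh_pos N
      -- The approximation minus the primitive of `G` has a small right derivative at every time. In
      -- its bound, 1 stands for the residual, nΛ for the error in the zeroth order terms and Λ for
      -- the error in λ ∂_x w.
      have := norm_image_sub_le_of_norm_deriv_right_le_segment (a := 0) (b := t)
        (f := fun s => lfApprox D c (lfMesh N) 0 i x s - ∫ r in 0..s, G r)
        (f' := fun s => (lfSeq D c (lfMesh N) (⌊s / lfMesh N⌋₊ + 1) i x -
          lfSeq D c (lfMesh N) ⌊s / lfMesh N⌋₊ i x) / lfMesh N - G s)
        (C := (n * Λ + Λ + 1) * ε) ?_ ?_ ?_ t ⟨ht, le_rfl⟩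
      · simp only [intervalIntegral.integral_same, sub_zero, Real.norm_eq_abs] at this
        rw [lfApprox_zero_time (lfMesh N) 0 i hh.le le_rfl, iteratedDeriv_zero] at this
        rwa [sub_right_comm, sub_sub] at this
      · refine Continuous.continuousOn ?_
        exact (cs (continuous_lfApprox hD.smooth (lfMesh N) 0 i)).sub
          (intervalIntegral.continuous_primitive (fun a b => hGc.intervalIntegrable a b) 0)
      · intro s hs
        have f1 := Nat.floor_le (div_nonneg hs.1 hh.le)
        have f2 := Nat.lt_floor_add_one (s / lfMesh N)
        rw [le_div_iff₀ hh] at f1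
        rw [div_lt_iff₀ hh] at f2
        exact (hasDerivWithinAt_lfApprox_forward hh f1 f2 i x).fun_sub
          (hGc.integral_hasStrictDerivAt 0 s).hasDerivAt.hasDerivWithinAt
      · intro s hs
        have f1 := Nat.floor_le (div_nonneg hs.1 hh.le)
        have f2 := Nat.lt_floor_add_one (s / lfMesh N)
        rw [le_div_iff₀ hh] at f1
        rw [div_lt_iff₀ hh] at f2
        have r := hK _ hh (lfMesh_le_one N) _ i x s le_rfl hs.2.le f1 f2.le
        have b := hΛ 0 le_rfl x s le_rfl (by rw [abs_of_nonneg hs.1]; exact hs.2.le)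
        simp only [iteratedDeriv_zero] at b
        have e : ∀ σ : ℝ, σ - G s = (σ + D.lam i x s * lfApprox D c (lfMesh N) 1 i x s
            - D.rhs s (fun j y => lfApprox D c (lfMesh N) 0 j y s) i x)
            + ((∑ j, D.f i j x s * (lfApprox D c (lfMesh N) 0 j x s - w 0 j x s))
            - D.lam i x s * (lfApprox D c (lfMesh N) 1 i x s - w 1 i x s)) := fun σ => by
          simp only [hG, TransportData.rhs, mul_sub, Finset.sum_sub_distrib]
          ring
        rw [Real.norm_eq_abs, e]
        have b1 : |∑ j, D.f i j x s * (lfApprox D c (lfMesh N) 0 j x s - w 0 j x s)| ≤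
            n * (Λ * ε) := by
          refine (Finset.abs_sum_le_sum_abs _ _).trans ?_
          refine (Finset.sum_le_sum (g := fun _ => Λ * ε) fun j _ => ?_).trans (le_of_eq ?_)
          · rw [abs_mul]
            exact mul_le_mul (b.2.1 i j) (h0 j x s le_rfl hs.2.le) (abs_nonneg _) hΛ0
          · rw [Finset.sum_const, nsmul_eq_mul, Finset.card_univ]
        have b2 : |D.lam i x s * (lfApprox D c (lfMesh N) 1 i x s - w 1 i x s)| ≤ Λ * ε := by
          rw [abs_mul]
          exact mul_le_mul (b.1 i) (h1 i x s le_rfl hs.2.le) (abs_nonneg _) hΛ0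
        refine (abs_add_le _ _).trans ?_
        have := (abs_sub _ _).trans (add_le_add b1 b2)
        linarith
    have hz : |w 0 i x t - (D.init i x + ∫ s in 0..t, G s)| ≤ 0 := by
      have l1 : Tendsto (fun ε : ℝ => (n * Λ + Λ + 1) * ε * t) (𝓝[>] 0) (𝓝 0) := by
        have : Continuous fun ε : ℝ => (n * Λ + Λ + 1) * ε * t := by fun_prop
        have := (this.tendsto 0).mono_left (nhdsWithin_le_nhds (s := Ioi 0))
        simpa using this
      refine ge_of_tendsto l1 ?_
      filter_upwards [self_mem_nhdsWithin] with ε hε using key ε hε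
    exact sub_eq_zero.1 (abs_nonpos_iff.1 hz)

end ColombeauRF

namespace ColombeauRF

open Set Filter Topology Function
open scoped ContDiff

/-! ## Smoothness and existence of solutions -/

theorem continuous_slice_right {F : ℝ → ℝ → ℝ} (hF : Continuous (uncurry F)) (x : ℝ) :
    Continuous fun s => F x s :=
  hF.comp (Continuous.prodMk continuous_const continuous_id)

/-- The partial derivative with respect to time of the space derivative of `u`. -/
theorem hasDerivAt_swap {u u₁ G G₁ : ℝ → ℝ → ℝ} (hG : Continuous (uncurry G))
    (hG₁ : Continuous (uncurry G₁)) (hux : ∀ x t, HasDerivAt (fun y => u y t) (u₁ x t) x)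
    (hut : ∀ x t, HasDerivAt (fun s => u x s) (G x t) t)
    (hGx : ∀ x t, HasDerivAt (fun y => G y t) (G₁ x t) x) (x t : ℝ) :
    HasDerivAt (fun s => u₁ x s) (G₁ x t) t := by
  -- Integrating in time, differentiating under the integral in x and differentiating the result in
  -- time exchanges the two derivatives without assuming that u is twice differentiable.
  have h1 : ∀ x t, u x t = u x 0 + ∫ s in 0..t, G x s := fun x t => by
    rw [intervalIntegral.integral_eq_sub_of_hasDerivAt (fun s _ => hut x s)
      ((continuous_slice_right hG x).intervalIntegrable _ _)]
    ring
  have h2 : ∀ x t, HasDerivAt (fun y => ∫ s in 0..t, G y s) (∫ s in 0..t, G₁ x s) x := by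
    intro x t
    obtain ⟨M, hM⟩ := exists_bound_on_box hG₁ (|x| + 1) |t|
    refine (intervalIntegral.hasDerivAt_integral_of_dominated_loc_of_deriv_le (μ := volume)
      (F := G) (F' := G₁) (bound := fun _ => M) (s := Metric.ball x 1)
      (Metric.ball_mem_nhds x one_pos)
      (Eventually.of_forall fun y => (continuous_slice_right hG y).aestronglyMeasurable)
      ((continuous_slice_right hG x).intervalIntegrable _ _)
      (continuous_slice_right hG₁ x).aestronglyMeasurable
      (Eventually.of_forall fun s hs y hy => hM y s ?_ ?_) intervalIntegrable_const
      (Eventually.of_forall fun s _ y _ => hGx y s)).2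
    · have : |y| ≤ |y - x| + |x| := by simpa using abs_add_le (y - x) x
      have := Metric.mem_ball.1 hy
      rw [Real.dist_eq] at this
      linarith
    · have := abs_sub_left_of_mem_uIcc (uIoc_subset_uIcc hs)
      simpa using this
  have h3 : ∀ t, u₁ x t = u₁ x 0 + ∫ s in 0..t, G₁ x s := fun t => by
    refine (hux x t).unique ?_
    have : (fun y => u y t) = fun y => u y 0 + ∫ s in 0..t, G y s := funext fun y => h1 y t
    rw [this]
    exact (hux x 0).add (h2 x t)
  have h4 : (fun s => u₁ x s) = fun t => u₁ x 0 + ∫ s in 0..t, G₁ x s := funext h3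
  rw [h4]
  exact ((continuous_slice_right hG₁ x).integral_hasStrictDerivAt 0 t).hasDerivAt.const_add _

theorem contDiff_deriv_slice_of_succ {F : ℝ → ℝ → ℝ} {k : ℕ}
    (hF : ContDiff ℝ ((k : WithTop ℕ∞) + 1) (uncurry F)) :
    (∀ x t, HasDerivAt (fun y => F y t) (deriv (fun y => F y t) x) x) ∧
    ContDiff ℝ k (uncurry fun x t => deriv (fun y => F y t) x) := by
  have h0 : ∀ x t, HasDerivAt (fun y => F y t) (fderiv ℝ (uncurry F) (x, t) (1, 0)) x := by
    intro x t
    have h1 := (hF.differentiable (by simp) (x, t)).hasFDerivAt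
    have h2 : HasDerivAt (fun y : ℝ => (y, t)) ((1 : ℝ), (0 : ℝ)) x :=
      (hasDerivAt_id x).prodMk (hasDerivAt_const x t)
    exact h1.comp_hasDerivAt x h2
  refine ⟨fun x t => (h0 x t).differentiableAt.hasDerivAt, ?_⟩
  have : (uncurry fun x t => deriv (fun y => F y t) x) =
      fun z => fderiv ℝ (uncurry F) z (1, 0) := by
    funext ⟨x, t⟩; exact (h0 x t).deriv
  rw [this]
  exact (hF.fderiv_right le_rfl).clm_apply contDiff_const

/-- Continuous partial derivatives give a joint Fréchet derivative, and its two components are C^k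
by hypothesis. -/
theorem contDiff_succ_of_partial {u u₁ u₂ : ℝ → ℝ → ℝ} {k : ℕ}
    (h₁ : ContDiff ℝ k (uncurry u₁)) (h₂ : ContDiff ℝ k (uncurry u₂))
    (hux : ∀ x t, HasDerivAt (fun y => u y t) (u₁ x t) x)
    (hut : ∀ x t, HasDerivAt (fun s => u x s) (u₂ x t) t) :
    ContDiff ℝ ((k : WithTop ℕ∞) + 1) (uncurry u) := by
  set f₁ : ℝ → ℝ → ℝ →L[ℝ] ℝ := fun x t => ContinuousLinearMap.toSpanSingleton ℝ (u₁ x t)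
  set f₂ : ℝ → ℝ → ℝ →L[ℝ] ℝ := fun x t => ContinuousLinearMap.toSpanSingleton ℝ (u₂ x t)
  have c₁ : ContDiff ℝ k (uncurry f₁) :=
    (ContinuousLinearMap.toSpanSingletonCLE (𝕜 := ℝ) (E := ℝ)).contDiff.comp h₁
  have c₂ : ContDiff ℝ k (uncurry f₂) :=
    (ContinuousLinearMap.toSpanSingletonCLE (𝕜 := ℝ) (E := ℝ)).contDiff.comp h₂
  refine contDiff_succ_iff_hasFDerivAt.2 ⟨fun z => (uncurry f₁ z).coprod (uncurry f₂ z), ?_,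
    fun z => ?_⟩
  · have : (fun z => (uncurry f₁ z).coprod (uncurry f₂ z)) = fun z =>
        uncurry u₁ z • ContinuousLinearMap.fst ℝ ℝ ℝ + uncurry u₂ z •
          ContinuousLinearMap.snd ℝ ℝ ℝ := by
      funext z
      ext <;> simp [f₁, f₂, uncurry]
    rw [this]
    exact (h₁.smul contDiff_const).add (h₂.smul contDiff_const)
  · exact (hasStrictFDerivAt_uncurry_coprod (f := u) (f₁ := f₁) (f₂ := f₂) (u := z)
      (Eventually.of_forall fun v => (hux v.1 v.2).hasFDerivAt)
      (Eventually.of_forall fun v => (hut v.1 v.2).hasFDerivAt)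
      c₁.continuous.continuousAt c₂.continuous.continuousAt).hasFDerivAt

variable {ι : Type*} [Fintype ι]

/-- A solution of the transport system all of whose space derivatives exist and are continuous is as
smooth as the source term. -/
theorem contDiff_of_transport (k : ℕ) {lam : ι → ℝ → ℝ → ℝ} {f : ι → ι → ℝ → ℝ → ℝ}
    {g : ι → ℝ → ℝ → ℝ} (hlam : ∀ i, ContDiff ℝ ∞ (uncurry (lam i)))
    (hf : ∀ i j, ContDiff ℝ ∞ (uncurry (f i j))) (hg : ∀ i, ContDiff ℝ k (uncurry (g i)))
    {w : ℕ → ι → ℝ → ℝ → ℝ} (hw : ∀ j i, Continuous (uncurry (w j i)))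
    (hwx : ∀ j i x t, HasDerivAt (fun y => w j i y t) (w (j + 1) i x t) x)
    (hwt : ∀ i x t, HasDerivAt (fun s => w 0 i x s)
      ((∑ j, f i j x t * w 0 j x t) + g i x t - lam i x t * w 1 i x t) t) (i : ι) :
    ContDiff ℝ k (uncurry (w 0 i)) := by
  classical
  induction k generalizing f g w i with
  | zero => exact contDiff_zero.2 (hw 0 i)
  | succ k ih =>
    have hkk : ((k : ℕ) : WithTop ℕ∞) ≤ ((k + 1 : ℕ) : WithTop ℕ∞) := by exact_mod_cast k.le_succ
    have hk : ((k : ℕ) : WithTop ℕ∞) ≤ ((⊤ : ℕ∞) : WithTop ℕ∞) := by exact_mod_cast le_top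
    push_cast at hg
    have hg' := fun i => contDiff_deriv_slice_of_succ (hg i)
    have h0 := ih hf (fun i => (hg i).of_le (by exact_mod_cast hkk)) hw hwx hwt
    set dlam : ι → ℝ → ℝ → ℝ := fun i x t => deriv (fun y => lam i y t) x with hdlam
    set df : ι → ι → ℝ → ℝ → ℝ := fun i j x t => deriv (fun y => f i j y t) x with hdf
    set dg : ι → ℝ → ℝ → ℝ := fun i x t => deriv (fun y => g i y t) x with hdg
    have dlamS : ∀ i, ContDiff ℝ ∞ (uncurry (dlam i)) := fun i => contDiff_deriv_slice (hlam i)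
    have dfS : ∀ i j, ContDiff ℝ ∞ (uncurry (df i j)) := fun i j => contDiff_deriv_slice (hf i j)
    have hlamx : ∀ i x t, HasDerivAt (fun y => lam i y t) (dlam i x t) x := fun i x t =>
      ((contDiff_slice (hlam i) t).differentiable (by simp) x).hasDerivAt
    have hfx : ∀ i j x t, HasDerivAt (fun y => f i j y t) (df i j x t) x := fun i j x t =>
      ((contDiff_slice (hf i j) t).differentiable (by simp) x).hasDerivAt
    -- The differentiated equation is a system for `w 1` with f_ij - δ_ij ∂_xλ_i in place of f_ij.
    -- Its source contains `w 0`, already known to be C^k. The induction hypothesis applies to the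
    -- shifted sequence, which is why f, g and w vary in the induction.
    have h1 : ∀ i, ContDiff ℝ k (uncurry (w 1 i)) := by
      refine ih (f := fun i j x t => f i j x t - if i = j then dlam i x t else 0)
        (g := fun i x t => (∑ j, df i j x t * w 0 j x t) + dg i x t)
        (w := fun j => w (j + 1)) (fun i j => ?_) (fun i => ?_) (fun j => hw (j + 1))
        (fun j => hwx (j + 1)) (fun i x t => ?_)
      · refine (hf i j).sub ?_
        split_ifs
        · exact dlamS i
        · exact contDiff_const
      · exact ContDiff.add (ContDiff.sum fun j _ => ((dfS i j).of_le hk).mul (h0 j)) (hg' i).2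
      · have := hasDerivAt_swap (u := w 0 i) (u₁ := w 1 i)
          (G := fun x t => (∑ j, f i j x t * w 0 j x t) + g i x t - lam i x t * w 1 i x t)
          (G₁ := fun x t => (∑ j, (df i j x t * w 0 j x t + f i j x t * w 1 j x t)) + dg i x t
            - (dlam i x t * w 1 i x t + lam i x t * w 2 i x t)) ?_ ?_ (hwx 0 i) (hwt i) ?_ x t
        · refine this.congr_deriv ?_
          simp only [sub_mul, Finset.sum_sub_distrib, Finset.sum_add_distrib, ite_mul, zero_mul,
            Finset.sum_ite_eq, Finset.mem_univ, if_true]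
          ring
        · exact ((continuous_finsetSum _ fun j _ => (hf i j).continuous.mul (hw 0 j)).add
            (hg i).continuous).sub ((hlam i).continuous.mul (hw 1 i))
        · exact ((continuous_finsetSum _ fun j _ => ((dfS i j).continuous.mul (hw 0 j)).add
            ((hf i j).continuous.mul (hw 1 j))).add (hg' i).2.continuous).sub
            (((dlamS i).continuous.mul (hw 1 i)).add ((hlam i).continuous.mul (hw 2 i)))
        · intro x t
          exact ((HasDerivAt.fun_sum fun j _ => (hfx i j x t).fun_mul (hwx 0 j x t)).fun_add
            ((hg' i).1 x t)).fun_sub ((hlamx i x t).fun_mul (hwx 1 i x t))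
    have hG : ContDiff ℝ k (uncurry fun x t =>
        (∑ j, f i j x t * w 0 j x t) + g i x t - lam i x t * w 1 i x t) :=
      (ContDiff.add (ContDiff.sum fun j _ => ((hf i j).of_le hk).mul (h0 j))
        ((hg i).of_le (by exact_mod_cast hkk))).sub (((hlam i).of_le hk).mul (h1 i))
    push_cast
    exact contDiff_succ_of_partial (h1 i) hG (hwx 0 i) (hwt i)

/-- Time reversal. -/
def TransportData.reverse (D : TransportData ι) : TransportData ι where
  lam i x t := -D.lam i x (-t)
  f i j x t := -D.f i j x (-t)
  g i x t := -D.g i x (-t)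
  init := D.init

theorem TransportData.Smooth.reverse {κ : Type*} {D : TransportData κ} (hD : D.Smooth) :
    D.reverse.Smooth := by
  have key : ∀ {F : ℝ → ℝ → ℝ}, ContDiff ℝ ∞ (uncurry F) →
      ContDiff ℝ ∞ (uncurry fun x t => -F x (-t)) := fun hF =>
    (hF.comp (contDiff_fst.prodMk contDiff_snd.neg)).neg
  exact ⟨fun i => key (hD.lam i), fun i j => key (hD.f i j), fun i => key (hD.g i), hD.init⟩

/-- The approximations of the solution on the whole plane. -/
noncomputable def lfGlobal (D : TransportData ι) (c : ℝ → ℝ) (N : ℕ) (i : ι) (x t : ℝ) : ℝ :=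
  lfApprox D c (lfMesh N) 0 i x t + lfApprox D.reverse c (lfMesh N) 0 i x (-t) - D.init i x

/-- Existence of smooth solutions on the whole plane, as limits of the explicit approximations
`lfGlobal`. -/
theorem exists_smooth_solution {D : TransportData ι} (hD : D.Smooth) {c : ℝ → ℝ}
    (hc : ∀ t, 0 < c t) (hmono : Monotone c) (hspeed : ∀ i x t, |D.lam i x t| ≤ c |t|) :
    ∃ u : ι → ℝ → ℝ → ℝ, (∀ i, ContDiff ℝ ∞ (uncurry (u i))) ∧ (∀ i x, u i x 0 = D.init i x) ∧
      (∀ i x t, HasDerivAt (fun s => u i x s)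
        (D.rhs t (fun j y => u j y t) i x - D.lam i x t * deriv (fun y => u i y t) x) t) ∧
      ∀ i x t, Tendsto (fun N => lfGlobal D c N i x t) atTop (𝓝 (u i x t)) := by
  have hA : D.Admissible c := ⟨hD, hc, hmono, fun i x t ht => by
    simpa [abs_of_nonneg ht] using hspeed i x t⟩
  have hA' : D.reverse.Admissible c := ⟨hD.reverse, hc, hmono, fun i x t ht => by
    simpa [TransportData.reverse, abs_of_nonneg ht] using hspeed i x (-t)⟩
  obtain ⟨p, pc, px, p0, pI, pl⟩ := exists_forward_solution hA
  obtain ⟨q, qc, qx, q0, qI, ql⟩ := exists_forward_solution hA'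
  -- For nonpositive arguments the forward and the reversed solution both equal the initial data. At
  -- every t one of the two therefore cancels against the subtracted term.
  set w : ℕ → ι → ℝ → ℝ → ℝ := fun j i x t =>
    p j i x t + q j i x (-t) - iteratedDeriv j (D.init i) x with hw
  have wpos : ∀ j i x t, 0 ≤ t → w j i x t = p j i x t := fun j i x t ht => by
    simp only [hw]
    rw [q0 j i x (-t) (by linarith)]
    exact add_sub_cancel_right _ _
  have wneg : ∀ j i x t, t ≤ 0 → w j i x t = q j i x (-t) := fun j i x t ht => by
    simp only [hw]
    rw [p0 j i x t ht]
    ring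
  have wc : ∀ j i, Continuous (uncurry (w j i)) := fun j i => by
    have h1 : Continuous (iteratedDeriv j (D.init i)) :=
      (hD.init i).continuous_iteratedDeriv _ (by exact_mod_cast le_top)
    exact ((pc j i).add ((qc j i).comp (continuous_fst.prodMk continuous_snd.neg))).sub
      (h1.comp continuous_fst)
  have wx : ∀ j i x t, HasDerivAt (fun y => w j i y t) (w (j + 1) i x t) x := fun j i x t => by
    refine ((px j i x t).fun_add (qx j i x (-t))).fun_sub ?_
    rw [iteratedDeriv_succ]
    exact ((hD.init i).differentiable_iteratedDeriv j
      (by exact_mod_cast WithTop.coe_lt_top j) x).hasDerivAt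
  set G : ι → ℝ → ℝ → ℝ := fun i x t =>
    (∑ j, D.f i j x t * w 0 j x t) + D.g i x t - D.lam i x t * w 1 i x t with hG
  have Gc : ∀ i, Continuous (uncurry (G i)) := fun i =>
    ((continuous_finsetSum _ fun j _ => (hD.f i j).continuous.mul (wc 0 j)).add
      (hD.g i).continuous).sub ((hD.lam i).continuous.mul (wc 1 i))
  -- The integrated equation holds on both sides of t = 0 with one continuous integrand, so
  -- differentiability across t = 0 needs no matching of derivatives.
  have wI : ∀ i x t, w 0 i x t = D.init i x + ∫ s in 0..t, G i x s := by
    intro i x t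
    rcases le_total 0 t with ht | ht
    · rw [wpos 0 i x t ht, pI i x t ht]
      congr 1
      refine intervalIntegral.integral_congr fun s hs => ?_
      rw [uIcc_of_le ht] at hs
      simp only [hG, TransportData.rhs, wpos _ _ _ _ hs.1]
    · rw [wneg 0 i x t ht, qI i x (-t) (by linarith)]
      have e : ∫ s in 0..(-t), (D.reverse.rhs s (fun j y => q 0 j y s) i x -
          D.reverse.lam i x s * q 1 i x s) = ∫ s in 0..(-t), -G i x (-s) := by
        refine intervalIntegral.integral_congr fun s hs => ?_
        rw [uIcc_of_le (by linarith)] at hs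
        have e : ∀ j i, w j i x (-s) = q j i x s := fun j i => by
          rw [wneg j i x (-s) (by linarith [hs.1]), neg_neg]
        simp only [hG, TransportData.rhs, TransportData.reverse, e, neg_mul,
          Finset.sum_neg_distrib]
        ring
      rw [e, intervalIntegral.integral_neg, intervalIntegral.integral_comp_neg (fun s => G i x s),
        neg_neg, neg_zero, ← intervalIntegral.integral_symm]
      rfl
  have wt : ∀ i x t, HasDerivAt (fun s => w 0 i x s) (G i x t) t := fun i x t => by
    have : (fun s => w 0 i x s) = fun t => D.init i x + ∫ s in 0..t, G i x s :=
      funext fun t => wI i x t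
    rw [this]
    exact ((continuous_slice_right (Gc i) x).integral_hasStrictDerivAt 0 t).hasDerivAt.const_add _
  refine ⟨w 0, fun i => contDiff_infty.2 fun k => ?_, fun i x => ?_, fun i x t => ?_,
    fun i x t => ?_⟩
  · exact contDiff_of_transport k hD.lam hD.f
      (fun i => (hD.g i).of_le (by exact_mod_cast le_top)) wc wx wt i
  · rw [wI]; simp
  · rw [(wx 0 i x t).deriv]; exact wt i x t
  · exact ((pl i x t).add (ql i x (-t))).sub tendsto_const_nhds

end ColombeauRF

namespace ColombeauRF

open Set Filter Topology Function

/-! ## Riemann sums and the `L^p` norm of integrals of random functions -/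

/-- Riemann sums involve only values at finitely many points. Measurability at each point and the
triangle inequality in L^p then suffice to treat integrals of random functions. -/
theorem tendsto_riemann_sum {φ : ℝ → ℝ} (hφ : Continuous φ) {a b : ℝ} (hab : a ≤ b) :
    Tendsto (fun N : ℕ => ∑ k ∈ Finset.range N, (b - a) / N * φ (a + k * ((b - a) / N))) atTop
      (𝓝 (∫ y in a..b, φ y)) := by
  rw [Metric.tendsto_atTop']
  intro ε hε
  have huc := isCompact_Icc.uniformContinuousOn_of_continuous (hφ.continuousOn (s := Icc a b))
  rw [Metric.uniformContinuousOn_iff_le] at huc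
  set η := ε / (2 * (b - a + 1)) with hη
  have hba : 0 ≤ b - a := sub_nonneg.2 hab
  have hη0 : 0 < η := by positivity
  obtain ⟨δ, hδ, H⟩ := huc η hη0
  obtain ⟨N₀, hN₀⟩ := exists_nat_gt ((b - a) / δ)
  refine ⟨N₀, fun N hN => ?_⟩
  have hNpos : 0 < (N : ℝ) := by exact_mod_cast (Nat.zero_le _).trans_lt hN
  set s := (b - a) / N with hs
  have hs0 : 0 ≤ s := by positivity
  have hNs : N * s = b - a := by rw [hs]; field_simp
  have hsδ : s ≤ δ := by
    rw [hs, div_le_iff₀ hNpos, mul_comm, ← div_le_iff₀ hδ]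
    exact hN₀.le.trans (by exact_mod_cast hN.le)
  have e1 : ∫ y in a..b, φ y =
      ∑ k ∈ Finset.range N, ∫ y in (a + k * s)..(a + (k + 1 : ℕ) * s), φ y := by
    rw [intervalIntegral.sum_integral_adjacent_intervals (a := fun k : ℕ => a + k * s)
      fun k _ => hφ.intervalIntegrable _ _]
    simp [hNs]
  rw [Real.dist_eq, abs_sub_comm, e1, ← Finset.sum_sub_distrib]
  refine (Finset.abs_sum_le_sum_abs _ _).trans_lt ?_
  refine (Finset.sum_le_sum (g := fun _ => η * s) fun k hk => ?_).trans_lt ?_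
  · have hle : a + k * s ≤ a + (k + 1 : ℕ) * s := by push_cast; linarith
    have hkN : ((k + 1 : ℕ) : ℝ) ≤ N := by exact_mod_cast Finset.mem_range.1 hk
    have hub : a + (k + 1 : ℕ) * s ≤ b := by
      have := mul_le_mul_of_nonneg_right hkN hs0
      linarith
    have hlb : a ≤ a + k * s := by
      have : 0 ≤ k * s := by positivity
      linarith
    have e2 : s * φ (a + k * s) = ∫ y in (a + k * s)..(a + (k + 1 : ℕ) * s), φ (a + k * s) := by
      rw [intervalIntegral.integral_const, smul_eq_mul]; push_cast; ring
    rw [e2, ← intervalIntegral.integral_sub (hφ.intervalIntegrable _ _) intervalIntegrable_const]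
    rw [← Real.norm_eq_abs]
    refine (intervalIntegral.norm_integral_le_of_norm_le_const (C := η) fun y hy => ?_).trans
      (le_of_eq ?_)
    · rw [uIoc_of_le hle] at hy
      refine H y ⟨hlb.trans hy.1.le, hy.2.trans hub⟩ _ ⟨hlb, hle.trans hub⟩ ?_
      rw [Real.dist_eq, abs_of_nonneg (by linarith [hy.1])]
      have := hy.2
      push_cast at this
      linarith
    · rw [abs_of_nonneg (by linarith)]; push_cast; ring
  · rw [Finset.sum_const, Finset.card_range, nsmul_eq_mul]
    have : N * (η * s) = η * (b - a) := by rw [← hNs]; ring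
    rw [this, hη, div_mul_eq_mul_div, div_lt_iff₀ (by positivity)]
    nlinarith

section Probability

variable {Ω : Type*} [MeasurableSpace Ω] {P : Measure Ω} {p : ℝ≥0∞}

/-- Minkowski's inequality for integrals of random functions with continuous paths. -/
theorem eLpNorm_integral_abs_le (hp : 1 ≤ p) {H : ℝ → Ω → ℝ} {a b : ℝ} (hab : a ≤ b)
    (hm : ∀ y, AEStronglyMeasurable (H y) P) (hc : ∀ᵐ ω ∂P, Continuous fun y => H y ω)
    {C : ℝ≥0∞} (hC : ∀ y ∈ Icc a b, eLpNorm (H y) p P ≤ C) :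
    AEStronglyMeasurable (fun ω => ∫ y in a..b, |H y ω|) P ∧
      eLpNorm (fun ω => ∫ y in a..b, |H y ω|) p P ≤ ENNReal.ofReal (b - a) * C := by
  set S : ℕ → Ω → ℝ := fun N => ∑ k ∈ Finset.range N,
    fun ω => (b - a) / N * |H (a + k * ((b - a) / N)) ω| with hS
  have hba : 0 ≤ b - a := sub_nonneg.2 hab
  have hterm : ∀ (N k : ℕ), AEStronglyMeasurable
      (fun ω => (b - a) / N * |H (a + k * ((b - a) / N)) ω|) P := fun N k =>
    ((hm _).norm).const_mul _
  have hSm : ∀ N, AEStronglyMeasurable (S N) P := fun N =>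
    Finset.aestronglyMeasurable_sum _ fun k _ => hterm N k
  have hlim : ∀ᵐ ω ∂P, Tendsto (fun N => S N ω) atTop (𝓝 (∫ y in a..b, |H y ω|)) := by
    filter_upwards [hc] with ω hω
    have := tendsto_riemann_sum (φ := fun y => |H y ω|) hω.abs hab
    simpa [hS, Finset.sum_apply] using this
  refine ⟨aestronglyMeasurable_of_tendsto_ae atTop hSm hlim, ?_⟩
  -- The L^p norm is lower semicontinuous under almost sure convergence, so a bound on the Riemann
  -- sums passes to the integral.
  refine Lp.eLpNorm_le_of_ae_tendsto (u := atTop) (Eventually.of_forall fun N => ?_) hSm hlim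
  rcases Nat.eq_zero_or_pos N with rfl | hN
  · simp [hS]
  have hN' : (0 : ℝ) < N := by exact_mod_cast hN
  refine (eLpNorm_sum_le (fun k _ => hterm N k) hp).trans ?_
  refine (Finset.sum_le_sum (g := fun _ => ENNReal.ofReal ((b - a) / N) * C) fun k hk => ?_).trans ?_
  · have h1 : eLpNorm (fun ω => (b - a) / N * |H (a + k * ((b - a) / N)) ω|) p P =
        ‖(b - a) / N‖ₑ * eLpNorm (H (a + k * ((b - a) / N))) p P := by
      have := eLpNorm_const_smul ((b - a) / (N : ℝ)) (fun ω => |H (a + k * ((b - a) / N)) ω|) p P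
      rw [← eLpNorm_norm (H _)]
      exact this
    rw [h1, Real.enorm_of_nonneg (by positivity)]
    refine mul_le_mul_right (hC _ ⟨?_, ?_⟩) _
    · have : 0 ≤ k * ((b - a) / N) := by positivity
      linarith
    · have hk' : (k : ℝ) ≤ N := by exact_mod_cast (Finset.mem_range.1 hk).le
      have : k * ((b - a) / N) ≤ N * ((b - a) / N) := by gcongr
      have e : (N : ℝ) * ((b - a) / N) = b - a := by field_simp
      linarith
  · rw [Finset.sum_const, Finset.card_range, nsmul_eq_mul, ← mul_assoc]
    refine mul_le_mul_left (le_of_eq ?_) _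
    rw [← ENNReal.ofReal_natCast, ← ENNReal.ofReal_mul hN'.le]
    congr 1
    field_simp

/-! ## Nets dominated in `L^p` -/

/-- Property `B` of nets is stable under the operations needed for linear estimates. -/
structure NetModule (B : (Eps → ℝ≥0∞) → Prop) : Prop extends NetClosed B where
  smul : ∀ r s, ModerateNet r → B s → B (r * s)

theorem netModule_moderate : NetModule ModerateNet :=
  { moderateNet_closed with smul := fun _ _ => ModerateNet.mul }

theorem netModule_negligible : NetModule NegligibleNet :=
  { negligibleNet_closed with smul := fun _ _ => ModerateNet.mul_negligible }

/-- Nets of random variables whose net of `L^p` norms has property `B`. -/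
def NetLp (B : (Eps → ℝ≥0∞) → Prop) (P : Measure Ω) (p : ℝ≥0∞) (m : Eps → Ω → ℝ) : Prop :=
  (∀ ε, AEStronglyMeasurable (m ε) P) ∧ B fun ε => eLpNorm (m ε) p P

variable {B : (Eps → ℝ≥0∞) → Prop}

theorem NetLp.zero (hB : NetModule B) : NetLp B P p 0 :=
  ⟨fun _ => aestronglyMeasurable_const, by
    have : (fun ε : Eps => eLpNorm ((0 : Eps → Ω → ℝ) ε) p P) = 0 := by
      funext ε; exact eLpNorm_zero
    rw [this]; exact hB.zero⟩

theorem NetLp.add (hB : NetModule B) {m m' : Eps → Ω → ℝ} (h : NetLp B P p m)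
    (h' : NetLp B P p m') : NetLp B P p (m + m') := by
  refine ⟨fun ε => (h.1 ε).add (h'.1 ε), ?_⟩
  refine hB.mono (ENNReal.LpAddConst p).toNNReal _ _ (fun ε => ?_) (hB.add _ _ h.2 h'.2)
  rw [ENNReal.coe_toNNReal (ENNReal.LpAddConst_lt_top p).ne]
  exact eLpNorm_add_le' (h.1 ε) (h'.1 ε) p

theorem NetLp.sum (hB : NetModule B) {κ : Type*} (s : Finset κ) {m : κ → Eps → Ω → ℝ}
    (h : ∀ k, NetLp B P p (m k)) : NetLp B P p (∑ k ∈ s, m k) := by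
  classical
  induction s using Finset.induction_on with
  | empty => simpa using NetLp.zero hB
  | insert k s hk ih => rw [Finset.sum_insert hk]; exact (h k).add hB ih

theorem NetLp.smul (hB : NetModule B) {C : Eps → ℝ} (hC : ModerateNet fun ε => ‖C ε‖ₑ)
    {m : Eps → Ω → ℝ} (h : NetLp B P p m) : NetLp B P p fun ε ω => C ε * m ε ω := by
  refine ⟨fun ε => (h.1 ε).const_mul _, ?_⟩
  have : (fun ε => eLpNorm (fun ω => C ε * m ε ω) p P) =
      (fun ε => ‖C ε‖ₑ) * fun ε => eLpNorm (m ε) p P := by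
    funext ε
    exact eLpNorm_const_smul (C ε) (m ε) p P
  rw [this]
  exact hB.smul _ _ hC h.2

theorem NetLp.abs {m : Eps → Ω → ℝ} (h : NetLp B P p m) : NetLp B P p fun ε ω => |m ε ω| := by
  refine ⟨fun ε => (h.1 ε).norm, ?_⟩
  have : (fun ε => eLpNorm (fun ω => |m ε ω|) p P) = fun ε => eLpNorm (m ε) p P := by
    funext ε; exact eLpNorm_norm (m ε)
  rw [this]; exact h.2

/-- A net of essentially bounded random variables is dominated by its net of norms. -/
theorem NetLp.exists_const {m : Eps → Ω → ℝ} (h : NetLp B P ⊤ m)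
    (hfin : ∀ r, B r → ∀ ε, r ε < ⊤) :
    ∃ C : Eps → ℝ, (∀ ε, 0 ≤ C ε) ∧ (B fun ε => ‖C ε‖ₑ) ∧ ∀ ε, ∀ᵐ ω ∂P, |m ε ω| ≤ C ε := by
  have hf := hfin _ h.2
  refine ⟨fun ε => (eLpNorm (m ε) ⊤ P).toReal, fun ε => ENNReal.toReal_nonneg, ?_, fun ε => ?_⟩
  · have : (fun ε => ‖(eLpNorm (m ε) ⊤ P).toReal‖ₑ) = fun ε => eLpNorm (m ε) ⊤ P := by
      funext ε
      rw [Real.enorm_of_nonneg ENNReal.toReal_nonneg, ENNReal.ofReal_toReal (hf ε).ne]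
    rw [this]; exact h.2
  · have h1 := ae_le_eLpNormEssSup (f := m ε) (μ := P)
    rw [← eLpNorm_exponent_top] at h1
    filter_upwards [h1] with ω hω
    have := ENNReal.toReal_mono (hf ε).ne hω
    simpa using this

end Probability

end ColombeauRF

namespace ColombeauRF

open Set Filter Topology Function

/-! ## Slices of functions on the plane -/

section Slices

variable {φ : (Fin 2 → ℝ) → ℝ}

theorem contDiff_vec : ContDiff ℝ ((⊤ : ℕ∞) : WithTop ℕ∞) fun z : ℝ × ℝ => ![z.1, z.2] := by
  rw [contDiff_pi]
  intro i
  fin_cases i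
  · exact contDiff_fst
  · exact contDiff_snd

theorem contDiff_uncurry_vec (hφ : ContDiff ℝ ((⊤ : ℕ∞) : WithTop ℕ∞) φ) :
    ContDiff ℝ ((⊤ : ℕ∞) : WithTop ℕ∞) (uncurry fun x t => φ ![x, t]) :=
  hφ.comp contDiff_vec

theorem hasDerivAt_vec_fst (x t : ℝ) :
    HasDerivAt (fun y => ![y, t]) (Pi.single 0 1 : Fin 2 → ℝ) x := by
  rw [hasDerivAt_pi]
  intro i
  fin_cases i
  · simpa using hasDerivAt_id' x
  · simpa using hasDerivAt_const x t

theorem hasDerivAt_vec_snd (x t : ℝ) :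
    HasDerivAt (fun s => ![x, s]) (Pi.single 1 1 : Fin 2 → ℝ) t := by
  rw [hasDerivAt_pi]
  intro i
  fin_cases i
  · simpa using hasDerivAt_const t x
  · simpa using hasDerivAt_id' t

theorem hasDerivAt_slice_fst (hφ : ContDiff ℝ ((⊤ : ℕ∞) : WithTop ℕ∞) φ) (x t : ℝ) :
    HasDerivAt (fun y => φ ![y, t]) (partialD 0 φ ![x, t]) x :=
  (hφ.differentiable (by simp) ![x, t]).hasFDerivAt.comp_hasDerivAt x (hasDerivAt_vec_fst x t)

theorem hasDerivAt_slice_snd (hφ : ContDiff ℝ ((⊤ : ℕ∞) : WithTop ℕ∞) φ) (x t : ℝ) :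
    HasDerivAt (fun s => φ ![x, s]) (partialD 1 φ ![x, t]) t :=
  (hφ.differentiable (by simp) ![x, t]).hasFDerivAt.comp_hasDerivAt t (hasDerivAt_vec_snd x t)

theorem vec_eta (z : Fin 2 → ℝ) : ![z 0, z 1] = z := by
  ext i; fin_cases i <;> rfl

theorem norm_vec_le_iff {x t R : ℝ} (hR : 0 ≤ R) : ‖![x, t]‖ ≤ R ↔ |x| ≤ R ∧ |t| ≤ R := by
  rw [pi_norm_le_iff_of_nonneg hR, Fin.forall_fin_two]
  simp [Real.norm_eq_abs]

theorem continuous_slice_fst (hφ : Continuous φ) (t : ℝ) : Continuous fun x => φ ![x, t] :=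
  hφ.comp (continuous_pi fun i => by fin_cases i <;> simp <;> fun_prop)

theorem continuous_slice_snd (hφ : Continuous φ) (x : ℝ) : Continuous fun t => φ ![x, t] :=
  hφ.comp (continuous_pi fun i => by fin_cases i <;> simp <;> fun_prop)

end Slices

/-- One-dimensional Sobolev embedding. The right-hand side no longer depends on x and serves as a
dominating random variable along a path. -/
theorem abs_le_abs_add_integral {f f' : ℝ → ℝ} (hf : ∀ x, HasDerivAt f (f' x) x)
    (hf' : Continuous f') {a b x : ℝ} (hx : x ∈ Icc a b) :
    |f x| ≤ |f a| + ∫ y in a..b, |f' y| := by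
  have h1 : f x = f a + ∫ y in a..x, f' y := by
    rw [intervalIntegral.integral_eq_sub_of_hasDerivAt (fun y _ => hf y)
      (hf'.intervalIntegrable _ _)]
    ring
  rw [h1]
  refine (abs_add_le _ _).trans (add_le_add_right ?_ _)
  refine (intervalIntegral.abs_integral_le_integral_abs hx.1).trans ?_
  refine intervalIntegral.integral_mono_interval le_rfl hx.1 hx.2
    (Eventually.of_forall fun _ => abs_nonneg _) (hf'.abs.intervalIntegrable _ _)

section Probability

variable {Ω : Type*} [MeasurableSpace Ω] {P : Measure Ω} {p : ℝ≥0∞} {d : ℕ}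
  {B : (Eps → ℝ≥0∞) → Prop}

/-! ## Measurability of derivatives -/

/-- A partial derivative is the almost sure limit of difference quotients with increments 1/(N + 1);
induction on the word does the rest. -/
theorem aestronglyMeasurable_famD {u : Family Ω d} (hu : SmoothPaths P u)
    (hm : ∀ ε x, AEStronglyMeasurable (u ε x) P) (w : List (Fin d)) (ε : Eps) (x : Fin d → ℝ) :
    AEStronglyMeasurable (famD w u ε x) P := by
  induction w generalizing u x with
  | nil => exact hm ε x
  | cons i w ih =>
    refine ih (u := famD [i] u) ?_ (fun ε x => ?_) x
    · filter_upwards [hu] with ω h ε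
      exact contDiff_partialD (h ε) i
    · refine aestronglyMeasurable_of_tendsto_ae atTop
        (f := fun (N : ℕ) ω => ((N : ℝ) + 1) * (u ε (x + ((N : ℝ) + 1)⁻¹ • Pi.single i 1) ω - u ε x ω))
        (fun N => ((hm ε _).sub (hm ε x)).const_mul _) ?_
      filter_upwards [hu] with ω h
      have hd := ((h ε).differentiable (by simp) x).hasFDerivAt
      have hl : HasDerivAt (fun s : ℝ => x + s • (Pi.single i 1 : Fin d → ℝ)) (Pi.single i 1) 0 := by
        have := ((hasDerivAt_id (0 : ℝ)).smul_const (Pi.single i 1 : Fin d → ℝ)).const_add x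
        simpa using this
      have hc : HasDerivAt (fun s : ℝ => u ε (x + s • (Pi.single i 1 : Fin d → ℝ)) ω)
          (fderiv ℝ (fun y => u ε y ω) x (Pi.single i 1)) 0 := by
        refine HasFDerivAt.comp_hasDerivAt (l := fun y => u ε y ω) 0 ?_ hl
        rwa [zero_smul, add_zero]
      have hs := hc.tendsto_slope_zero_right
      have ht : Tendsto (fun N : ℕ => ((N : ℝ) + 1)⁻¹) atTop (𝓝[>] 0) := by
        refine tendsto_nhdsWithin_iff.2 ⟨?_, Eventually.of_forall fun N => ?_⟩
        · simpa using tendsto_one_div_add_atTop_nhds_zero_nat (𝕜 := ℝ)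
        · exact inv_pos.2 (by positivity : (0 : ℝ) < (N : ℝ) + 1)
      have e : famD [i] u ε x ω = fderiv ℝ (fun y => u ε y ω) x (Pi.single i 1) := rfl
      have := hs.comp ht
      rw [e]
      simpa [Function.comp_def] using this

/-! ## Pathwise domination -/

/-- On every compact set, the family is dominated by a net of random variables whose net of `L^p`
norms has property `B`. -/
def LocDom (B : (Eps → ℝ≥0∞) → Prop) (P : Measure Ω) (p : ℝ≥0∞) (u : Family Ω d) : Prop :=
  ∀ K : Set (Fin d → ℝ), IsCompact K → ∃ m : Eps → Ω → ℝ, NetLp B P p m ∧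
    ∀ ε, ∀ᵐ ω ∂P, ∀ x ∈ K, |u ε x ω| ≤ m ε ω

/-- All derivatives of order at most `k` are locally dominated. -/
def PathBound (B : (Eps → ℝ≥0∞) → Prop) (P : Measure Ω) (p : ℝ≥0∞) :
    ℕ → Family Ω d → Prop
  | 0, u => LocDom B P p u
  | k + 1, u => LocDom B P p u ∧ ∀ i, PathBound B P p k (famD [i] u)

theorem PathBound.locDom {k : ℕ} {u : Family Ω d} (h : PathBound B P p k u) : LocDom B P p u := by
  cases k with
  | zero => exact h
  | succ k => exact h.1

theorem PathBound.of_succ {k : ℕ} {u : Family Ω d} (h : PathBound B P p (k + 1) u) :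
    PathBound B P p k u := by
  induction k generalizing u with
  | zero => exact h.1
  | succ k ih => exact ⟨h.1, fun i => ih (h.2 i)⟩

theorem PathBound.congr {k : ℕ} {u v : Family Ω d} (hu : PathBound B P p k u)
    (h : ∀ ε, ∀ᵐ ω ∂P, ∀ x, u ε x ω = v ε x ω) : PathBound B P p k v := by
  have hL : ∀ {u v : Family Ω d}, LocDom B P p u → (∀ ε, ∀ᵐ ω ∂P, ∀ x, u ε x ω = v ε x ω) →
      LocDom B P p v := by
    intro u v hu h K hK
    obtain ⟨m, hm, H⟩ := hu K hK
    refine ⟨m, hm, fun ε => ?_⟩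
    filter_upwards [H ε, h ε] with ω h1 h2 x hx
    rw [← h2]; exact h1 x hx
  induction k generalizing u v with
  | zero => exact hL hu h
  | succ k ih =>
    refine ⟨hL hu.1 h, fun i => ih (hu.2 i) fun ε => ?_⟩
    filter_upwards [h ε] with ω hω x
    have : (fun y => u ε y ω) = fun y => v ε y ω := funext hω
    simp only [famD, this]

theorem LocDom.add (hB : NetModule B) {u v : Family Ω d} (hu : LocDom B P p u)
    (hv : LocDom B P p v) : LocDom B P p (u + v) := by
  intro K hK
  obtain ⟨m, hm, H⟩ := hu K hK
  obtain ⟨m', hm', H'⟩ := hv K hK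
  refine ⟨m + m', hm.add hB hm', fun ε => ?_⟩
  filter_upwards [H ε, H' ε] with ω h1 h2 x hx
  exact (abs_add_le _ _).trans (add_le_add (h1 x hx) (h2 x hx))

theorem SmoothPaths.famD_add {u v : Family Ω d} (hu : SmoothPaths P u) (hv : SmoothPaths P v)
    (i : Fin d) (ε : Eps) :
    ∀ᵐ ω ∂P, ∀ x, (famD [i] u + famD [i] v) ε x ω = famD [i] (u + v) ε x ω := by
  filter_upwards [hu, hv] with ω h1 h2 x
  exact (congrFun (iterPartial_add [i] (h1 ε) (h2 ε)) x).symm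

theorem SmoothPaths.famD_mul {u v : Family Ω d} (hu : SmoothPaths P u) (hv : SmoothPaths P v)
    (i : Fin d) (ε : Eps) :
    ∀ᵐ ω ∂P, ∀ x, (famD [i] u * v + u * famD [i] v) ε x ω = famD [i] (u * v) ε x ω := by
  filter_upwards [hu, hv] with ω h1 h2 x
  exact (congrFun (partialD_mul (h1 ε) (h2 ε) i) x).symm

theorem SmoothPaths.famD {u : Family Ω d} (hu : SmoothPaths P u) (i : Fin d) :
    SmoothPaths P (famD [i] u) := by
  filter_upwards [hu] with ω h ε
  exact contDiff_partialD (h ε) i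

theorem SmoothPaths.add {u v : Family Ω d} (hu : SmoothPaths P u) (hv : SmoothPaths P v) :
    SmoothPaths P (u + v) := by
  filter_upwards [hu, hv] with ω h1 h2 ε
  exact (h1 ε).add (h2 ε)

theorem SmoothPaths.mul {u v : Family Ω d} (hu : SmoothPaths P u) (hv : SmoothPaths P v) :
    SmoothPaths P (u * v) := by
  filter_upwards [hu, hv] with ω h1 h2 ε
  exact (h1 ε).mul (h2 ε)

theorem SmoothPaths.zero : SmoothPaths P (0 : Family Ω d) :=
  Eventually.of_forall fun _ _ => contDiff_const

theorem SmoothPaths.sum {κ : Type*} (s : Finset κ) {u : κ → Family Ω d}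
    (h : ∀ k, SmoothPaths P (u k)) : SmoothPaths P (∑ k ∈ s, u k) := by
  classical
  induction s using Finset.induction_on with
  | empty => simpa using SmoothPaths.zero
  | insert k s hk ih => rw [Finset.sum_insert hk]; exact (h k).add ih

theorem PathBound.add (hB : NetModule B) {k : ℕ} {u v : Family Ω d} (su : SmoothPaths P u)
    (sv : SmoothPaths P v) (hu : PathBound B P p k u) (hv : PathBound B P p k v) :
    PathBound B P p k (u + v) := by
  induction k generalizing u v with
  | zero => exact LocDom.add hB hu hv
  | succ k ih =>
    exact ⟨hu.1.add hB hv.1, fun i =>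
      (ih (su.famD i) (sv.famD i) (hu.2 i) (hv.2 i)).congr (su.famD_add sv i)⟩

theorem PathBound.zero (hB : NetModule B) (k : ℕ) : PathBound B P p k (0 : Family Ω d) := by
  have h0 : LocDom B P p (0 : Family Ω d) := fun K _ =>
    ⟨0, NetLp.zero hB, fun ε => Eventually.of_forall fun ω x _ => by simp⟩
  induction k with
  | zero => exact h0
  | succ k ih =>
    refine ⟨h0, fun i => ih.congr fun ε => Eventually.of_forall fun ω x => ?_⟩
    exact (congrFun (iterPartial_zero [i]) x).symm

theorem PathBound.sum (hB : NetModule B) {k : ℕ} {κ : Type*} (s : Finset κ) {u : κ → Family Ω d}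
    (su : ∀ j, SmoothPaths P (u j)) (h : ∀ j, PathBound B P p k (u j)) :
    PathBound B P p k (∑ j ∈ s, u j) := by
  classical
  induction s using Finset.induction_on with
  | empty => simpa using PathBound.zero hB k
  | insert j s hj ih =>
    rw [Finset.sum_insert hj]
    exact (h j).add hB (su j) (SmoothPaths.sum s su) ih

/-- A dominated family with values in `L^∞` is dominated by a deterministic net. -/
theorem LocDom.exists_const {a : Family Ω d} (ha : LocDom B P ⊤ a)
    (hfin : ∀ r, B r → ∀ ε, r ε < ⊤) {K : Set (Fin d → ℝ)} (hK : IsCompact K) :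
    ∃ C : Eps → ℝ, (∀ ε, 0 ≤ C ε) ∧ (B fun ε => ‖C ε‖ₑ) ∧
      ∀ ε, ∀ᵐ ω ∂P, ∀ x ∈ K, |a ε x ω| ≤ C ε := by
  obtain ⟨m, hm, H⟩ := ha K hK
  obtain ⟨C, hC0, hC, HC⟩ := hm.exists_const hfin
  refine ⟨C, hC0, hC, fun ε => ?_⟩
  filter_upwards [H ε, HC ε] with ω h1 h2 x hx
  exact (h1 x hx).trans ((le_abs_self _).trans h2)

/-- The L^∞ factor is replaced by a deterministic moderate net, so the product is dominated by a
scalar multiple of the dominating variable of `u`. -/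
theorem LocDom.mul (hB : NetModule B) {a u : Family Ω d} (ha : LocDom ModerateNet P ⊤ a)
    (hu : LocDom B P p u) : LocDom B P p (a * u) := by
  intro K hK
  obtain ⟨C, hC0, hC, HC⟩ := ha.exists_const (fun _ h => h.1) hK
  obtain ⟨m, hm, H⟩ := hu K hK
  refine ⟨_, hm.smul hB hC, fun ε => ?_⟩
  filter_upwards [HC ε, H ε] with ω h1 h2 x hx
  change |a ε x ω * u ε x ω| ≤ _
  rw [abs_mul]
  exact mul_le_mul (h1 x hx) (h2 x hx) (abs_nonneg _) (hC0 ε)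

theorem PathBound.mul (hB : NetModule B) {k : ℕ} {a u : Family Ω d} (sa : SmoothPaths P a)
    (su : SmoothPaths P u) (ha : PathBound ModerateNet P ⊤ k a) (hu : PathBound B P p k u) :
    PathBound B P p k (a * u) := by
  induction k generalizing a u with
  | zero => exact LocDom.mul hB ha hu
  | succ k ih =>
    exact ⟨ha.1.mul hB hu.1, fun i => ((ih (sa.famD i) su (ha.2 i) hu.of_succ).add hB
      ((sa.famD i).mul su) (sa.mul (su.famD i)) (ih sa (su.famD i) ha.of_succ (hu.2 i))).congr
      (sa.famD_mul su i)⟩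

/-! ## Moderate and negligible families in terms of pathwise domination -/

/-- The easy direction: a random variable dominating the path on K dominates its value at each point
of K, and monotonicity of the norm applies. -/
theorem HasBounds.of_pathBound (hB : NetClosed B) {u : Family Ω d} (su : SmoothPaths P u)
    (hm : ∀ ε x, AEStronglyMeasurable (u ε x) P) (hfin : ∀ r, B r → ∀ ε, r ε < ⊤)
    (h : ∀ k, PathBound B P p k u) : HasBounds B P p u := by
  have key : ∀ (w : List (Fin d)) (u : Family Ω d), (∀ k, PathBound B P p k u) →
      LocDom B P p (famD w u) := by
    intro w
    induction w with
    | nil => exact fun u h => h 0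
    | cons i w ih => exact fun u h => ih (famD [i] u) fun k => (h (k + 1)).2 i
  refine ⟨su, fun w ε x => ⟨aestronglyMeasurable_famD su hm w ε x, ?_⟩, fun K hK w => ?_⟩
  · obtain ⟨m, hm, H⟩ := key w u h {x} isCompact_singleton
    refine lt_of_le_of_lt (eLpNorm_mono_ae_real ?_) (hfin _ hm.2 ε)
    filter_upwards [H ε] with ω hω using hω x rfl
  · obtain ⟨m, hm, H⟩ := key w u h K hK
    refine hB.mono 1 _ _ (fun ε => ?_) hm.2
    rw [ENNReal.coe_one, one_mul]
    refine iSup₂_le fun x hx => eLpNorm_mono_ae_real ?_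
    filter_upwards [H ε] with ω hω using hω x hx

theorem le_supLp {K : Set (Fin d → ℝ)} {u : Family Ω d} {ε : Eps} {x : Fin d → ℝ} (hx : x ∈ K) :
    eLpNorm (u ε x) p P ≤ supLp P p K u ε :=
  le_iSup₂ (f := fun x (_ : x ∈ K) => eLpNorm (u ε x) p P) x hx

/-- The supremum over x is moved inside the L^p norm. Along a path |u| is at most its value at -R
plus the integral of |u'|, and Minkowski's inequality, which needs p ≥ 1, bounds the norm of that
integral. -/
theorem HasBounds.locDom_line (hB : NetClosed B) (hp : 1 ≤ p) {u : Family Ω 1}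
    (hu : HasBounds B P p u) : LocDom B P p u := by
  intro K hK
  obtain ⟨R, hR0, hKR⟩ := hK.isBounded.subset_closedBall_lt 0 0
  set Q := Metric.closedBall (0 : Fin 1 → ℝ) R with hQ
  have hQc : IsCompact Q := isCompact_closedBall _ _
  have hmem : ∀ y ∈ Icc (-R) R, ![y] ∈ Q := fun y hy => by
    rw [hQ, mem_closedBall_zero_iff, pi_norm_le_iff_of_nonneg hR0.le]
    intro i; simpa using abs_le.2 hy
  have hRR : -R ≤ R := by linarith
  have hI := fun ε => eLpNorm_integral_abs_le hp (H := fun y => famD [0] u ε ![y]) hRR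
    (fun y => (hu.memLp [0] ε ![y]).1) (by
      filter_upwards [hu.smooth] with ω h
      exact (contDiff_partialD (h ε) 0).continuous.comp
        (continuous_pi fun i => by simpa using continuous_id'))
    (fun y hy => le_supLp (hmem y hy))
  refine ⟨fun ε ω => |u ε ![-R] ω| + ∫ y in (-R)..R, |famD [0] u ε ![y] ω|, ⟨fun ε => ?_, ?_⟩,
    fun ε => ?_⟩
  · exact (hu.memLp [] ε ![-R]).1.norm.add (hI ε).1
  · refine hB.mono (1 + (R - -R).toNNReal) _ _ (fun ε => ?_)
      (hB.add _ _ (hu.bound Q hQc []) (hu.bound Q hQc [0]))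
    refine (eLpNorm_add_le (hu.memLp [] ε ![-R]).1.norm (hI ε).1 hp).trans ?_
    rw [eLpNorm_norm, ENNReal.coe_add, ENNReal.coe_one, Pi.add_apply]
    have h1 : eLpNorm (u ε ![-R]) p P ≤ supLp P p Q (famD [] u) ε :=
      le_supLp (u := famD [] u) (hmem _ ⟨le_rfl, hRR⟩)
    calc _ ≤ supLp P p Q (famD [] u) ε + ((R - -R).toNNReal : ℝ≥0∞) *
          supLp P p Q (famD [0] u) ε := add_le_add h1 (hI ε).2
      _ ≤ (1 + ((R - -R).toNNReal : ℝ≥0∞)) * supLp P p Q (famD [] u) ε +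
          (1 + ((R - -R).toNNReal : ℝ≥0∞)) * supLp P p Q (famD [0] u) ε := by
        gcongr
        · exact le_mul_of_one_le_left' le_self_add
        · exact le_add_self
      _ = _ := by rw [mul_add]
  · filter_upwards [hu.smooth] with ω h x hx
    have hx' : |x 0| ≤ R := by
      have := hKR hx
      rw [mem_closedBall_zero_iff] at this
      exact (norm_le_pi_norm x 0).trans this
    have e : x = ![x 0] := by ext i; fin_cases i; rfl
    rw [e]
    refine abs_le_abs_add_integral (f := fun y => u ε ![y] ω) (fun y => ?_) ?_ (abs_le.1 hx')
    · have hl : HasDerivAt (fun y : ℝ => ![y]) (Pi.single 0 1 : Fin 1 → ℝ) y := by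
        rw [hasDerivAt_pi]
        intro i; fin_cases i; simpa using hasDerivAt_id' y
      exact ((h ε).differentiable (by simp) ![y]).hasFDerivAt.comp_hasDerivAt y hl
    · exact (contDiff_partialD (h ε) 0).continuous.comp
        (continuous_pi fun i => by simpa using continuous_id')

end Probability

end ColombeauRF

/-! ### From L^p bounds to pathwise domination in the plane -/

namespace ColombeauRF

open Set Filter Topology Function

section Probability

variable {Ω : Type*} [MeasurableSpace Ω] {P : Measure Ω} {p : ℝ≥0∞}
  {B : (Eps → ℝ≥0∞) → Prop}

/-- The one-dimensional embedding is applied in t, and then in x both to u on the lower edge and to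
∂_t u. Hence u, ∂_x u, ∂_t u and ∂_x∂_t u enter; `W` is the resulting majorant of |∂_t u(x, s)| for
all x. -/
theorem HasBounds.locDom_plane (hB : NetClosed B) (hp : 1 ≤ p) {u : Family Ω 2}
    (hu : HasBounds B P p u) : LocDom B P p u := by
  intro K hK
  obtain ⟨R, hR0, hKR⟩ := hK.isBounded.subset_closedBall_lt 0 0
  set Q := Metric.closedBall (0 : Fin 2 → ℝ) R with hQ
  have hQc : IsCompact Q := isCompact_closedBall _ _
  have hmem : ∀ x ∈ Icc (-R) R, ∀ t ∈ Icc (-R) R, ![x, t] ∈ Q := fun x hx t ht => by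
    rw [hQ, mem_closedBall_zero_iff, norm_vec_le_iff hR0.le]
    exact ⟨abs_le.2 hx, abs_le.2 ht⟩
  have hRR : -R ≤ R := by linarith
  have hl : -R ∈ Icc (-R) R := ⟨le_rfl, hRR⟩
  have hux := (hu.partialD 0).smooth
  have hut := (hu.partialD 1).smooth
  have hutx := ((hu.partialD 1).partialD 0).smooth
  set W : Eps → ℝ → Ω → ℝ := fun ε s ω => |famD [1] u ε ![-R, s] ω| +
    ∫ y in (-R)..R, |famD [1, 0] u ε ![y, s] ω| with hW
  have hI1 := fun ε => eLpNorm_integral_abs_le hp (H := fun y => famD [0] u ε ![y, -R]) hRR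
    (fun y => (hu.memLp [0] ε _).1) (by
      filter_upwards [hux] with ω h
      exact continuous_slice_fst (h ε).continuous _)
    (fun y hy => le_supLp (hmem y hy _ hl))
  have hI2 := fun ε s (hs : s ∈ Icc (-R) R) =>
    eLpNorm_integral_abs_le hp (H := fun y => famD [1, 0] u ε ![y, s]) hRR
    (fun y => (hu.memLp [1, 0] ε _).1) (by
      filter_upwards [hutx] with ω h
      exact continuous_slice_fst (h ε).continuous _)
    (fun y hy => le_supLp (hmem y hy s hs))
  -- The trivial bound ∞ gives measurability for every s, also outside [-R, R]; applying Minkowski's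
  -- inequality to `W` requires it at all s.
  have hI2m := fun ε s => (eLpNorm_integral_abs_le hp (C := ⊤)
    (H := fun y => famD [1, 0] u ε ![y, s]) hRR (fun y => (hu.memLp [1, 0] ε _).1) (by
      filter_upwards [hutx] with ω h
      exact continuous_slice_fst (h ε).continuous _) (fun y hy => le_top)).1
  have hWm : ∀ ε s, AEStronglyMeasurable (W ε s) P := fun ε s =>
    (hu.memLp [1] ε _).1.norm.add (hI2m ε s)
  have hWc : ∀ᵐ ω ∂P, ∀ ε, Continuous fun s => W ε s ω := by
    filter_upwards [hut, hutx] with ω h1 h2 ε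
    refine (continuous_slice_snd (h1 ε).continuous _).abs.add ?_
    refine intervalIntegral.continuous_parametric_intervalIntegral_of_continuous' ?_ _ _
    have h3 : Continuous (fun z : ℝ × ℝ => famD [1, 0] u ε ![z.2, z.1] ω) :=
      (h2 ε).continuous.comp (contDiff_vec.continuous.comp continuous_swap)
    exact h3.abs
  set ρ : ℝ≥0 := (R - -R).toNNReal with hρ
  have hW0 := fun ε => eLpNorm_integral_abs_le hp (H := W ε) hRR (hWm ε)
    (hWc.mono fun ω h => h ε)
    (C := supLp P p Q (famD [1] u) ε + ρ * supLp P p Q (famD [1, 0] u) ε) (fun s hs => by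
      refine (eLpNorm_add_le (hu.memLp [1] ε _).1.norm (hI2m ε s) hp).trans ?_
      refine add_le_add ?_ (hI2 ε s hs).2
      rw [eLpNorm_norm]
      exact le_supLp (hmem _ hl s hs))
  refine ⟨fun ε ω => (|u ε ![-R, -R] ω| + ∫ y in (-R)..R, |famD [0] u ε ![y, -R] ω|) +
    ∫ s in (-R)..R, |W ε s ω|, ⟨fun ε => ?_, ?_⟩, fun ε => ?_⟩
  · exact ((hu.memLp [] ε _).1.norm.add (hI1 ε).1).add (hW0 ε).1
  · refine hB.mono ((1 + ρ) * (1 + ρ)) _ _ (fun ε => ?_)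
      (hB.add _ _ (hB.add _ _ (hu.bound Q hQc []) (hu.bound Q hQc [0]))
        (hB.add _ _ (hu.bound Q hQc [1]) (hu.bound Q hQc [1, 0])))
    refine (eLpNorm_add_le ((hu.memLp [] ε _).1.norm.add (hI1 ε).1) (hW0 ε).1 hp).trans ?_
    have h1 : eLpNorm (u ε ![-R, -R]) p P ≤ supLp P p Q (famD [] u) ε :=
      le_supLp (u := famD [] u) (hmem _ hl _ hl)
    have h2 := eLpNorm_add_le (hu.memLp [] ε ![-R, -R]).1.norm (hI1 ε).1 hp
    rw [eLpNorm_norm] at h2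
    refine (add_le_add (h2.trans (add_le_add h1 (hI1 ε).2)) (hW0 ε).2).trans ?_
    simp only [Pi.add_apply, ENNReal.coe_mul, ENNReal.coe_add, ENNReal.coe_one]
    change _ + (ρ : ℝ≥0∞) * _ + (ρ : ℝ≥0∞) * _ ≤ _
    set a := supLp P p Q (famD [] u) ε
    set b := supLp P p Q (famD [0] u) ε
    set e := supLp P p Q (famD [1] u) ε
    set f := supLp P p Q (famD [1, 0] u) ε
    -- The weights 1, ρ and ρ² of the four norms are all at most (1 + ρ)², which serves as a common
    -- constant.
    have r1 : (1 : ℝ≥0∞) ≤ (1 + ρ) * (1 + ρ) :=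
      one_le_mul le_self_add le_self_add
    have r2 : (ρ : ℝ≥0∞) ≤ (1 + ρ) * (1 + ρ) :=
      le_add_self.trans (le_mul_of_one_le_right' le_self_add)
    have r3 : (ρ : ℝ≥0∞) * ρ ≤ (1 + ρ) * (1 + ρ) := mul_le_mul' le_add_self le_add_self
    calc a + ρ * b + ρ * (e + ρ * f) = 1 * a + ρ * b + (ρ * e + ρ * ρ * f) := by ring
      _ ≤ ((1 + ρ) * (1 + ρ)) * a + ((1 + ρ) * (1 + ρ)) * b +
          (((1 + ρ) * (1 + ρ)) * e + ((1 + ρ) * (1 + ρ)) * f) := by gcongr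
      _ = _ := by ring
  · filter_upwards [hu.smooth, hut, hutx, hux, hWc] with ω h h1 h2 h3 h4 z hz
    have hz' := hKR hz
    rw [mem_closedBall_zero_iff, ← vec_eta z, norm_vec_le_iff hR0.le] at hz'
    rw [← vec_eta z]
    set x := z 0
    set t := z 1
    have hx := abs_le.1 hz'.1
    have ht := abs_le.1 hz'.2
    have a1 : |u ε ![x, t] ω| ≤ |u ε ![x, -R] ω| + ∫ s in (-R)..R, |famD [1] u ε ![x, s] ω| :=
      abs_le_abs_add_integral (f := fun s => u ε ![x, s] ω) (hasDerivAt_slice_snd (h ε) x)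
        (continuous_slice_snd (h1 ε).continuous x) ht
    have a2 : |u ε ![x, -R] ω| ≤ |u ε ![-R, -R] ω| +
        ∫ y in (-R)..R, |famD [0] u ε ![y, -R] ω| :=
      abs_le_abs_add_integral (f := fun y => u ε ![y, -R] ω)
        (fun y => hasDerivAt_slice_fst (h ε) y (-R))
        (continuous_slice_fst (h3 ε).continuous (-R)) hx
    have a3 : ∀ s, |famD [1] u ε ![x, s] ω| ≤ W ε s ω := fun s =>
      abs_le_abs_add_integral (f := fun y => famD [1] u ε ![y, s] ω)
        (fun y => hasDerivAt_slice_fst (h1 ε) y s)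
        (continuous_slice_fst (h2 ε).continuous s) hx
    have a4 : ∫ s in (-R)..R, |famD [1] u ε ![x, s] ω| ≤ ∫ s in (-R)..R, |W ε s ω| :=
      intervalIntegral.integral_mono_on hRR
        ((continuous_slice_snd (h1 ε).continuous x).abs.intervalIntegrable _ _)
        ((h4 ε).abs.intervalIntegrable _ _) fun s _ => (a3 s).trans (le_abs_self _)
    linarith

theorem HasBounds.pathBound_plane (hB : NetClosed B) (hp : 1 ≤ p) {u : Family Ω 2}
    (hu : HasBounds B P p u) (k : ℕ) : PathBound B P p k u := by
  induction k generalizing u with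
  | zero => exact hu.locDom_plane hB hp
  | succ k ih => exact ⟨hu.locDom_plane hB hp, fun i => ih (hu.partialD i)⟩

theorem HasBounds.pathBound_line (hB : NetClosed B) (hp : 1 ≤ p) {u : Family Ω 1}
    (hu : HasBounds B P p u) (k : ℕ) : PathBound B P p k u := by
  induction k generalizing u with
  | zero => exact hu.locDom_line hB hp
  | succ k ih => exact ⟨hu.locDom_line hB hp, fun i => ih (hu.partialD i)⟩

end Probability

end ColombeauRF

namespace ColombeauRF

open Set Filter Topology Function

/-! ## A priori estimates along paths -/

theorem partialD_comm {d : ℕ} {φ : (Fin d → ℝ) → ℝ} (hφ : ContDiff ℝ ((⊤ : ℕ∞) : WithTop ℕ∞) φ)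
    (i j : Fin d) : partialD i (partialD j φ) = partialD j (partialD i φ) := by
  funext x
  have h1 : DifferentiableAt ℝ (fderiv ℝ φ) x :=
    (hφ.fderiv_right (m := 1) (by norm_cast)).differentiable (by simp) x
  have h2 : ∀ i j : Fin d, partialD i (partialD j φ) x =
      fderiv ℝ (fderiv ℝ φ) x (Pi.single i 1) (Pi.single j 1) := fun i j => by
    have : HasFDerivAt (partialD j φ) ((ContinuousLinearMap.apply ℝ ℝ (Pi.single j 1)).comp
        (fderiv ℝ (fderiv ℝ φ) x)) x :=
      HasFDerivAt.comp x (g := fun L : (Fin d → ℝ) →L[ℝ] ℝ => L (Pi.single j 1))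
        (ContinuousLinearMap.apply ℝ ℝ (Pi.single j (1 : ℝ) : Fin d → ℝ)).hasFDerivAt
        h1.hasFDerivAt
    rw [partialD, this.fderiv]
    rfl
  rw [h2, h2]
  exact (hφ.contDiffAt.isSymmSndFDerivAt (by simp; norm_cast)) _ _

/-- For smooth solutions the chain rule provides the backward derivative. The bound is exponential
in F only, so a logarithmic F costs a power of ε. -/
theorem abs_le_of_transport {ι : Type*} [Fintype ι] {U lam g : ι → (Fin 2 → ℝ) → ℝ}
    {f : ι → ι → (Fin 2 → ℝ) → ℝ} (hU : ∀ i, ContDiff ℝ ((⊤ : ℕ∞) : WithTop ℕ∞) (U i))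
    {R T C F G E : ℝ} (hC : 0 ≤ C) (hF : 0 ≤ F) (hG : 0 ≤ G)
    (blam : ∀ i x t, |x| ≤ R + C * T → |t| ≤ T → |lam i ![x, t]| ≤ C)
    (bf : ∀ i j x t, |x| ≤ R + C * T → |t| ≤ T → |f i j ![x, t]| ≤ F)
    (bg : ∀ i x t, |x| ≤ R + C * T → |t| ≤ T → |g i ![x, t]| ≤ G)
    (b0 : ∀ i x, |x| ≤ R + C * T → |U i ![x, 0]| ≤ E)
    (heq : ∀ i z, partialD 1 (U i) z + lam i z * partialD 0 (U i) z =
      (∑ j, f i j z * U j z) + g i z) (i : ι) {x t : ℝ} (hx : |x| ≤ R) (ht : |t| ≤ T) :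
    |U i ![x, t]| ≤ Real.exp ((Fintype.card ι * F + 1) * T) * max E G := by
  -- The sign σ selects the direction of time: U(x, σt) is transported with speed σλ and right-hand
  -- side σ(fU + g), with the same bounds.
  have key : ∀ σ : ℝ, |σ| = 1 → ∀ s, 0 ≤ s → s ≤ T →
      |U i ![x, σ * s]| ≤ Real.exp ((Fintype.card ι * F + 1) * T) * max E G := by
    intro σ hσ s hs hsT
    have hσ2 : σ * σ = 1 := by
      rw [← abs_mul_abs_self, hσ, one_mul]
    refine abs_le_of_transport_inequality (R := R) (C := C) (A := Fintype.card ι * F)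
      (w := fun i x t => U i ![x, σ * t]) hC (by positivity) hG (fun i => ?_) (fun i x hx => ?_)
      ?_ i hs hsT ?_
    · exact (hU i).continuous.comp (contDiff_vec.continuous.comp
        (continuous_fst.prodMk (continuous_const.mul continuous_snd)))
    · rw [mul_zero]; exact b0 i x hx
    · intro i x t ht htT hx
      have hx' : |x| ≤ R + C * T := hx.trans (by nlinarith)
      have ht' : |σ * t| ≤ T := by rw [abs_mul, hσ, one_mul, abs_of_pos ht]; exact htT
      refine ⟨σ * lam i ![x, σ * t], σ * ((∑ j, f i j ![x, σ * t] * U j ![x, σ * t])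
        + g i ![x, σ * t]), ?_, ?_, fun M hM => ?_⟩
      · rw [abs_mul, hσ, one_mul]; exact blam i x _ hx' ht'
      · set l := σ * lam i ![x, σ * t] with hl
        have h1 : HasDerivAt (fun s : ℝ => ![x - l * s, σ * (t - s)])
            ((-l) • Pi.single 0 1 + (-σ) • Pi.single 1 1 : Fin 2 → ℝ) 0 := by
          rw [hasDerivAt_pi]
          intro k
          fin_cases k
          · simpa using ((hasDerivAt_id (0 : ℝ)).const_mul l).const_sub x
          · simpa using ((hasDerivAt_id (0 : ℝ)).const_sub t).const_mul σ
        have h2 : HasFDerivAt (U i) (fderiv ℝ (U i) ![x, σ * t]) ![x - l * 0, σ * (t - 0)] := by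
          rw [mul_zero, sub_zero, sub_zero]
          exact ((hU i).differentiable (by simp) _).hasFDerivAt
        have h3 := h2.comp_hasDerivAt (0 : ℝ) h1
        refine (h3.congr_deriv ?_).hasDerivWithinAt
        rw [← heq, map_add, map_smul, map_smul, smul_eq_mul, smul_eq_mul, partialD, partialD, hl]
        ring
      · rw [abs_mul, hσ, one_mul]
        refine (abs_add_le _ _).trans (add_le_add ?_ (bg i x _ hx' ht'))
        refine (Finset.abs_sum_le_sum_abs _ _).trans ?_
        refine (Finset.sum_le_sum (g := fun _ => F * M) fun j _ => ?_).trans (le_of_eq ?_)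
        · rw [abs_mul]
          exact mul_le_mul (bf i j x _ hx' ht') (hM j) (abs_nonneg _) hF
        · rw [Finset.sum_const, nsmul_eq_mul, Finset.card_univ]; ring
    · have : 0 ≤ C * (T - s) := mul_nonneg hC (by linarith)
      linarith
  rcases le_total 0 t with h | h
  · simpa using key 1 (by simp) t h (by rwa [abs_of_nonneg h] at ht)
  · simpa using key (-1) (by simp) (-t) (by linarith) (by rwa [abs_of_nonpos h] at ht)

/-! ### Logarithmic coefficients and a priori estimates in L^p -/

section Probability

variable {Ω : Type*} [MeasurableSpace Ω] {P : Measure Ω} {p : ℝ≥0∞}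
  {B : (Eps → ℝ≥0∞) → Prop}

/-- Nets of nonnegative numbers of logarithmic growth. -/
def LogNet (F : Eps → ℝ) : Prop :=
  (∀ ε, 0 ≤ F ε) ∧ ∃ C η : ℝ, 0 ≤ C ∧ 0 < η ∧ ∀ ε : Eps, (ε : ℝ) ≤ η →
    F ε ≤ C * (1 + |Real.log ε|)

theorem LogNet.add {F G : Eps → ℝ} (hF : LogNet F) (hG : LogNet G) :
    LogNet fun ε => F ε + G ε := by
  obtain ⟨F0, C, η, hC, hη, H⟩ := hF
  obtain ⟨G0, C', η', hC', hη', H'⟩ := hG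
  refine ⟨fun ε => add_nonneg (F0 ε) (G0 ε), C + C', min η η', by positivity, lt_min hη hη',
    fun ε hε => ?_⟩
  have h1 := H ε (hε.trans (min_le_left _ _))
  have h2 := H' ε (hε.trans (min_le_right _ _))
  linarith

theorem LogNet.sum {κ : Type*} (s : Finset κ) {F : κ → Eps → ℝ} (hF : ∀ k, LogNet (F k)) :
    LogNet fun ε => ∑ k ∈ s, F k ε := by
  classical
  induction s using Finset.induction_on with
  | empty => exact ⟨fun _ => by simp, 0, 1, le_rfl, one_pos, fun _ _ => by simp⟩
  | insert k s hk ih =>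
    simp_rw [Finset.sum_insert hk]
    exact (hF k).add ih

/-- For small ε, a F + b is at most aC + b - aC log ε, and the exponential of the last term is
ε^{-aC}. Here logarithmic growth turns into moderateness. -/
theorem LogNet.moderate_exp {F : Eps → ℝ} (hF : LogNet F) {a : ℝ} (ha : 0 ≤ a) (b : ℝ) :
    ModerateNet fun ε => ‖Real.exp (a * F ε + b)‖ₑ := by
  obtain ⟨-, C, η, hC, hη, H⟩ := hF
  refine ⟨fun ε => enorm_lt_top, a * C, by positivity,
    (Real.exp (a * C + b)).toNNReal, η, hη, fun ε hε => ?_⟩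
  change ‖Real.exp (a * F ε + b)‖ₑ ≤
    ENNReal.ofReal (Real.exp (a * C + b)) * ENNReal.ofReal ((ε : ℝ) ^ (-(a * C)))
  rw [Real.enorm_of_nonneg (Real.exp_pos _).le, ← ENNReal.ofReal_mul (Real.exp_pos _).le]
  refine ENNReal.ofReal_le_ofReal ?_
  rw [Real.rpow_def_of_pos ε.2.1, ← Real.exp_add, Real.exp_le_exp]
  have hlog : |Real.log ε| = -Real.log ε :=
    abs_of_nonpos (Real.log_nonpos ε.2.1.le ε.2.2)
  have := mul_le_mul_of_nonneg_left (H ε hε) ha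
  rw [hlog] at this
  linarith

/-- Families bounded on compact sets by deterministic nets of logarithmic growth. -/
def LogBound (P : Measure Ω) (f : Family Ω 2) : Prop :=
  ∀ K : Set (Fin 2 → ℝ), IsCompact K → ∃ F : Eps → ℝ, LogNet F ∧
    ∀ ε, ∀ᵐ ω ∂P, ∀ z ∈ K, |f ε z ω| ≤ F ε

theorem LogBound.add {f g : Family Ω 2} (hf : LogBound P f) (hg : LogBound P g) :
    LogBound P (f + g) := by
  intro K hK
  obtain ⟨F, hF, H⟩ := hf K hK
  obtain ⟨G, hG, H'⟩ := hg K hK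
  refine ⟨_, hF.add hG, fun ε => ?_⟩
  filter_upwards [H ε, H' ε] with ω h1 h2 z hz
  exact (abs_add_le _ _).trans (add_le_add (h1 z hz) (h2 z hz))

theorem LogBound.neg {f : Family Ω 2} (hf : LogBound P f) : LogBound P (-f) := by
  intro K hK
  obtain ⟨F, hF, H⟩ := hf K hK
  refine ⟨F, hF, fun ε => ?_⟩
  filter_upwards [H ε] with ω h1 z hz
  change |-(f ε z ω)| ≤ _
  rw [abs_neg]; exact h1 z hz

/-- The family `u` solves the system `∂_t u + λ ∂_x u = f u + g` along almost all paths. -/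
def SolvesPathwise {ι : Type*} [Fintype ι] (P : Measure Ω) (lam : ι → Family Ω 2)
    (f : ι → ι → Family Ω 2) (g u : ι → Family Ω 2) : Prop :=
  ∀ ε, ∀ᵐ ω ∂P, ∀ i z, famD [1] (u i) ε z ω + lam i ε z ω * famD [0] (u i) ε z ω =
    (∑ j, f i j ε z ω * u j ε z ω) + g i ε z ω

/-- The coefficients `λ` are bounded on strips, uniformly in `ε` and in the path. -/
def StripBound {ι : Type*} (P : Measure Ω) (lam : ι → Family Ω 2) : Prop :=
  ∀ T : ℝ, ∃ c : ℝ, ∀ᵐ ω ∂P, ∀ (ε : Eps) i x t, |t| ≤ T → |lam i ε ![x, t] ω| ≤ c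

variable {ι : Type*} [Fintype ι] {lam : ι → Family Ω 2} {f : ι → ι → Family Ω 2}
  {g u : ι → Family Ω 2}

/-- The maximum principle is applied path by path. The speed bound depends on neither ε nor ω, so
one compact ball of radius ρ contains all domains of dependence, and the exponential factor is
deterministic. -/
theorem locDom_of_transport (hB : NetModule B) (hlam : StripBound P lam)
    (hf : ∀ i j, LogBound P (f i j)) (su : ∀ i, SmoothPaths P (u i))
    (hg : ∀ i, LocDom B P p (g i)) (h0 : ∀ i, LocDom B P p (famAxis (u i)))
    (heq : SolvesPathwise P lam f g u) (i : ι) : LocDom B P p (u i) := by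
  intro K hK
  obtain ⟨R, hR0, hKR⟩ := hK.isBounded.subset_closedBall_lt 0 0
  obtain ⟨c, hc⟩ := hlam R
  set C := max c 0 with hC
  have hC0 : 0 ≤ C := le_max_right _ _
  set ρ := R + C * R with hρ
  have hρ0 : 0 ≤ ρ := by positivity
  have hRρ : R ≤ ρ := by
    have : 0 ≤ C * R := by positivity
    linarith
  have hmem : ∀ x t, |x| ≤ ρ → |t| ≤ R → ![x, t] ∈ Metric.closedBall (0 : Fin 2 → ℝ) ρ :=
    fun x t hx ht => by
      rw [mem_closedBall_zero_iff, norm_vec_le_iff hρ0]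
      exact ⟨hx, ht.trans hRρ⟩
  choose F hF HF using fun i j => hf i j _ (isCompact_closedBall (0 : Fin 2 → ℝ) ρ)
  choose mg hmg Hmg using fun i => hg i _ (isCompact_closedBall (0 : Fin 2 → ℝ) ρ)
  choose m0 hm0 Hm0 using fun i => h0 i _ (isCompact_closedBall (0 : Fin 1 → ℝ) ρ)
  -- A single random majorant for all sources and initial data; the absolute values make each
  -- summand nonnegative, so the sum dominates every one of them.
  set S : Eps → Ω → ℝ := ∑ i, ((fun ε ω => |mg i ε ω|) + fun ε ω => |m0 i ε ω|) with hS
  have hSlp : NetLp B P p S := NetLp.sum hB _ fun i => (hmg i).abs.add hB (hm0 i).abs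
  have hFs : LogNet fun ε => ∑ i, ∑ j, F i j ε := LogNet.sum _ fun i => LogNet.sum _ (hF i)
  set Λ : Eps → ℝ := fun ε => ∑ i, ∑ j, F i j ε with hΛ
  have hSval : ∀ ε ω, S ε ω = ∑ i, (|mg i ε ω| + |m0 i ε ω|) := fun ε ω => by
    simp [hS, Finset.sum_apply]
  -- The exponent (nΛ + 1)R is rewritten as a Λ + b with a = nR and b = R.
  refine ⟨_, hSlp.smul hB (hFs.moderate_exp (a := Fintype.card ι * R) (by positivity) R),
    fun ε => ?_⟩
  have e1 : ∀ᵐ ω ∂P, ∀ i j, ∀ z ∈ Metric.closedBall (0 : Fin 2 → ℝ) ρ, |f i j ε z ω| ≤ F i j ε :=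
    ae_all_iff.2 fun i => ae_all_iff.2 fun j => HF i j ε
  have e2 := ae_all_iff.2 fun i => Hmg i ε
  have e3 := ae_all_iff.2 fun i => Hm0 i ε
  have e4 := ae_all_iff.2 su
  filter_upwards [e1, e2, e3, e4, hc, heq ε] with ω w1 w2 w3 w4 w5 w6 z hz
  have hz' := hKR hz
  rw [mem_closedBall_zero_iff, ← vec_eta z, norm_vec_le_iff hR0.le] at hz'
  have hterm : ∀ i, |mg i ε ω| + |m0 i ε ω| ≤ S ε ω := fun i => by
    rw [hSval]
    exact Finset.single_le_sum (f := fun i => |mg i ε ω| + |m0 i ε ω|)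
      (fun i _ => by positivity) (Finset.mem_univ i)
  have hS0 : 0 ≤ S ε ω := by
    rw [hSval]; exact Finset.sum_nonneg fun i _ => by positivity
  have hFle : ∀ i j, F i j ε ≤ Λ ε := fun i j =>
    (Finset.single_le_sum (f := fun j => F i j ε) (fun j _ => (hF i j).1 ε)
      (Finset.mem_univ j)).trans (Finset.single_le_sum (f := fun i => ∑ j, F i j ε)
      (fun i _ => Finset.sum_nonneg fun j _ => (hF i j).1 ε) (Finset.mem_univ i))
  have main := abs_le_of_transport (U := fun i y => u i ε y ω) (lam := fun i z => lam i ε z ω)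
    (g := fun i z => g i ε z ω) (f := fun i j z => f i j ε z ω) (R := R) (T := R) (C := C)
    (F := Λ ε) (G := S ε ω) (E := S ε ω) (fun i => w4 i ε) hC0 (hFs.1 ε) hS0
    (fun i x t _ ht => (w5 ε i x t ht).trans (le_max_left _ _))
    (fun i j x t hx ht => (w1 i j _ (hmem x t hx ht)).trans (hFle i j))
    (fun i x t hx ht => (w2 i _ (hmem x t hx ht)).trans
      ((le_abs_self _).trans ((le_add_of_nonneg_right (abs_nonneg _)).trans (hterm i))))
    (fun i x hx => by
      refine (w3 i ![x] ?_).trans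
        ((le_abs_self _).trans ((le_add_of_nonneg_left (abs_nonneg _)).trans (hterm i)))
      rw [mem_closedBall_zero_iff, pi_norm_le_iff_of_nonneg hρ0]
      intro k; simpa using hx)
    w6 i hz'.1 hz'.2
  rw [vec_eta, max_self] at main
  refine main.trans (le_of_eq ?_)
  congr 2
  ring

/-- Loss-free a priori estimate: if the source and the initial data of a transport system have
property `B` up to order `k`, so has the solution. -/
theorem pathBound_of_transport (hB : NetModule B) (mlam : ∀ i, HasBounds ModerateNet P ⊤ (lam i))
    (hlam : StripBound P lam) (hdlam : ∀ i, LogBound P (famD [0] (lam i))) (k : ℕ)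
    (mf : ∀ i j, HasBounds ModerateNet P ⊤ (f i j)) (hf : ∀ i j, LogBound P (f i j))
    (su : ∀ i, SmoothPaths P (u i)) (sg : ∀ i, SmoothPaths P (g i))
    (hg : ∀ i, PathBound B P p k (g i)) (h0 : ∀ i, PathBound B P p k (famAxis (u i)))
    (heq : SolvesPathwise P lam f g u) (i : ι) : PathBound B P p k (u i) := by
  classical
  induction k generalizing f g u i with
  | zero => exact locDom_of_transport hB hlam hf su hg h0 heq i
  | succ k ih =>
    have hu : ∀ i, PathBound B P p k (u i) :=
      ih mf hf su sg (fun i => (hg i).of_succ) (fun i => (h0 i).of_succ) heq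
    have pb : ∀ {a : Family Ω 2}, HasBounds ModerateNet P ⊤ a → PathBound ModerateNet P ⊤ k a :=
      fun ha => ha.pathBound_plane moderateNet_closed le_top k
    -- Differentiating in x moves -∂_xλ_i u_i' into the zeroth order matrix, where it contributes to
    -- the exponential; hence the logarithmic hypothesis on ∂_xλ_i. The derivatives ∂_x f_ij
    -- multiply u, already controlled to order k, and need only be moderate.
    set g' : ι → Family Ω 2 := fun i => (∑ j, famD [0] (f i j) * u j) + famD [0] (g i) with hg'
    set f' : ι → ι → Family Ω 2 := fun i j =>
      if i = j then f i j + -famD [0] (lam i) else f i j with hf'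
    have sgm : ∀ i j, SmoothPaths P (famD [0] (f i j) * u j) := fun i j =>
      ((mf i j).partialD 0).smooth.mul (su j)
    have hv : ∀ i, PathBound B P p k (famD [0] (u i)) := by
      refine ih (f := f') (g := g') (u := fun i => famD [0] (u i)) (fun i j => ?_) (fun i j => ?_)
        (fun i => (su i).famD 0) (fun i => ?_) (fun i => ?_) (fun i => ?_) (fun ε => ?_)
      · simp only [hf']
        split_ifs
        · exact (mf i j).add moderateNet_closed ((mlam i).partialD 0).neg
        · exact mf i j
      · simp only [hf']
        split_ifs
        · exact (hf i j).add (hdlam i).neg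
        · exact hf i j
      · exact (SmoothPaths.sum _ (sgm i)).add ((sg i).famD 0)
      · exact (PathBound.sum hB _ (sgm i) fun j => PathBound.mul hB ((mf i j).partialD 0).smooth
          (su j) (pb ((mf i j).partialD 0)) (hu j)).add hB (SmoothPaths.sum _ (sgm i))
          ((sg i).famD 0) ((hg i).2 0)
      · refine ((h0 i).2 0).congr fun ε => ?_
        filter_upwards [su i] with ω hω x
        exact congrFun (iterPartial_axis [0] (hω ε)) x
      · have e1 := ae_all_iff.2 su
        have e2 := ae_all_iff.2 sg
        have e3 := ae_all_iff.2 fun i => (mlam i).smooth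
        have e4 := ae_all_iff.2 fun i => ae_all_iff.2 fun j => (mf i j).smooth
        filter_upwards [heq ε, e1, e2, e3, e4] with ω w w1 w2 w3 w4 i z
        rw [← vec_eta z]
        set x := z 0
        set t := z 1
        have dL := (hasDerivAt_slice_fst (contDiff_partialD (w1 i ε) 1) x t).fun_add
          ((hasDerivAt_slice_fst (w3 i ε) x t).fun_mul
            (hasDerivAt_slice_fst (contDiff_partialD (w1 i ε) 0) x t))
        have dR := (HasDerivAt.fun_sum (u := Finset.univ) fun j _ =>
          (hasDerivAt_slice_fst (w4 i j ε) x t).fun_mul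
            (hasDerivAt_slice_fst (w1 j ε) x t)).fun_add (hasDerivAt_slice_fst (w2 i ε) x t)
        -- The equation holds at every y on the line, so both sides are the same function of y and
        -- have the same derivative.
        have hfun := funext fun y => w i ![y, t]
        have hE := (hfun ▸ dL).unique dR
        have c1 : famD [1] (famD [0] (u i)) ε ![x, t] ω =
            partialD 0 (partialD 1 fun y => u i ε y ω) ![x, t] :=
          congrFun (partialD_comm (w1 i ε) 1 0) _
        have c2 : ∑ j, f' i j ε ![x, t] ω * famD [0] (u j) ε ![x, t] ω =
            (∑ j, f i j ε ![x, t] ω * famD [0] (u j) ε ![x, t] ω)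
            - famD [0] (lam i) ε ![x, t] ω * famD [0] (u i) ε ![x, t] ω := by
          have : ∀ j, f' i j ε ![x, t] ω * famD [0] (u j) ε ![x, t] ω =
              f i j ε ![x, t] ω * famD [0] (u j) ε ![x, t] ω - if i = j then
              famD [0] (lam i) ε ![x, t] ω * famD [0] (u j) ε ![x, t] ω else 0 := by
            intro j
            by_cases hij : i = j
            · simp only [hf', if_pos hij]
              change (f i j ε ![x, t] ω + -famD [0] (lam i) ε ![x, t] ω) * _ = _
              ring
            · simp only [hf', if_neg hij, sub_zero]
          simp only [this, Finset.sum_sub_distrib, Finset.sum_ite_eq, Finset.mem_univ, if_true]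
        have c3 : g' i ε ![x, t] ω = (∑ j, famD [0] (f i j) ε ![x, t] ω * u j ε ![x, t] ω)
            + famD [0] (g i) ε ![x, t] ω := by
          simp only [hg', Pi.add_apply, Finset.sum_apply, Pi.mul_apply]
        rw [c1, c2, c3]
        rw [Finset.sum_add_distrib] at hE
        change partialD 0 (partialD 1 fun y => u i ε y ω) ![x, t] +
          (famD [0] (lam i) ε ![x, t] ω * famD [0] (u i) ε ![x, t] ω +
            lam i ε ![x, t] ω * famD [0] (famD [0] (u i)) ε ![x, t] ω) =
          (∑ j, famD [0] (f i j) ε ![x, t] ω * u j ε ![x, t] ω) +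
          (∑ j, f i j ε ![x, t] ω * famD [0] (u j) ε ![x, t] ω)
            + famD [0] (g i) ε ![x, t] ω at hE
        linarith
    refine ⟨(hu i).locDom, Fin.forall_fin_two.2 ⟨hv i, ?_⟩⟩
    -- The time derivative is f u + g - λ ∂_x u, and each term is now controlled to order k.
    have sfu : ∀ j, SmoothPaths P (f i j * u j) := fun j => (mf i j).smooth.mul (su j)
    have h1 : PathBound B P p k (((∑ j, f i j * u j) + g i) + -lam i * famD [0] (u i)) :=
      ((PathBound.sum hB _ sfu fun j => PathBound.mul hB (mf i j).smooth (su j) (pb (mf i j))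
        (hu j)).add hB (SmoothPaths.sum _ sfu) (sg i) (hg i).of_succ).add hB
        ((SmoothPaths.sum _ sfu).add (sg i)) ((mlam i).neg.smooth.mul ((su i).famD 0))
        (PathBound.mul hB (mlam i).neg.smooth ((su i).famD 0) (pb (mlam i).neg) (hv i))
    refine h1.congr fun ε => ?_
    filter_upwards [heq ε] with ω w z
    have := w i z
    simp only [Pi.add_apply, Finset.sum_apply, Pi.mul_apply, Pi.neg_apply]
    linarith

end Probability

end ColombeauRF

namespace ColombeauRF

open Set Filter Topology Function

section Probability

variable {Ω : Type*} [MeasurableSpace Ω] {P : Measure Ω} {p : ℝ≥0∞}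

/-! ## Measurability of the Lax–Friedrichs approximations -/

section Measurability

variable {ι : Type*}

/-- Random coefficients and data, measurable at every point. -/
structure AEMeasurableData (P : Measure Ω) (D : Ω → TransportData ι) : Prop where
  lam : ∀ i x t, AEStronglyMeasurable (fun ω => (D ω).lam i x t) P
  f : ∀ i j x t, AEStronglyMeasurable (fun ω => (D ω).f i j x t) P
  g : ∀ i x t, AEStronglyMeasurable (fun ω => (D ω).g i x t) P
  init : ∀ i x, AEStronglyMeasurable (fun ω => (D ω).init i x) P

theorem AEMeasurableData.reverse {D : Ω → TransportData ι} (hD : AEMeasurableData P D) :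
    AEMeasurableData P fun ω => (D ω).reverse :=
  ⟨fun i x t => (hD.lam i x (-t)).neg, fun i j x t => (hD.f i j x (-t)).neg,
    fun i x t => (hD.g i x (-t)).neg, hD.init⟩

variable [Fintype ι]

/-- With deterministic step and numerical speed, each step combines finitely many values by sums and
products, all at points independent of ω. -/
theorem aestronglyMeasurable_lfSeq {D : Ω → TransportData ι} (hD : AEMeasurableData P D)
    (c : ℝ → ℝ) (h : ℝ) (k : ℕ) (i : ι) (x : ℝ) :
    AEStronglyMeasurable (fun ω => lfSeq (D ω) c h k i x) P := by
  induction k generalizing i x with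
  | zero => exact hD.init i x
  | succ k ih =>
    refine ((((ih i _).add (ih i _)).mul_const (2 : ℝ)⁻¹).add
      (((hD.lam i x _).mul ((ih i _).sub (ih i _))).const_mul _)).add
      (AEStronglyMeasurable.const_mul (AEStronglyMeasurable.add ?_ (hD.g i x _)) h)
    exact Finset.aestronglyMeasurable_fun_sum _ fun j _ => (hD.f i j x _).mul (ih j x)

theorem aestronglyMeasurable_lfGlobal {D : Ω → TransportData ι} (hD : AEMeasurableData P D)
    (c : ℝ → ℝ) (N : ℕ) (i : ι) (x t : ℝ) :
    AEStronglyMeasurable (fun ω => lfGlobal (D ω) c N i x t) P := by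
  have key : ∀ {D : Ω → TransportData ι}, AEMeasurableData P D → ∀ t, AEStronglyMeasurable
      (fun ω => lfApprox (D ω) c (lfMesh N) 0 i x t) P := fun hD t => by
    have h0 := fun k => aestronglyMeasurable_lfSeq hD c (lfMesh N) k i x
    simp only [lfApprox, plInterp, iteratedDeriv_zero]
    exact (h0 0).add (Finset.aestronglyMeasurable_fun_sum _ fun k _ =>
      ((h0 (k + 1)).sub (h0 k)).const_mul _)
  exact ((key hD t).add (key hD.reverse (-t))).sub (hD.init i x)

end Measurability

/-! ## Consequences of the assumptions on the coefficients -/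

/-- Taking b = 0 shows that the net is eventually bounded. A bounded net fits the bound C(1 + |log
ε|) thanks to the summand 1. -/
theorem NegligibleNet.logNet {C : Eps → ℝ} (hC : ∀ ε, 0 ≤ C ε) (h : NegligibleNet fun ε => ‖C ε‖ₑ) :
    LogNet C := by
  obtain ⟨D, η, hη, H⟩ := h.2 0 le_rfl
  refine ⟨hC, D, η, D.2, hη, fun ε hε => ?_⟩
  have h1 : ‖C ε‖ₑ ≤ (D : ℝ≥0∞) * ENNReal.ofReal ((ε : ℝ) ^ (0 : ℝ)) := H ε hε
  rw [Real.rpow_zero, ENNReal.ofReal_one, mul_one, Real.enorm_of_nonneg (hC ε)] at h1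
  have h2 : C ε ≤ D := by
    have := ENNReal.toReal_mono ENNReal.coe_ne_top h1
    rwa [ENNReal.toReal_ofReal (hC ε), ENNReal.coe_toReal] at this
  have h3 : (D : ℝ) * 1 ≤ D * (1 + |Real.log ε|) :=
    mul_le_mul_of_nonneg_left (by linarith [abs_nonneg (Real.log ε)]) D.2
  linarith

theorem mk_eq_mk_iff {d : ℕ} {u v : Family Ω d} (hu : u ∈ moderateFamilies P p d)
    (hv : v ∈ moderateFamilies P p d) :
    (QuotientAddGroup.mk ⟨u, hu⟩ : Colombeau P p d) = QuotientAddGroup.mk ⟨v, hv⟩ ↔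
      HasBounds NegligibleNet P p (-u + v) := by
  rw [QuotientAddGroup.eq]
  rfl

/-- The logarithmic bound is given for one representative only. Any other differs by a negligible
family, which is locally dominated by a deterministic negligible net; adding it preserves
logarithmic growth. -/
theorem logBound_of_uniformLocalLogType {u : Family Ω 2} (hu : u ∈ moderateFamilies P ⊤ 2)
    (h : UniformLocalLogType (QuotientAddGroup.mk ⟨u, hu⟩ : Colombeau P ⊤ 2)) : LogBound P u := by
  obtain ⟨v, ⟨hv, hvu⟩, hlog⟩ := h
  have h1 : LogBound P v := by
    intro K hK
    obtain ⟨c, hc, H⟩ := hlog K hK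
    refine ⟨fun ε => c * |Real.log ε|, ⟨fun ε => by positivity, c, 1, hc.le, one_pos,
      fun ε _ => by nlinarith⟩, fun ε => ?_⟩
    filter_upwards [H] with ω hω using hω ε
  have hneg := (mk_eq_mk_iff hv hu).1 hvu
  have h2 : LogBound P (-v + u) := by
    intro K hK
    obtain ⟨C, hC0, hC, H⟩ := (hneg.locDom_plane negligibleNet_closed le_top).exists_const
      (fun _ h => h.1) hK
    exact ⟨C, hC.logNet hC0, H⟩
  have := h1.add h2
  rwa [add_neg_cancel_left] at this

theorem stripBound_of_uniformlyBounded {n : ℕ} {l : Fin n → Family Ω 2}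
    (h : ∀ i, ∀ a b : ℝ, ∃ c : ℝ, 0 < c ∧ ∀ᵐ ω ∂P, ∀ ε : Eps, ∀ x : ℝ, ∀ t ∈ Icc a b,
      |l i ε ![x, t] ω| ≤ c) : StripBound P l := by
  intro T
  choose c hc H using fun i => h i (-T) T
  refine ⟨∑ i, c i, ?_⟩
  filter_upwards [ae_all_iff.2 H] with ω hω ε i x t ht
  exact (hω i ε x t (abs_le.1 ht)).trans
    (Finset.single_le_sum (fun i _ => (hc i).le) (Finset.mem_univ i))

/-! ## The Cauchy problem on representatives -/

/-- The residual `-(∂_t u + λ ∂_x u) + (f u + g)`. -/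
noncomputable def residual {n : ℕ} (l : Fin n → Family Ω 2) (f : Fin n → Fin n → Family Ω 2)
    (g u : Fin n → Family Ω 2) (i : Fin n) : Family Ω 2 :=
  -(famD [1] (u i) + l i * famD [0] (u i)) + ((∑ j, f i j * u j) + g i)

/-- All operations act on representatives, so an equation between classes says that a difference is
negligible. The form -a + b of the residual is the one in which equality of cosets is expressed. -/
theorem solvesCauchy_mk_iff {n : ℕ} {l : Fin n → Family Ω 2} {f : Fin n → Fin n → Family Ω 2}
    {g u : Fin n → Family Ω 2} {u₀ : Fin n → Family Ω 1}
    (hl : ∀ i, l i ∈ moderateFamilies P ⊤ 2) (hf : ∀ i j, f i j ∈ moderateFamilies P ⊤ 2)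
    (hg : ∀ i, g i ∈ moderateFamilies P p 2) (hu : ∀ i, u i ∈ moderateFamilies P p 2)
    (hu₀ : ∀ i, u₀ i ∈ moderateFamilies P p 1) :
    SolvesCauchy (P := P) (p := p) (fun i => QuotientAddGroup.mk ⟨l i, hl i⟩)
      (fun i j => QuotientAddGroup.mk ⟨f i j, hf i j⟩) (fun i => QuotientAddGroup.mk ⟨g i, hg i⟩)
      (fun i => QuotientAddGroup.mk ⟨u₀ i, hu₀ i⟩) (fun i => QuotientAddGroup.mk ⟨u i, hu i⟩) ↔
    (∀ i, HasBounds NegligibleNet P p (residual l f g u i)) ∧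
      ∀ i, HasBounds NegligibleNet P p (-famAxis (u i) + u₀ i) := by
  have hfu : ∀ i j, f i j * u j ∈ moderateFamilies P p 2 := fun i j =>
    HasBounds.mul moderateNet_closed (fun _ _ => ModerateNet.mul) (hf i j) (hu j)
  have hL : ∀ i, famD [1] (u i) + l i * famD [0] (u i) ∈ moderateFamilies P p 2 := fun i =>
    add_mem (HasBounds.partialD (hu i) 1)
      (HasBounds.mul moderateNet_closed (fun _ _ => ModerateNet.mul) (hl i)
        (HasBounds.partialD (hu i) 0))
  have hR : ∀ i, (∑ j, f i j * u j) + g i ∈ moderateFamilies P p 2 := fun i =>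
    add_mem (sum_mem fun j _ => hfu i j) (hg i)
  have eR : ∀ i, (∑ j, (QuotientAddGroup.mk ⟨f i j, hf i j⟩ : Colombeau P ⊤ 2) •
      (QuotientAddGroup.mk ⟨u j, hu j⟩ : Colombeau P p 2)) + QuotientAddGroup.mk ⟨g i, hg i⟩ =
      (QuotientAddGroup.mk ⟨_, hR i⟩ : Colombeau P p 2) := by
    intro i
    have h1 : ∀ j, (QuotientAddGroup.mk ⟨f i j, hf i j⟩ : Colombeau P ⊤ 2) •
      (QuotientAddGroup.mk ⟨u j, hu j⟩ : Colombeau P p 2) =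
        QuotientAddGroup.mk' _ ⟨f i j * u j, hfu i j⟩ := fun j => rfl
    simp only [h1]
    rw [← map_sum]
    change QuotientAddGroup.mk (_ + _) = _
    congr 1
    ext1
    simp
  refine and_congr (forall_congr' fun i => ?_) (forall_congr' fun i => ?_)
  · rw [eR]
    exact mk_eq_mk_iff (hL i) (hR i)
  · exact mk_eq_mk_iff (HasBounds.axis moderateNet_closed (hu i)) (hu₀ i)

/-- Uniqueness. By linearity -u + v solves the system with source residual(u) - residual(v) and with
negligible initial data; the a priori estimate for negligible nets applies at every order. -/
theorem hasBounds_negligible_of_solves {n : ℕ} (hp : 1 ≤ p) {l : Fin n → Family Ω 2}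
    {f : Fin n → Fin n → Family Ω 2} {g u v : Fin n → Family Ω 2} {u₀ : Fin n → Family Ω 1}
    (hl : ∀ i, l i ∈ moderateFamilies P ⊤ 2) (hf : ∀ i j, f i j ∈ moderateFamilies P ⊤ 2)
    (hu : ∀ i, u i ∈ moderateFamilies P p 2) (hv : ∀ i, v i ∈ moderateFamilies P p 2)
    (hstrip : StripBound P l) (hdl : ∀ i, LogBound P (famD [0] (l i)))
    (hlog : ∀ i j, LogBound P (f i j))
    (ru : ∀ i, HasBounds NegligibleNet P p (residual l f g u i))
    (rv : ∀ i, HasBounds NegligibleNet P p (residual l f g v i))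
    (iu : ∀ i, HasBounds NegligibleNet P p (-famAxis (u i) + u₀ i))
    (iv : ∀ i, HasBounds NegligibleNet P p (-famAxis (v i) + u₀ i)) (i : Fin n) :
    HasBounds NegligibleNet P p (-u i + v i) := by
  have su : ∀ i, SmoothPaths P (u i) := fun i => HasBounds.smooth (hu i)
  have sv : ∀ i, SmoothPaths P (v i) := fun i => HasBounds.smooth (hv i)
  have md : ∀ i, HasBounds ModerateNet P p (-u i + v i) := fun i =>
    (HasBounds.neg (hu i)).add moderateNet_closed (hv i)
  have hr : ∀ i, HasBounds NegligibleNet P p (residual l f g u i + -residual l f g v i) := fun i =>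
    (ru i).add negligibleNet_closed (rv i).neg
  have h0 : ∀ i, HasBounds NegligibleNet P p (famAxis (-u i + v i)) := fun i => by
    have := (iu i).add negligibleNet_closed (iv i).neg
    have e : famAxis (-u i + v i) = (-famAxis (u i) + u₀ i) + -(-famAxis (v i) + u₀ i) := by
      funext ε y ω
      simp only [famAxis, Pi.add_apply, Pi.neg_apply]
      ring
    rw [e]; exact this
  refine HasBounds.of_pathBound negligibleNet_closed (md i).smooth
    (fun ε x => ((md i).memLp [] ε x).1) (fun _ h => h.1) fun k => ?_
  refine pathBound_of_transport netModule_negligible (u := fun i => -u i + v i) hl hstrip hdl k hf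
    hlog (fun i => (md i).smooth) (fun i => (hr i).smooth)
    (fun i => (hr i).pathBound_plane negligibleNet_closed hp k)
    (fun i => (h0 i).pathBound_line negligibleNet_closed hp k) (fun ε => ?_) i
  filter_upwards [ae_all_iff.2 su, ae_all_iff.2 sv] with ω w1 w2 i z
  have hD : ∀ k, famD [k] (-u i + v i) ε z ω = -famD [k] (u i) ε z ω + famD [k] (v i) ε z ω := by
    intro k
    have e := congrFun (iterPartial_add [k] (w1 i ε).neg (w2 i ε)) z
    have e' := congrFun (iterPartial_neg [k] (fun y => u i ε y ω)) z
    exact e.trans (congrArg (· + iterPartial [k] (fun y => v i ε y ω) z) e')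
  rw [hD, hD]
  simp only [residual, Pi.add_apply, Pi.neg_apply, Pi.mul_apply, Finset.sum_apply, mul_add,
    mul_neg, Finset.sum_add_distrib, Finset.sum_neg_distrib]
  ring

theorem exists_family_solution {n : ℕ} (hp : 1 ≤ p) {l : Fin n → Family Ω 2}
    {f : Fin n → Fin n → Family Ω 2} {g : Fin n → Family Ω 2} {u₀ : Fin n → Family Ω 1}
    (hl : ∀ i, l i ∈ moderateFamilies P ⊤ 2) (hf : ∀ i j, f i j ∈ moderateFamilies P ⊤ 2)
    (hg : ∀ i, g i ∈ moderateFamilies P p 2) (hu₀ : ∀ i, u₀ i ∈ moderateFamilies P p 1)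
    (hstrip : StripBound P l) (hdl : ∀ i, LogBound P (famD [0] (l i)))
    (hlog : ∀ i j, LogBound P (f i j)) :
    ∃ u : Fin n → Family Ω 2, (∀ i, u i ∈ moderateFamilies P p 2) ∧
      (∀ i, HasBounds NegligibleNet P p (residual l f g u i)) ∧
      ∀ i, HasBounds NegligibleNet P p (-famAxis (u i) + u₀ i) := by
  have sl : ∀ i, SmoothPaths P (l i) := fun i => HasBounds.smooth (hl i)
  have sf : ∀ i j, SmoothPaths P (f i j) := fun i j => HasBounds.smooth (hf i j)
  have sg : ∀ i, SmoothPaths P (g i) := fun i => HasBounds.smooth (hg i)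
  have s0 : ∀ i, SmoothPaths P (u₀ i) := fun i => HasBounds.smooth (hu₀ i)
  choose C hC using hstrip
  -- A positive nondecreasing majorant of the strip bounds, independent of ε and ω: the sum contains
  -- |C k| for k = ⌈t⌉₊, and the scheme needs c > 0.
  set c : ℝ → ℝ := fun t => 1 + ∑ k ∈ Finset.range (⌈t⌉₊ + 1), |C k| with hc
  have hcpos : ∀ t, 0 < c t := fun t => by positivity
  have hcmono : Monotone c := fun s t hst => by
    refine add_le_add_right (Finset.sum_le_sum_of_subset_of_nonneg (Finset.range_mono ?_)
      fun _ _ _ => abs_nonneg _) _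
    exact Nat.succ_le_succ (Nat.ceil_mono hst)
  set D : Eps → Ω → TransportData (Fin n) := fun ε ω =>
    { lam := fun i x t => l i ε ![x, t] ω
      f := fun i j x t => f i j ε ![x, t] ω
      g := fun i x t => g i ε ![x, t] ω
      init := fun i x => u₀ i ε ![x] ω } with hD
  have hDm : ∀ ε, AEMeasurableData P (D ε) := fun ε =>
    ⟨fun i x t => (HasBounds.memLp (hl i) [] ε ![x, t]).1,
      fun i j x t => (HasBounds.memLp (hf i j) [] ε ![x, t]).1,
      fun i x t => (HasBounds.memLp (hg i) [] ε ![x, t]).1,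
      fun i x => (HasBounds.memLp (hu₀ i) [] ε ![x]).1⟩
  have hgood : ∀ᵐ ω ∂P, ∀ ε, (D ε ω).Smooth ∧ ∀ i x t, |(D ε ω).lam i x t| ≤ c |t| := by
    filter_upwards [ae_all_iff.2 sl, ae_all_iff.2 fun i => ae_all_iff.2 (sf i), ae_all_iff.2 sg,
      ae_all_iff.2 s0, ae_all_iff.2 fun k : ℕ => hC k] with ω w1 w2 w3 w4 w5 ε
    refine ⟨⟨fun i => contDiff_uncurry_vec (w1 i ε), fun i j => contDiff_uncurry_vec (w2 i j ε),
      fun i => contDiff_uncurry_vec (w3 i ε), fun i => (w4 i ε).comp ?_⟩, fun i x t => ?_⟩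
    · refine contDiff_pi.2 fun k => ?_
      rw [Subsingleton.elim k 0]
      exact contDiff_id
    · refine (w5 ⌈|t|⌉₊ ε i x t (Nat.le_ceil _)).trans ((le_abs_self _).trans ?_)
      have := Finset.single_le_sum (f := fun k : ℕ => |C k|) (s := Finset.range (⌈|t|⌉₊ + 1))
        (fun _ _ => abs_nonneg _) (Finset.self_mem_range_succ ⌈|t|⌉₊)
      simp only [hc]
      linarith
  -- The implication makes the choice total in ω; on the exceptional null set the value 0 is used.
  have hex : ∀ ε ω, ∃ s : Fin n → ℝ → ℝ → ℝ, ((D ε ω).Smooth ∧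
      ∀ i x t, |(D ε ω).lam i x t| ≤ c |t|) →
      (∀ i, ContDiff ℝ ((⊤ : ℕ∞) : WithTop ℕ∞) (uncurry (s i))) ∧
      (∀ i x, s i x 0 = (D ε ω).init i x) ∧
      (∀ i x t, HasDerivAt (fun r => s i x r) ((D ε ω).rhs t (fun j y => s j y t) i x -
        (D ε ω).lam i x t * deriv (fun y => s i y t) x) t) ∧
      ∀ i x t, Tendsto (fun N => lfGlobal (D ε ω) c N i x t) atTop (𝓝 (s i x t)) := by
    intro ε ω
    by_cases h : (D ε ω).Smooth ∧ ∀ i x t, |(D ε ω).lam i x t| ≤ c |t|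
    · obtain ⟨s, hs⟩ := exists_smooth_solution h.1 hcpos hcmono h.2
      exact ⟨s, fun _ => hs⟩
    · exact ⟨0, fun h' => absurd h' h⟩
  choose s hs using hex
  set u : Fin n → Family Ω 2 := fun i ε z ω => s ε ω i (z 0) (z 1) with hu
  have su : ∀ i, SmoothPaths P (u i) := fun i => by
    filter_upwards [hgood] with ω w ε
    exact ((hs ε ω (w ε)).1 i).comp ((contDiff_apply ℝ ℝ (0 : Fin 2)).prodMk
      (contDiff_apply ℝ ℝ (1 : Fin 2)))
  -- A choice made separately for each ω carries no measurability; it comes from almost sure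
  -- convergence of the explicit approximations.
  have um : ∀ i ε z, AEStronglyMeasurable (u i ε z) P := fun i ε z => by
    refine aestronglyMeasurable_of_tendsto_ae atTop
      (fun N => aestronglyMeasurable_lfGlobal (hDm ε) c N i (z 0) (z 1)) ?_
    filter_upwards [hgood] with ω w
    exact (hs ε ω (w ε)).2.2.2 i (z 0) (z 1)
  have heq : ∀ᵐ ω ∂P, ∀ ε i z, famD [1] (u i) ε z ω + l i ε z ω * famD [0] (u i) ε z ω =
      (∑ j, f i j ε z ω * u j ε z ω) + g i ε z ω := by
    filter_upwards [hgood, ae_all_iff.2 su] with ω w w' ε i z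
    have h1 := (hasDerivAt_slice_fst (w' i ε) (z 0) (z 1)).deriv
    have h2 := (hasDerivAt_slice_snd (w' i ε) (z 0) (z 1)).unique
      ((hs ε ω (w ε)).2.2.1 i (z 0) (z 1))
    rw [vec_eta] at h1 h2
    have h1' : deriv (fun y => s ε ω i y (z 1)) (z 0) = famD [0] (u i) ε z ω := h1
    have h2' : famD [1] (u i) ε z ω = _ := h2
    rw [h2', h1']
    simp only [TransportData.rhs, hD, hu, vec_eta]
    ring
  have hax : ∀ᵐ ω ∂P, ∀ i ε y, famAxis (u i) ε y ω = u₀ i ε y ω := by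
    filter_upwards [hgood] with ω w i ε y
    have e : ![y 0] = y := by ext k; fin_cases k; rfl
    have := (hs ε ω (w ε)).2.1 i (y 0)
    simp only [hD, e] at this
    simpa [famAxis, hu] using this
  have hmod : ∀ i, u i ∈ moderateFamilies P p 2 := fun i => by
    refine HasBounds.of_pathBound moderateNet_closed (su i) (um i) (fun _ h => h.1) fun k => ?_
    refine pathBound_of_transport netModule_moderate hl (fun T => ⟨C T, hC T⟩) hdl k hf hlog su sg
      (fun i => HasBounds.pathBound_plane moderateNet_closed hp (hg i) k) (fun i => ?_)
      (fun ε => heq.mono fun ω w => w ε) i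
    refine (HasBounds.pathBound_line moderateNet_closed hp (hu₀ i) k).congr fun ε => ?_
    filter_upwards [hax] with ω w y using (w i ε y).symm
  refine ⟨u, hmod, fun i => (HasBounds.zero negligibleNet_closed P p).congr ?_,
    fun i => (HasBounds.zero negligibleNet_closed P p).congr ?_⟩
  · filter_upwards [heq] with ω w ε z
    have := w ε i z
    simp only [residual, Pi.add_apply, Pi.neg_apply, Pi.mul_apply, Finset.sum_apply,
      Pi.zero_apply]
    linarith
  · filter_upwards [hax] with ω w ε y
    have := w i ε y
    simp only [Pi.add_apply, Pi.neg_apply, Pi.zero_apply]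
    linarith

end Probability

end ColombeauRF

/-! ### Passage to the quotient -/

theorem theorem5p3 {Ω : Type*} [MeasurableSpace Ω] (P : MeasureTheory.Measure Ω)
    [MeasureTheory.IsProbabilityMeasure P] (p : ENNReal) (hp : 1 ≤ p) (n : ℕ)
    (lam : Fin n → ColombeauRF.Colombeau P ⊤ 2)
    (f : Matrix (Fin n) (Fin n) (ColombeauRF.Colombeau P ⊤ 2))
    (g : Fin n → ColombeauRF.Colombeau P p 2)
    (u₀ : Fin n → ColombeauRF.Colombeau P p 1)
    (hlam : ∀ i, ColombeauRF.UniformlyBoundedOnStrips (lam i))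
    (hdlam : ∀ i, ColombeauRF.UniformLocalLogType (ColombeauRF.pderiv 0 (lam i)))
    (hf : ∀ i j, ColombeauRF.UniformLocalLogType (f i j)) :
    ∃! u : Fin n → ColombeauRF.Colombeau P p 2, ColombeauRF.SolvesCauchy lam f g u₀ u := by
  open ColombeauRF in
  have repr : ∀ {q : ENNReal} {d : ℕ} (U : Colombeau P q d), ∃ (u : Family Ω d)
      (hu : u ∈ moderateFamilies P q d), QuotientAddGroup.mk ⟨u, hu⟩ = U := fun U => by
    obtain ⟨⟨u, hu⟩, h⟩ := QuotientAddGroup.mk_surjective U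
    exact ⟨u, hu, h⟩
  -- For λ the representative must be the one bounded on strips: that bound is global in x, whereas
  -- negligibility is local. The logarithmic type of ∂_xλ_i is afterwards transferred to this
  -- representative, and the other coefficients and data may be represented arbitrarily.
  choose l hlrep hstrip using hlam
  choose ml hl using hlrep
  choose f' mf hf' using fun i j => repr (f i j)
  choose g' mg hg using fun i => repr (g i)
  choose v₀ mv₀ hv₀ using fun i => repr (u₀ i)
  obtain rfl : (fun i => QuotientAddGroup.mk ⟨l i, ml i⟩) = lam := funext hl
  obtain rfl : (fun i j => QuotientAddGroup.mk ⟨f' i j, mf i j⟩) = f :=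
    funext fun i => funext fun j => hf' i j
  obtain rfl : (fun i => QuotientAddGroup.mk ⟨g' i, mg i⟩) = g := funext hg
  obtain rfl : (fun i => QuotientAddGroup.mk ⟨v₀ i, mv₀ i⟩) = u₀ := funext hv₀
  have hs := ColombeauRF.stripBound_of_uniformlyBounded hstrip
  have hdl := fun i => ColombeauRF.logBound_of_uniformLocalLogType
    (ColombeauRF.HasBounds.partialD (ml i) 0) (hdlam i)
  have hlog := fun i j => ColombeauRF.logBound_of_uniformLocalLogType (mf i j) (hf i j)
  obtain ⟨u, mu, ru, iu⟩ := ColombeauRF.exists_family_solution hp ml mf mg mv₀ hs hdl hlog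
  refine ⟨fun i => QuotientAddGroup.mk ⟨u i, mu i⟩,
    (ColombeauRF.solvesCauchy_mk_iff ml mf mg mu mv₀).2 ⟨ru, iu⟩, fun V hV => ?_⟩
  choose v mv hv using fun i => repr (V i)
  obtain rfl : (fun i => QuotientAddGroup.mk ⟨v i, mv i⟩) = V := funext hv
  obtain ⟨rv, iv⟩ := (ColombeauRF.solvesCauchy_mk_iff ml mf mg mv mv₀).1 hV
  funext i
  exact (ColombeauRF.mk_eq_mk_iff (mv i) (mu i)).2
    (ColombeauRF.hasBounds_negligible_of_solves hp ml mf mv mu hs hdl hlog rv ru iv iu i)
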